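/- Let $d>0$, $\mathbb{R}_+=[0,\infty)$, and let $\sigma,\alpha\in L^\infty(\mathbb{R}_+)$ be real-valued. Let $\Omega=\{(x,y)\in\mathbb{R}_+^2 : |x-y|\le d\}$ and let $-\Delta^d_{\sigma,\alpha}$ be the operator in $L^2(\Omega)$ (complex-valued functions) associated with the quadratic form $$q[\varphi]=\int_\Omega|\nabla\varphi|^2\,dx\,dy-\int_0^d\sigma(y)\bigl(|\varphi(y,0)|^2+|\varphi(0,y)|^2\bigr)\,dy+\int_0^\infty\alpha(y)|\varphi(y,y)|^2\,dy$$ with form domain $\{\varphi\in H^1(\Omega): \varphi=0 \text{ on } |x-y|=d\}$, where boundary and diagonal values are understood as traces; that is, $u$ is in the operator domain and is mapped to $f$ if and only if $u$ is in the form domain and $q(v,u)=\langle v,f\rangle$ for every $v$ in the form domain. Let $\sigma_{ess}$ denote the essential spectrum, i.e. the spectrum without the isolated eigenvalues of finite multiplicity. Then $$\Bigl[\tfrac{2\pi^2}{d^2},\infty\Bigr)\subset\sigma_{ess}(-\Delta^d_{\sigma,\alpha}).$$ If moreover $\alpha(y)\to0$ as $y\to\infty$ (in the sense of $L^\infty$: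 for every $\varepsilon>0$ there is $R$ with $|\alpha|<\varepsilon$ a.e. on $[R,\infty)$), then $$\sigma_{ess}(-\Delta^d_{\sigma,\alpha})=\Bigl[\tfrac{\pi^2}{2d^2},\infty\Bigr).$$ -/

import Mathlib

open MeasureTheory Set Filter Topology
open scoped ContDiff

noncomputable section

namespace Pencil

/-! ### Spectrum of an unbounded operator on a complex Hilbert space -/

section Spectrum

variable {H : Type*} [NormedAddCommGroup H] [InnerProductSpace ℂ H]

/-- `z` belongs to the resolvent set of `A`: the map `A - z` from the domain of `A` to `H` has a
bounded everywhere defined inverse `R`. -/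
def IsRegularValue (A : H →ₗ.[ℂ] H) (z : ℂ) : Prop :=
  ∃ R : H →L[ℂ] H,
    (∀ f : H, ∃ u : A.domain, (u : H) = R f ∧ A u - z • (u : H) = f) ∧
    (∀ u : A.domain, R (A u - z • (u : H)) = u)

/-- The spectrum of an unbounded operator. -/
def opSpectrum (A : H →ₗ.[ℂ] H) : Set ℂ := {z | ¬ IsRegularValue A z}

/-- The kernel of `A - z`. -/
def opEigenspace (A : H →ₗ.[ℂ] H) (z : ℂ) : Submodule ℂ H where
  carrier := {u | ∃ v : A.domain, (v : H) = u ∧ A v = z • u}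
  zero_mem' := ⟨0, by simp, by simp⟩
  add_mem' := by
    rintro _ _ ⟨v, rfl, hv⟩ ⟨w, rfl, hw⟩
    exact ⟨v + w, by simp, by rw [LinearPMap.map_add, hv, hw, smul_add]⟩
  smul_mem' := by
    rintro c _ ⟨v, rfl, hv⟩
    exact ⟨c • v, by simp, by rw [LinearPMap.map_smul, hv, smul_comm]⟩

/-- The discrete spectrum: isolated points of the spectrum that are eigenvalues of finite
multiplicity. -/
def discreteSpectrum (A : H →ₗ.[ℂ] H) : Set ℂ :=
  {z | (∃ ε : ℝ, 0 < ε ∧ opSpectrum A ∩ Metric.ball z ε = {z}) ∧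
    opEigenspace A z ≠ ⊥ ∧ FiniteDimensional ℂ (opEigenspace A z)}

/-- The essential spectrum: the complement of the discrete spectrum in the spectrum. -/
def essentialSpectrum (A : H →ₗ.[ℂ] H) : Set ℂ := opSpectrum A \ discreteSpectrum A

end Spectrum

/-! ### The domain and the function spaces -/

/-- The pencil-shaped domain `{(x, y) : 0 ≤ x, 0 ≤ y, |x - y| ≤ d}`. -/
def pencil (d : ℝ) : Set (ℝ × ℝ) := {p | 0 ≤ p.1 ∧ 0 ≤ p.2 ∧ |p.1 - p.2| ≤ d}

/-- The Hilbert space `L²(Ω)`. -/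
abbrev L2Pencil (d : ℝ) : Type := Lp ℂ 2 (volume.restrict (pencil d))

/-- `L²([0, d])`, for the boundary values on each of the two segments of `∂Ω` on the axes. -/
abbrev L2Seg (d : ℝ) : Type := Lp ℂ 2 (volume.restrict (Icc (0 : ℝ) d))

/-- `L²([0, ∞))`, for the values along the diagonal and along the two rays `|x - y| = d`. -/
abbrev L2Ray : Type := Lp ℂ 2 (volume.restrict (Ici (0 : ℝ)))

/-- Real-valued elements of `L^∞([0, ∞))`. -/
abbrev LInftyRay : Type := Lp ℝ ⊤ (volume.restrict (Ici (0 : ℝ)))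

/-- A function in `L²(Ω)` together with its two first partial derivatives and its traces
`y ↦ φ(y, 0)` and `y ↦ φ(0, y)` on `[0, d]` and `y ↦ φ(y, y)` on `[0, ∞)`. -/
abbrev Jet (d : ℝ) : Type :=
  L2Pencil d × L2Pencil d × L2Pencil d × L2Seg d × L2Seg d × L2Ray

namespace Jet

variable {d : ℝ}

abbrev val (U : Jet d) : L2Pencil d := U.1
abbrev dx (U : Jet d) : L2Pencil d := U.2.1
abbrev dy (U : Jet d) : L2Pencil d := U.2.2.1
abbrev bottom (U : Jet d) : L2Seg d := U.2.2.2.1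
abbrev left (U : Jet d) : L2Seg d := U.2.2.2.2.1
abbrev diag (U : Jet d) : L2Ray := U.2.2.2.2.2

end Jet

/-- The directional derivative of a function on the plane. -/
abbrev pd (v : ℝ × ℝ) (φ : ℝ × ℝ → ℂ) (p : ℝ × ℝ) : ℂ := fderiv ℝ φ p v

/-- `g` is the weak derivative of `u` in the direction `v` in the interior of `Ω`. -/
def IsWeakDeriv (d : ℝ) (v : ℝ × ℝ) (u g : L2Pencil d) : Prop :=
  ∀ φ : ℝ × ℝ → ℂ, ContDiff ℝ ∞ φ → HasCompactSupport φ → tsupport φ ⊆ interior (pencil d) →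
    ∫ p in pencil d, u p * pd v φ p = - ∫ p in pencil d, g p * φ p

/-- `U.val` belongs to `H¹(Ω)`, with weak gradient `(U.dx, U.dy)`. -/
def IsSobolev {d : ℝ} (U : Jet d) : Prop :=
  IsWeakDeriv d (1, 0) U.val U.dx ∧ IsWeakDeriv d (0, 1) U.val U.dy

/-- The functions `f n` converge to `T` in `L²(μ)`. -/
def ConvL2 {X : Type*} [MeasurableSpace X] {μ : Measure X} (f : ℕ → X → ℂ) (T : Lp ℂ 2 μ) : Prop :=
  Tendsto (fun n => eLpNorm (fun x => f n x - T x) 2 μ) atTop (𝓝 0)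

/-- `U.bottom`, `U.left`, `U.diag`, `lower` and `upper` are the traces of `U.val` on the segments
`{(y, 0)}`, `{(0, y)}`, `0 ≤ y ≤ d`, and on the rays `{(y, y)}`, `{(y + d, y)}`, `{(y, y + d)}`,
`0 ≤ y`.  Traces are obtained by continuity from the smooth functions: some sequence in
`C_c^∞(ℝ²)` converges to `U.val` in the norm of `H¹(Ω)`, and its restrictions to these curves
converge to the traces in `L²`. -/
def HasTraces {d : ℝ} (U : Jet d) (lower upper : L2Ray) : Prop :=
  ∃ φ : ℕ → ℝ × ℝ → ℂ, (∀ n, ContDiff ℝ ∞ (φ n) ∧ HasCompactSupport (φ n)) ∧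
    ConvL2 φ U.val ∧
    ConvL2 (fun n p => pd (1, 0) (φ n) p) U.dx ∧
    ConvL2 (fun n p => pd (0, 1) (φ n) p) U.dy ∧
    ConvL2 (fun n y => φ n (y, 0)) U.bottom ∧
    ConvL2 (fun n y => φ n (0, y)) U.left ∧
    ConvL2 (fun n y => φ n (y, y)) U.diag ∧
    ConvL2 (fun n y => φ n (y + d, y)) lower ∧
    ConvL2 (fun n y => φ n (y, y + d)) upper

/-- The form domain: functions in `H¹(Ω)` whose trace on `{|x - y| = d}` vanishes, recorded with
their weak gradient and their traces on the axes and on the diagonal. -/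
def InFormDomain {d : ℝ} (U : Jet d) : Prop := IsSobolev U ∧ HasTraces U 0 0

/-- The sesquilinear form (antilinear in the first argument) whose quadratic form is
`∫_Ω |∇φ|² - ∫_0^d σ(y) (|φ(y,0)|² + |φ(0,y)|²) dy + ∫_0^∞ α(y) |φ(y,y)|² dy`. -/
def form {d : ℝ} (σ α : LInftyRay) (V U : Jet d) : ℂ :=
  (∫ p in pencil d, (starRingEnd ℂ (V.dx p) * U.dx p + starRingEnd ℂ (V.dy p) * U.dy p))
    - (∫ y in Icc (0 : ℝ) d, (σ y : ℂ) *
        (starRingEnd ℂ (V.bottom y) * U.bottom y + starRingEnd ℂ (V.left y) * U.left y))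
    + ∫ y in Ici (0 : ℝ), (α y : ℂ) * (starRingEnd ℂ (V.diag y) * U.diag y)

/-! ### Linear structure -/

section Linear

variable {d : ℝ}

theorem integrable_conj_mul {X : Type*} [MeasurableSpace X] {μ : Measure X} (f g : Lp ℂ 2 μ) :
    Integrable (fun x => starRingEnd ℂ (f x) * g x) μ := by
  have h := L2.integrable_inner (𝕜 := ℂ) f g
  simpa [RCLike.inner_apply, mul_comm] using h

theorem integrable_mul_of_lInfty {μ ν : Measure ℝ} (hμ : μ ≪ ν) (τ : Lp ℝ ⊤ ν) {f : ℝ → ℂ}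
    (hf : Integrable f μ) : Integrable (fun y => (τ y : ℂ) * f y) μ := by
  have hm : AEStronglyMeasurable (fun y => ((τ y : ℝ) : ℂ)) μ :=
    Complex.continuous_ofReal.comp_aestronglyMeasurable ((Lp.aestronglyMeasurable τ).mono_ac hμ)
  refine hf.bdd_mul (c := ‖τ‖) hm ?_
  have h1 : ∀ᵐ y ∂ν, ‖τ y‖ ≤ ‖τ‖ := by
    have h2 := ae_le_eLpNormEssSup (f := (τ : ℝ → ℝ)) (μ := ν)
    filter_upwards [h2] with y hy
    rw [Lp.norm_def, eLpNorm_exponent_top]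
    have h3 : eLpNormEssSup (τ : ℝ → ℝ) ν ≠ ⊤ := by
      have := Lp.eLpNorm_ne_top τ
      rwa [eLpNorm_exponent_top] at this
    have h4 := ENNReal.toReal_mono h3 hy
    simpa using h4
  filter_upwards [hμ.ae_le h1] with y hy
  simpa using hy

theorem seg_ac : volume.restrict (Icc (0 : ℝ) d) ≪ volume.restrict (Ici (0 : ℝ)) :=
  (Measure.restrict_mono Icc_subset_Ici_self le_rfl).absolutelyContinuous

theorem integrable_l2_mul {u : L2Pencil d} {φ : ℝ × ℝ → ℂ} (hφ : Continuous φ)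
    (hc : HasCompactSupport φ) :
    Integrable (fun p => u p * φ p) (volume.restrict (pencil d)) :=
  (Lp.memLp u).integrable_mul (q := 2) (hφ.memLp_of_hasCompactSupport hc)

theorem continuous_pd {φ : ℝ × ℝ → ℂ} (hφ : ContDiff ℝ ∞ φ) (v : ℝ × ℝ) :
    Continuous (pd v φ) :=
  (hφ.continuous_fderiv (by simp)).clm_apply continuous_const

theorem hasCompactSupport_pd {φ : ℝ × ℝ → ℂ} (hc : HasCompactSupport φ) (v : ℝ × ℝ) :
    HasCompactSupport (pd v φ) :=
  hc.fderiv_apply (𝕜 := ℝ) v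

theorem pd_add {φ ψ : ℝ × ℝ → ℂ} (hφ : ContDiff ℝ ∞ φ) (hψ : ContDiff ℝ ∞ ψ) (v p : ℝ × ℝ) :
    pd v (φ + ψ) p = pd v φ p + pd v ψ p := by
  have h1 := (hφ.differentiable (by simp)) p
  have h2 := (hψ.differentiable (by simp)) p
  simp [pd, fderiv_add h1 h2]

theorem pd_smul {φ : ℝ × ℝ → ℂ} (hφ : ContDiff ℝ ∞ φ) (c : ℂ) (v p : ℝ × ℝ) :
    pd v (c • φ) p = c * pd v φ p := by
  have h1 := (hφ.differentiable (by simp)) p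
  simp [pd, fderiv_const_smul h1]

theorem IsWeakDeriv.add {v : ℝ × ℝ} {u u' g g' : L2Pencil d} (h : IsWeakDeriv d v u g)
    (h' : IsWeakDeriv d v u' g') : IsWeakDeriv d v (u + u') (g + g') := by
  intro φ hs hc ht
  have e1 : ∫ p in pencil d, (u + u') p * pd v φ p =
      ∫ p in pencil d, (u p * pd v φ p + u' p * pd v φ p) := by
    refine integral_congr_ae ?_
    filter_upwards [Lp.coeFn_add u u'] with p hp
    rw [hp, Pi.add_apply, add_mul]
  have e2 : ∫ p in pencil d, (g + g') p * φ p =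
      ∫ p in pencil d, (g p * φ p + g' p * φ p) := by
    refine integral_congr_ae ?_
    filter_upwards [Lp.coeFn_add g g'] with p hp
    rw [hp, Pi.add_apply, add_mul]
  have hp := continuous_pd hs v
  have hpc := hasCompactSupport_pd hc v
  rw [e1, e2, integral_add (integrable_l2_mul hp hpc) (integrable_l2_mul hp hpc),
    integral_add (integrable_l2_mul hs.continuous hc) (integrable_l2_mul hs.continuous hc),
    h φ hs hc ht, h' φ hs hc ht, neg_add]

theorem IsWeakDeriv.smul {v : ℝ × ℝ} {u g : L2Pencil d} (c : ℂ) (h : IsWeakDeriv d v u g) :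
    IsWeakDeriv d v (c • u) (c • g) := by
  intro φ hs hc ht
  have e1 : ∫ p in pencil d, (c • u) p * pd v φ p =
      ∫ p in pencil d, c * (u p * pd v φ p) := by
    refine integral_congr_ae ?_
    filter_upwards [Lp.coeFn_smul c u] with p hp
    rw [hp, Pi.smul_apply, smul_eq_mul, mul_assoc]
  have e2 : ∫ p in pencil d, (c • g) p * φ p = ∫ p in pencil d, c * (g p * φ p) := by
    refine integral_congr_ae ?_
    filter_upwards [Lp.coeFn_smul c g] with p hp
    rw [hp, Pi.smul_apply, smul_eq_mul, mul_assoc]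
  rw [e1, e2, integral_const_mul, integral_const_mul, h φ hs hc ht, mul_neg]

theorem ConvL2.add {X : Type*} [MeasurableSpace X] {μ : Measure X} {f g : ℕ → X → ℂ}
    {S T : Lp ℂ 2 μ} (hf : ConvL2 f S) (hg : ConvL2 g T)
    (mf : ∀ n, AEStronglyMeasurable (f n) μ) (mg : ∀ n, AEStronglyMeasurable (g n) μ) :
    ConvL2 (fun n x => f n x + g n x) (S + T) := by
  have hlim : Tendsto (fun n => eLpNorm (fun x => f n x - S x) 2 μ +
      eLpNorm (fun x => g n x - T x) 2 μ) atTop (𝓝 0) := by simpa using Tendsto.add hf hg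
  refine tendsto_of_tendsto_of_tendsto_of_le_of_le tendsto_const_nhds hlim
    (fun _ => zero_le) (fun n => ?_)
  have hae : (fun x => f n x + g n x - (S + T : Lp ℂ 2 μ) x) =ᵐ[μ]
      (fun x => f n x - S x) + (fun x => g n x - T x) := by
    filter_upwards [Lp.coeFn_add S T] with x hx
    simp only [hx, Pi.add_apply]
    ring
  simp only
  rw [eLpNorm_congr_ae hae]
  exact eLpNorm_add_le ((mf n).sub (Lp.aestronglyMeasurable S))
    ((mg n).sub (Lp.aestronglyMeasurable T)) (by norm_num)

theorem ConvL2.smul {X : Type*} [MeasurableSpace X] {μ : Measure X} {f : ℕ → X → ℂ}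
    {S : Lp ℂ 2 μ} (c : ℂ) (hf : ConvL2 f S) : ConvL2 (fun n x => c * f n x) (c • S) := by
  have hlim : Tendsto (fun n => ‖c‖ₑ * eLpNorm (fun x => f n x - S x) 2 μ) atTop (𝓝 0) := by
    simpa using ENNReal.Tendsto.const_mul hf (Or.inr enorm_ne_top)
  refine hlim.congr (fun n => ?_)
  have hae : (fun x => c * f n x - (c • S : Lp ℂ 2 μ) x) =ᵐ[μ]
      c • (fun x => f n x - S x) := by
    filter_upwards [Lp.coeFn_smul c S] with x hx
    simp only [hx, Pi.smul_apply, smul_eq_mul]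
    ring
  rw [eLpNorm_congr_ae hae, eLpNorm_const_smul]

theorem ConvL2.zero {X : Type*} [MeasurableSpace X] {μ : Measure X} :
    ConvL2 (fun _ _ => 0) (0 : Lp ℂ 2 μ) := by
  refine tendsto_const_nhds.congr (fun n => ?_)
  have : (fun x => (0 : ℂ) - (0 : Lp ℂ 2 μ) x) =ᵐ[μ] 0 := by
    filter_upwards [Lp.coeFn_zero ℂ 2 μ] with x hx
    rw [hx, Pi.zero_apply, sub_zero]
  rw [eLpNorm_congr_ae this, eLpNorm_zero]

theorem InFormDomain.zero : InFormDomain (0 : Jet d) := by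
  have hw : ∀ v, IsWeakDeriv d v 0 0 := fun v φ _ _ _ => by
    have h0 := Lp.coeFn_zero ℂ 2 (volume.restrict (pencil d))
    have h : ∀ ψ : ℝ × ℝ → ℂ, ∫ p in pencil d, (0 : L2Pencil d) p * ψ p = 0 := fun ψ => by
      rw [← integral_zero (ℝ × ℝ) ℂ (μ := volume.restrict (pencil d))]
      refine integral_congr_ae ?_
      filter_upwards [h0] with p hp
      rw [hp, Pi.zero_apply, zero_mul]
    rw [h, h, neg_zero]
  refine ⟨⟨hw _, hw _⟩, fun _ _ => 0, fun _ => ⟨contDiff_const, HasCompactSupport.zero⟩,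
    ConvL2.zero, ?_, ?_, ConvL2.zero, ConvL2.zero, ConvL2.zero, ConvL2.zero, ConvL2.zero⟩ <;>
  · simp only [pd, fderiv_const_apply]
    exact ConvL2.zero

theorem InFormDomain.add {U V : Jet d} (hU : InFormDomain U) (hV : InFormDomain V) :
    InFormDomain (U + V) := by
  obtain ⟨⟨hx, hy⟩, φ, hφ, a0, a1, a2, a3, a4, a5, a6, a7⟩ := hU
  obtain ⟨⟨hx', hy'⟩, ψ, hψ, b0, b1, b2, b3, b4, b5, b6, b7⟩ := hV
  have cφ : ∀ n, Continuous (φ n) := fun n => (hφ n).1.continuous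
  have cψ : ∀ n, Continuous (ψ n) := fun n => (hψ n).1.continuous
  have mx : ∀ {μ : Measure ℝ} {γ : ℕ → ℝ × ℝ → ℂ}, (∀ n, Continuous (γ n)) →
      ∀ k : ℝ → ℝ × ℝ, Continuous k → ∀ n, AEStronglyMeasurable (fun y => γ n (k y)) μ :=
    fun hγ k hk n => ((hγ n).comp hk).aestronglyMeasurable
  refine ⟨⟨hx.add hx', hy.add hy'⟩, fun n => φ n + ψ n,
    fun n => ⟨(hφ n).1.add (hψ n).1, (hφ n).2.add (hψ n).2⟩,
    a0.add b0 (fun n => (cφ n).aestronglyMeasurable) (fun n => (cψ n).aestronglyMeasurable),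
    ?_, ?_,
    a3.add b3 (mx cφ _ (by fun_prop)) (mx cψ _ (by fun_prop)),
    a4.add b4 (mx cφ _ (by fun_prop)) (mx cψ _ (by fun_prop)),
    a5.add b5 (mx cφ _ (by fun_prop)) (mx cψ _ (by fun_prop)), ?_, ?_⟩
  · simp only [pd_add (hφ _).1 (hψ _).1]
    exact a1.add b1 (fun n => (continuous_pd (hφ n).1 _).aestronglyMeasurable)
      (fun n => (continuous_pd (hψ n).1 _).aestronglyMeasurable)
  · simp only [pd_add (hφ _).1 (hψ _).1]
    exact a2.add b2 (fun n => (continuous_pd (hφ n).1 _).aestronglyMeasurable)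
      (fun n => (continuous_pd (hψ n).1 _).aestronglyMeasurable)
  · have := a6.add b6 (mx cφ _ (by fun_prop)) (mx cψ _ (by fun_prop))
    rwa [add_zero] at this
  · have := a7.add b7 (mx cφ _ (by fun_prop)) (mx cψ _ (by fun_prop))
    rwa [add_zero] at this

theorem InFormDomain.smul {U : Jet d} (c : ℂ) (hU : InFormDomain U) : InFormDomain (c • U) := by
  obtain ⟨⟨hx, hy⟩, φ, hφ, a0, a1, a2, a3, a4, a5, a6, a7⟩ := hU
  refine ⟨⟨hx.smul c, hy.smul c⟩, fun n => c • φ n,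
    fun n => ⟨contDiff_const.smul (hφ n).1, (hφ n).2.smul_left (f := fun _ => c)⟩,
    a0.smul c, ?_, ?_, a3.smul c, a4.smul c, a5.smul c, ?_, ?_⟩
  · simp only [pd_smul (hφ _).1]
    exact a1.smul c
  · simp only [pd_smul (hφ _).1]
    exact a2.smul c
  · have := a6.smul c
    rwa [smul_zero] at this
  · have := a7.smul c
    rwa [smul_zero] at this

theorem form_add (σ α : LInftyRay) (V U W : Jet d) :
    form σ α V (U + W) = form σ α V U + form σ α V W := by
  have i1 : ∀ Z : Jet d, Integrable (fun p => starRingEnd ℂ (V.dx p) * Z.dx p +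
      starRingEnd ℂ (V.dy p) * Z.dy p) (volume.restrict (pencil d)) := fun Z =>
    (integrable_conj_mul V.dx Z.dx).add (integrable_conj_mul V.dy Z.dy)
  have i2 : ∀ Z : Jet d, Integrable (fun y => (σ y : ℂ) * (starRingEnd ℂ (V.bottom y) * Z.bottom y
      + starRingEnd ℂ (V.left y) * Z.left y)) (volume.restrict (Icc (0 : ℝ) d)) := fun Z =>
    integrable_mul_of_lInfty seg_ac σ
      ((integrable_conj_mul V.bottom Z.bottom).add (integrable_conj_mul V.left Z.left))
  have i3 : ∀ Z : Jet d, Integrable (fun y => (α y : ℂ) * (starRingEnd ℂ (V.diag y) * Z.diag y))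
      (volume.restrict (Ici (0 : ℝ))) := fun Z =>
    integrable_mul_of_lInfty .rfl α (integrable_conj_mul V.diag Z.diag)
  have e1 := integral_add (i1 U) (i1 W)
  have e2 := integral_add (i2 U) (i2 W)
  have e3 := integral_add (i3 U) (i3 W)
  have f1 : ∫ p in pencil d, (starRingEnd ℂ (V.dx p) * (U + W).dx p +
      starRingEnd ℂ (V.dy p) * (U + W).dy p) = (∫ p in pencil d, (starRingEnd ℂ (V.dx p) * U.dx p + starRingEnd ℂ (V.dy p) * U.dy p)) +
      ∫ p in pencil d, (starRingEnd ℂ (V.dx p) * W.dx p + starRingEnd ℂ (V.dy p) * W.dy p) := by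
    rw [← e1]
    refine integral_congr_ae ?_
    filter_upwards [Lp.coeFn_add U.dx W.dx, Lp.coeFn_add U.dy W.dy] with p h h'
    simp only [Jet.dx, Jet.dy, Prod.snd_add, Prod.fst_add] at h h' ⊢
    rw [h, h']
    simp only [Pi.add_apply]
    ring
  have f2 : ∫ y in Icc (0 : ℝ) d, (σ y : ℂ) * (starRingEnd ℂ (V.bottom y) * (U + W).bottom y
      + starRingEnd ℂ (V.left y) * (U + W).left y) = (∫ y in Icc (0 : ℝ) d, (σ y : ℂ) * (starRingEnd ℂ (V.bottom y) * U.bottom y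
      + starRingEnd ℂ (V.left y) * U.left y)) +
      ∫ y in Icc (0 : ℝ) d, (σ y : ℂ) * (starRingEnd ℂ (V.bottom y) * W.bottom y
      + starRingEnd ℂ (V.left y) * W.left y) := by
    rw [← e2]
    refine integral_congr_ae ?_
    filter_upwards [Lp.coeFn_add U.bottom W.bottom, Lp.coeFn_add U.left W.left] with p h h'
    simp only [Jet.bottom, Jet.left, Prod.snd_add, Prod.fst_add] at h h' ⊢
    rw [h, h']
    simp only [Pi.add_apply]
    ring
  have f3 : ∫ y in Ici (0 : ℝ), (α y : ℂ) * (starRingEnd ℂ (V.diag y) * (U + W).diag y) = 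
      (∫ y in Ici (0 : ℝ), (α y : ℂ) * (starRingEnd ℂ (V.diag y) * U.diag y)) +
      ∫ y in Ici (0 : ℝ), (α y : ℂ) * (starRingEnd ℂ (V.diag y) * W.diag y) := by
    rw [← e3]
    refine integral_congr_ae ?_
    filter_upwards [Lp.coeFn_add U.diag W.diag] with p h
    simp only [Jet.diag, Prod.snd_add] at h ⊢
    rw [h]
    simp only [Pi.add_apply]
    ring
  unfold form
  rw [f1, f2, f3]
  ring

theorem form_smul (σ α : LInftyRay) (c : ℂ) (V U : Jet d) :
    form σ α V (c • U) = c * form σ α V U := by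
  have f1 : ∫ p in pencil d, (starRingEnd ℂ (V.dx p) * (c • U).dx p +
      starRingEnd ℂ (V.dy p) * (c • U).dy p) = c * ∫ p in pencil d,
      (starRingEnd ℂ (V.dx p) * U.dx p + starRingEnd ℂ (V.dy p) * U.dy p) := by
    rw [← integral_const_mul]
    refine integral_congr_ae ?_
    filter_upwards [Lp.coeFn_smul c U.dx, Lp.coeFn_smul c U.dy] with p h h'
    simp only [Jet.dx, Jet.dy, Prod.smul_snd, Prod.smul_fst] at h h' ⊢
    rw [h, h']
    simp only [Pi.smul_apply, smul_eq_mul]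
    ring
  have f2 : ∫ y in Icc (0 : ℝ) d, (σ y : ℂ) * (starRingEnd ℂ (V.bottom y) * (c • U).bottom y
      + starRingEnd ℂ (V.left y) * (c • U).left y) = c * ∫ y in Icc (0 : ℝ) d, (σ y : ℂ) *
      (starRingEnd ℂ (V.bottom y) * U.bottom y + starRingEnd ℂ (V.left y) * U.left y) := by
    rw [← integral_const_mul]
    refine integral_congr_ae ?_
    filter_upwards [Lp.coeFn_smul c U.bottom, Lp.coeFn_smul c U.left] with p h h'
    simp only [Jet.bottom, Jet.left, Prod.smul_snd, Prod.smul_fst] at h h' ⊢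
    rw [h, h']
    simp only [Pi.smul_apply, smul_eq_mul]
    ring
  have f3 : ∫ y in Ici (0 : ℝ), (α y : ℂ) * (starRingEnd ℂ (V.diag y) * (c • U).diag y) =
      c * ∫ y in Ici (0 : ℝ), (α y : ℂ) * (starRingEnd ℂ (V.diag y) * U.diag y) := by
    rw [← integral_const_mul]
    refine integral_congr_ae ?_
    filter_upwards [Lp.coeFn_smul c U.diag] with p h
    simp only [Jet.diag, Prod.smul_snd] at h ⊢
    rw [h]
    simp only [Pi.smul_apply, smul_eq_mul]
    ring
  unfold form
  rw [f1, f2, f3]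
  ring

end Linear

/-! ### The operator -/

/-- The graph of the operator associated with the form by the representation theorem: `(u, f)`
such that `u` is in the form domain and `q(v, u) = ⟨v, f⟩` for all `v` in the form domain. -/
def operatorGraph (d : ℝ) (σ α : LInftyRay) : Submodule ℂ (L2Pencil d × L2Pencil d) where
  carrier := {w | ∃ U : Jet d, InFormDomain U ∧ U.val = w.1 ∧
    ∀ V : Jet d, InFormDomain V → form σ α V U = inner ℂ V.val w.2}
  zero_mem' := ⟨0, InFormDomain.zero, rfl, fun V _ => by
    have h := form_smul σ α 0 V 0
    rw [zero_smul, zero_mul] at h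
    rw [h, Prod.snd_zero, inner_zero_right]⟩
  add_mem' := by
    rintro w w' ⟨U, hU, hw, h⟩ ⟨U', hU', hw', h'⟩
    exact ⟨U + U', hU.add hU', congrArg₂ (· + ·) hw hw', fun V hV => by
      rw [form_add, h V hV, h' V hV, Prod.snd_add, inner_add_right]⟩
  smul_mem' := by
    rintro c w ⟨U, hU, hw, h⟩
    exact ⟨c • U, hU.smul c, congrArg (c • ·) hw, fun V hV => by
      rw [form_smul, h V hV, Prod.smul_snd, inner_smul_right]⟩

/-- The open set obtained from `Ω` by removing its boundary and the diagonal. -/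
def slit (d : ℝ) : Set (ℝ × ℝ) := {p | 0 < p.1 ∧ 0 < p.2 ∧ |p.1 - p.2| < d ∧ p.1 ≠ p.2}

theorem isOpen_slit (d : ℝ) : IsOpen (slit d) := by
  have h1 : IsOpen {p : ℝ × ℝ | 0 < p.1} := isOpen_lt continuous_const continuous_fst
  have h2 : IsOpen {p : ℝ × ℝ | 0 < p.2} := isOpen_lt continuous_const continuous_snd
  have h3 : IsOpen {p : ℝ × ℝ | |p.1 - p.2| < d} := isOpen_lt (by fun_prop) continuous_const
  have h4 : IsOpen {p : ℝ × ℝ | p.1 ≠ p.2} := isOpen_ne_fun continuous_fst continuous_snd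
  exact h1.inter (h2.inter (h3.inter h4))

theorem slit_subset (d : ℝ) : slit d ⊆ pencil d := fun _ h => ⟨h.1.le, h.2.1.le, h.2.2.1.le⟩

theorem slit_subset_interior (d : ℝ) : slit d ⊆ interior (pencil d) :=
  interior_maximal (slit_subset d) (isOpen_slit d)

theorem measurableSet_pencil (d : ℝ) : MeasurableSet (pencil d) := by
  have h1 : IsClosed {p : ℝ × ℝ | 0 ≤ p.1} := isClosed_le continuous_const continuous_fst
  have h2 : IsClosed {p : ℝ × ℝ | 0 ≤ p.2} := isClosed_le continuous_const continuous_snd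
  have h3 : IsClosed {p : ℝ × ℝ | |p.1 - p.2| ≤ d} := isClosed_le (by fun_prop) continuous_const
  exact (h1.inter (h2.inter h3)).measurableSet

theorem ae_mem_slit (d : ℝ) : ∀ᵐ p ∂(volume.restrict (pencil d)), p ∈ slit d := by
  rw [ae_restrict_iff' (measurableSet_pencil d)]
  have h1 : ∀ᵐ p : ℝ × ℝ, p.1 ≠ 0 :=
    (Measure.quasiMeasurePreserving_fst (μ := (volume : Measure ℝ))
      (ν := (volume : Measure ℝ))).ae (p := fun x => x ≠ 0) (Measure.ae_ne volume 0)
  have h2 : ∀ k : ℝ, ∀ᵐ p : ℝ × ℝ, p.2 ≠ p.1 + k := fun k => by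
    have hm : MeasurableSet {p : ℝ × ℝ | p.2 ≠ p.1 + k} :=
      (isOpen_ne_fun continuous_snd (by fun_prop)).measurableSet
    exact (Measure.ae_prod_iff_ae_ae hm).2 (ae_of_all _ fun x => Measure.ae_ne volume (x + k))
  have h3 : ∀ᵐ p : ℝ × ℝ, p.2 ≠ 0 :=
    (Measure.quasiMeasurePreserving_snd (μ := (volume : Measure ℝ))
      (ν := (volume : Measure ℝ))).ae (p := fun x => x ≠ 0) (Measure.ae_ne volume 0)
  filter_upwards [h1, h3, h2 0, h2 d, h2 (-d)] with p a1 a2 a3 a4 a5 hp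
  obtain ⟨b1, b2, b3⟩ := hp
  refine ⟨lt_of_le_of_ne b1 (Ne.symm a1), lt_of_le_of_ne b2 (Ne.symm a2),
    lt_of_le_of_ne b3 (fun h => ?_), fun h => a3 (by rw [h, add_zero])⟩
  rcases abs_choice (p.1 - p.2) with h' | h' <;> rw [h'] at h
  · exact a5 (by linarith)
  · exact a4 (by linarith)

theorem eq_zero_of_test {d : ℝ} (f : L2Pencil d)
    (h : ∀ g : ℝ × ℝ → ℝ, ContDiff ℝ ∞ g → HasCompactSupport g → tsupport g ⊆ slit d →
      ∫ p in pencil d, f p * (g p : ℂ) = 0) : f = 0 := by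
  have hl : LocallyIntegrable f (volume.restrict (pencil d)) :=
    (Lp.memLp f).locallyIntegrable (by norm_num)
  have := (isOpen_slit d).ae_eq_zero_of_integral_contDiff_smul_eq_zero
    (hl.locallyIntegrableOn (slit d)) (fun g hg hc ht => by
      rw [← h g hg hc ht]
      refine integral_congr_ae (ae_of_all _ fun p => ?_)
      simp [mul_comm])
  rw [Lp.eq_zero_iff_ae_eq_zero]
  filter_upwards [this, ae_mem_slit d] with p hp hp'
  exact hp hp'

/-- The jet of a smooth function supported away from the boundary and the diagonal. -/
theorem exists_jet {d : ℝ} {φ : ℝ × ℝ → ℂ} (hs : ContDiff ℝ ∞ φ) (hc : HasCompactSupport φ)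
    (ht : tsupport φ ⊆ slit d) :
    ∃ V : Jet d, InFormDomain V ∧ V.val =ᵐ[volume.restrict (pencil d)] φ ∧
      V.bottom = 0 ∧ V.left = 0 ∧ V.diag = 0 := by
  have m0 : MemLp φ 2 (volume.restrict (pencil d)) := hs.continuous.memLp_of_hasCompactSupport hc
  have m : ∀ v, MemLp (pd v φ) 2 (volume.restrict (pencil d)) := fun v =>
    (continuous_pd hs v).memLp_of_hasCompactSupport (hasCompactSupport_pd hc v)
  have hz : ∀ p, p ∉ slit d → φ p = 0 := fun p hp =>
    image_eq_zero_of_notMem_tsupport fun h => hp (ht h)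
  obtain ⟨T, hT⟩ : ∃ T : L2Pencil d, T =ᵐ[volume.restrict (pencil d)] φ :=
    ⟨m0.toLp φ, m0.coeFn_toLp⟩
  have hD' : ∀ v, ∃ D : L2Pencil d, D =ᵐ[volume.restrict (pencil d)] pd v φ := fun v =>
    ⟨(m v).toLp _, (m v).coeFn_toLp⟩
  choose D hD using hD'
  have hconv : ∀ (ψ : ℝ × ℝ → ℂ) (S : L2Pencil d), S =ᵐ[volume.restrict (pencil d)] ψ →
      ConvL2 (fun _ p => ψ p) S := fun ψ S hS => by
    refine tendsto_const_nhds.congr (fun n => ?_)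
    have : (fun x => ψ x - S x) =ᵐ[volume.restrict (pencil d)] 0 := by
      filter_upwards [hS] with x hx
      rw [hx, sub_self, Pi.zero_apply]
    rw [eLpNorm_congr_ae this, eLpNorm_zero]
  have hw : ∀ v, IsWeakDeriv d v T (D v) := fun v ψ hψ hψc hψt => by
    have hout : ∀ p, p ∉ pencil d → p ∉ tsupport ψ := fun p hp h =>
      hp (interior_subset (hψt h))
    have hout' : ∀ p, p ∉ pencil d → pd v ψ p = 0 := fun p hp => by
      have hn : p ∉ tsupport (fderiv ℝ ψ) := fun h => hout p hp (tsupport_fderiv_subset ℝ h)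
      have := image_eq_zero_of_notMem_tsupport hn
      simp [pd, this]
    have e1 : ∫ p in pencil d, T p * pd v ψ p = ∫ p, φ p * pd v ψ p := by
      rw [← setIntegral_eq_integral_of_forall_compl_eq_zero (s := pencil d)
        (f := fun p => φ p * pd v ψ p) (fun p hp => by rw [hout' p hp, mul_zero])]
      refine integral_congr_ae ?_
      filter_upwards [hT] with p hp
      rw [hp]
    have e2 : ∫ p in pencil d, D v p * ψ p = ∫ p, pd v φ p * ψ p := by
      rw [← setIntegral_eq_integral_of_forall_compl_eq_zero (s := pencil d)
        (f := fun p => pd v φ p * ψ p) (fun p hp => by rw [image_eq_zero_of_notMem_tsupport (hout p hp), mul_zero])]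
      refine integral_congr_ae ?_
      filter_upwards [hD v] with p hp
      rw [hp]
    rw [e1, e2]
    refine integral_mul_fderiv_eq_neg_fderiv_mul_of_integrable ?_ ?_ ?_
      (fun x _ => hs.differentiable (by simp) x) (fun x _ => hψ.differentiable (by simp) x)
    · exact ((continuous_pd hs v).mul hψ.continuous).integrable_of_hasCompactSupport hψc.mul_left
    · exact (hs.continuous.mul (continuous_pd hψ v)).integrable_of_hasCompactSupport hc.mul_right
    · exact (hs.continuous.mul hψ.continuous).integrable_of_hasCompactSupport hc.mul_right
  refine ⟨(T, D (1, 0), D (0, 1), 0, 0, 0),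
    ⟨⟨hw _, hw _⟩, fun _ => φ, fun _ => ⟨hs, hc⟩, hconv _ _ hT, hconv _ _ (hD _), hconv _ _ (hD _), ?_, ?_, ?_, ?_, ?_⟩,
    hT, rfl, rfl, rfl⟩
  · have : ∀ y : ℝ, φ (y, 0) = 0 := fun y => hz _ fun h => lt_irrefl _ h.2.1
    simp only [this]
    exact ConvL2.zero
  · have : ∀ y : ℝ, φ (0, y) = 0 := fun y => hz _ fun h => lt_irrefl _ h.1
    simp only [this]
    exact ConvL2.zero
  · have : ∀ y : ℝ, φ (y, y) = 0 := fun y => hz _ fun h => h.2.2.2 rfl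
    simp only [this]
    exact ConvL2.zero
  · have : ∀ y : ℝ, φ (y + d, y) = 0 := fun y => hz _ fun h => by
      have := (le_abs_self _).trans_lt h.2.2.1
      simp at this
    simp only [this]
    exact ConvL2.zero
  · have : ∀ y : ℝ, φ (y, y + d) = 0 := fun y => hz _ fun h => by
      have := (neg_le_abs _).trans_lt h.2.2.1
      simp at this
    simp only [this]
    exact ConvL2.zero

/-- The graph is single-valued, so that it is the graph of an operator. -/
theorem operatorGraph_singleValued (d : ℝ) (σ α : LInftyRay)
    (w : L2Pencil d × L2Pencil d) (hw : w ∈ operatorGraph d σ α) (h0 : w.1 = 0) : w.2 = 0 := by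
  obtain ⟨U, hU, hv, h⟩ := hw
  rw [h0] at hv
  have hd : ∀ (v : ℝ × ℝ) (g : L2Pencil d), IsWeakDeriv d v U.val g → g = 0 := fun v g hg => by
    refine eq_zero_of_test g fun k hk hc ht => ?_
    have hts : tsupport (fun p => (k p : ℂ)) ⊆ tsupport k :=
      closure_mono fun p hp hk0 => hp (by simp [hk0])
    have := hg (fun p => (k p : ℂ)) (Complex.ofRealCLM.contDiff.comp hk)
      (hc.comp_left (g := Complex.ofReal) rfl) (hts.trans (ht.trans (slit_subset_interior d)))
    rw [hv] at this
    have hz : ∫ p in pencil d, (0 : L2Pencil d) p * pd v (fun p => (k p : ℂ)) p = 0 := by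
      rw [← integral_zero (ℝ × ℝ) ℂ (μ := volume.restrict (pencil d))]
      refine integral_congr_ae ?_
      filter_upwards [Lp.coeFn_zero ℂ 2 (volume.restrict (pencil d))] with p hp
      rw [hp, Pi.zero_apply, zero_mul]
    rw [hz] at this
    exact neg_eq_zero.1 this.symm
  have hdx : U.dx = 0 := hd _ _ hU.1.1
  have hdy : U.dy = 0 := hd _ _ hU.1.2
  refine eq_zero_of_test w.2 fun k hk hc ht => ?_
  have hts : tsupport (fun p => (k p : ℂ)) ⊆ tsupport k :=
    closure_mono fun p hp hk0 => hp (by simp [hk0])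
  obtain ⟨V, hV, hVv, hb, hl, hg⟩ := exists_jet (φ := fun p => (k p : ℂ))
    (Complex.ofRealCLM.contDiff.comp hk) (hc.comp_left (g := Complex.ofReal) rfl) (hts.trans ht)
  have hform : form σ α V U = 0 := by
    have z1 := Lp.coeFn_zero ℂ 2 (volume.restrict (pencil d))
    have z2 := Lp.coeFn_zero ℂ 2 (volume.restrict (Icc (0 : ℝ) d))
    have z3 := Lp.coeFn_zero ℂ 2 (volume.restrict (Ici (0 : ℝ)))
    unfold form
    rw [hdx, hdy, hb, hl, hg]
    have i1 : ∫ p in pencil d, (starRingEnd ℂ (V.dx p) * (0 : L2Pencil d) p +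
        starRingEnd ℂ (V.dy p) * (0 : L2Pencil d) p) = 0 := by
      refine integral_eq_zero_of_ae ?_
      filter_upwards [z1] with p hp
      simp only [hp, Pi.zero_apply, mul_zero, add_zero]
    have i2 : ∫ y in Icc (0 : ℝ) d, (σ y : ℂ) * (starRingEnd ℂ ((0 : L2Seg d) y) * U.bottom y
        + starRingEnd ℂ ((0 : L2Seg d) y) * U.left y) = 0 := by
      refine integral_eq_zero_of_ae ?_
      filter_upwards [z2] with p hp
      simp only [hp, Pi.zero_apply, map_zero, zero_mul, mul_zero, add_zero]
    have i3 : ∫ y in Ici (0 : ℝ), (α y : ℂ) * (starRingEnd ℂ ((0 : L2Ray) y) * U.diag y) = 0 := by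
      refine integral_eq_zero_of_ae ?_
      filter_upwards [z3] with p hp
      simp only [hp, Pi.zero_apply, map_zero, zero_mul, mul_zero]
    rw [i1, i2, i3, sub_zero, add_zero]
  have hin := h V hV
  rw [hform, L2.inner_def] at hin
  rw [hin]
  refine integral_congr_ae ?_
  filter_upwards [hVv] with p hp
  rw [RCLike.inner_apply, hp, Complex.conj_ofReal]

/-- The operator `-Δ^d_{σ,α}` in `L²(Ω)` associated with the form. -/
def operator (d : ℝ) (σ α : LInftyRay) : L2Pencil d →ₗ.[ℂ] L2Pencil d :=
  (operatorGraph d σ α).toLinearPMap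

/-- The domain and the action of the operator: `u` is in the domain and is mapped to `f` exactly
when `u` is in the form domain and `q(v, u) = ⟨v, f⟩` for all `v` in the form domain. -/
theorem operator_graph (d : ℝ) (σ α : LInftyRay) :
    (operator d σ α).graph = operatorGraph d σ α :=
  Submodule.toLinearPMap_graph_eq _ (operatorGraph_singleValued d σ α)

end Pencil

end

/-!
The form domain is a Hilbert space `FormSpace d`: a closed subspace of the `L²` space of jets
`(u, ∂ₓu, ∂ᵧu, traces)`. The form is represented there by a bounded symmetric operator `formOp`,
so that `-Δ` fits the abstract situation `IsFormOperator`, in which a trace inequality supplies the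
Gårding inequality. All inequalities are proved for smooth functions and extended to the form domain
by density (`InFormDomain.induction`); terms that involve the values on `|x - y| = d` drop out in
the limit.

*Upper bound of the essential spectrum* (`essentialSpectrum_subset`). It suffices to bound the form
below by any `Λ < π² / (2 d²)` up to a form of finite rank
(`IsFormOperator.notMem_essentialSpectrum`, by the Fredholm alternative). Cut the pencil at
`x + y = R`. Beyond the cut, in the coordinates `(x + y, x - y)`, it is a half-strip in which the
transverse operator with Dirichlet conditions at `±d` has lowest eigenvalue
`2 (π / (2 d))² = π² / (2 d²)`; this bound comes from Jacobi's factorization with the weight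
`μ tan (μ t + δ)`, and for `μ < π / d` it leaves room for the small contribution of `α`
(`far_inequality`). Before the cut the domain is bounded and convex, the boundary terms are absorbed
by the trace inequality, and the Poincaré inequality on the cells of a fine grid (`exists_cells`)
gives an arbitrarily large lower bound up to finitely many means.

*Lower bound* (`mem_opSpectrum_of_mode`). Products `c (x + y) h (x - y)`, where `c` is a slowly
modulated wave `e^{iks}` with support far away and `h` is a Dirichlet mode of `(-d, d)` with
`h'' = -ν² h`, are approximate eigenfunctions for `2 k² + 2 ν²`. The odd mode `sin (π t / d)`
vanishes on the diagonal, does not feel `α` and yields `[2 π² / d², ∞)`; if `α` tends to zero, the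
even mode `cos (π t / (2 d))` yields `[π² / (2 d²), ∞)`. Points of a half-line in the spectrum are
not isolated, so both half-lines are in the essential spectrum.
-/

noncomputable section

namespace Pencil

section

/-! ### Operators associated with forms on a Hilbert space -/

section Abstract

variable {H V W : Type*} [NormedAddCommGroup H] [InnerProductSpace ℂ H]
  [NormedAddCommGroup V] [InnerProductSpace ℂ V]
  [NormedAddCommGroup W] [InnerProductSpace ℂ W] [FiniteDimensional ℂ W]

/-- `A` is the operator in `H` associated with the closed, symmetric, semibounded form
`(X, U) ↦ ⟪X, T U⟫` whose form domain is the Hilbert space `V`, mapped to `H` by `J`. -/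
structure IsFormOperator (A : H →ₗ.[ℂ] H) (J : V →L[ℂ] H) (T : V →L[ℂ] V) : Prop where
  mem_graph_iff : ∀ u f : H, (u, f) ∈ A.graph ↔
    ∃ U : V, J U = u ∧ ∀ X : V, inner ℂ X (T U) = inner ℂ (J X) f
  symm : ∀ X U : V, inner ℂ (T X) U = inner ℂ X (T U)
  garding : ∃ κ c : ℝ, 0 < κ ∧ ∀ U : V, κ * ‖U‖ ^ 2 ≤ (inner ℂ U (T U)).re + c * ‖J U‖ ^ 2

namespace IsFormOperator

variable {A : H →ₗ.[ℂ] H} {J : V →L[ℂ] H} {T : V →L[ℂ] V}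

theorem im_inner_self (hA : IsFormOperator A J T) (U : V) : (inner ℂ U (T U)).im = 0 := by
  have h := hA.symm U U
  rw [← inner_conj_symm] at h
  exact Complex.conj_eq_iff_im.1 h

theorem inner_self_eq (hA : IsFormOperator A J T) (U : V) :
    inner ℂ U (T U) = ((inner ℂ U (T U)).re : ℂ) :=
  Complex.ext (by simp) (by simp [hA.im_inner_self])

theorem exists_of_mem_opEigenspace (hA : IsFormOperator A J T) {z : ℂ} {u : H}
    (hu : u ∈ opEigenspace A z) :
    ∃ U : V, J U = u ∧ ∀ X, inner ℂ X (T U) = z * inner ℂ (J X) (J U) := by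
  obtain ⟨v, rfl, hv⟩ := hu
  obtain ⟨U, hU, h⟩ := (hA.mem_graph_iff _ _).1 (A.mem_graph v)
  exact ⟨U, hU, fun X => by rw [h X, hv, inner_smul_right, hU]⟩

theorem mem_opEigenspace (hA : IsFormOperator A J T) {z : ℂ} {U : V}
    (hU : ∀ X, inner ℂ X (T U) = z * inner ℂ (J X) (J U)) : J U ∈ opEigenspace A z := by
  have : (J U, z • J U) ∈ A.graph :=
    (hA.mem_graph_iff _ _).2 ⟨U, rfl, fun X => by rw [hU X, inner_smul_right]⟩
  obtain ⟨y, h1, h2⟩ := LinearPMap.mem_graph_iff _ |>.1 this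
  exact ⟨y, h1, h2⟩

/-- Weyl's criterion in terms of the form: the approximate eigenvectors need only lie in the form
domain, with a remainder that is small in the dual of the form domain. -/
theorem mem_opSpectrum (hA : IsFormOperator A J T) {lam : ℝ}
    (h : ∀ ε : ℝ, 0 < ε → ∃ U : V, J U ≠ 0 ∧ ∀ X : V,
      ‖inner ℂ X (T U) - lam * inner ℂ (J X) (J U)‖ ≤ ε * ‖X‖ * ‖J U‖) :
    (lam : ℂ) ∈ opSpectrum A := by
  rintro ⟨R, hR, -⟩
  obtain ⟨κ, c, hκ, hg⟩ := hA.garding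
  set M : ℝ := ‖R‖ * (1 + |lam| * ‖R‖) + |c| * ‖R‖ ^ 2 with hM
  have hM0 : 0 ≤ M := by positivity
  set C : ℝ := Real.sqrt (M / κ)
  have hC : 0 ≤ C := Real.sqrt_nonneg _
  obtain ⟨U, hU0, hU⟩ := h (1 / (2 * (C + 1))) (by positivity)
  -- the remainder is tested with the solution `v` of `(A - lam) v = J U`
  obtain ⟨v, hv, hv'⟩ := hR (J U)
  obtain ⟨X, hX, hXg⟩ := (hA.mem_graph_iff _ _).1 (A.mem_graph v)
  have hAv : A v = J U + (lam : ℂ) • (v : H) := by rw [← hv']; abel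
  have hvn : ‖(v : H)‖ ≤ ‖R‖ * ‖J U‖ := hv ▸ R.le_opNorm _
  have hAvn : ‖A v‖ ≤ (1 + |lam| * ‖R‖) * ‖J U‖ := by
    rw [hAv]
    refine (norm_add_le _ _).trans ?_
    rw [norm_smul, Complex.norm_real, Real.norm_eq_abs]
    nlinarith [abs_nonneg lam]
  have hXn : ‖X‖ ≤ C * ‖J U‖ := by
    have h1 := hg X
    rw [hXg X, hX] at h1
    have h2 : (inner ℂ (v : H) (A v)).re ≤ ‖(v : H)‖ * ‖A v‖ :=
      (Complex.re_le_norm _).trans (norm_inner_le_norm _ _)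
    have h3 : ‖(v : H)‖ * ‖A v‖ ≤ (‖R‖ * ‖J U‖) * ((1 + |lam| * ‖R‖) * ‖J U‖) := by gcongr
    have h4 : c * ‖(v : H)‖ ^ 2 ≤ |c| * (‖R‖ * ‖J U‖) ^ 2 := by
      have := le_abs_self c
      gcongr
    have h5 : ‖X‖ ^ 2 ≤ (C * ‖J U‖) ^ 2 := by
      rw [mul_pow, Real.sq_sqrt (by positivity), div_mul_eq_mul_div, le_div_iff₀ hκ]
      rw [hM]
      nlinarith
    exact (le_abs_self _).trans (abs_le_of_sq_le_sq h5 (by positivity))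
  have key : inner ℂ X (T U) - lam * inner ℂ (J X) (J U) = inner ℂ (J U) (J U) := by
    have h1 := hXg U
    rw [← hA.symm, ← inner_conj_symm, hAv, inner_add_right, inner_smul_right] at h1
    have h2 := congrArg (starRingEnd ℂ) h1
    rw [Complex.conj_conj, map_add, map_mul, Complex.conj_ofReal, inner_conj_symm,
      inner_conj_symm] at h2
    rw [h2, hX]
    ring
  have h1 := hU X
  rw [key, inner_self_eq_norm_sq_to_K] at h1
  have hpos : 0 < ‖J U‖ := norm_pos_iff.2 hU0
  have h2 : ‖((‖J U‖ : ℂ)) ^ 2‖ = ‖J U‖ ^ 2 := by simp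
  simp only [Complex.coe_algebraMap, h2] at h1
  have h3 : 1 / (2 * (C + 1)) * ‖X‖ * ‖J U‖ ≤ 1 / (2 * (C + 1)) * (C * ‖J U‖) * ‖J U‖ := by
    gcongr
  have h4 : 1 / (2 * (C + 1)) * (C * ‖J U‖) * ‖J U‖ ≤ ‖J U‖ ^ 2 / 2 := by
    rw [one_div, inv_mul_eq_div, div_mul_eq_mul_div, div_le_div_iff₀ (by positivity) (by norm_num)]
    nlinarith [sq_nonneg ‖J U‖]
  nlinarith

/-- If the form is at least `Λ` up to a form of rank `finrank W`, then there are at most `finrank W`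
eigenvalues below `Λ`: on a span of eigenvectors the form is below `Λ`, so a combination in the
kernel of `G` vanishes. -/
theorem card_eigenvalues_le (hA : IsFormOperator A J T) {Λ : ℝ} (G : H →L[ℂ] W)
    (hG : ∀ U : V, Λ * ‖J U‖ ^ 2 ≤ (inner ℂ U (T U)).re + ‖G (J U)‖ ^ 2)
    (s : Finset ℝ) (hs : ∀ μ ∈ s, μ < Λ ∧
      ∃ U : V, J U ≠ 0 ∧ ∀ X, inner ℂ X (T U) = μ * inner ℂ (J X) (J U)) :
    s.card ≤ Module.finrank ℂ W := by
  choose hlt U hU0 hU using hs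
  have horth : ∀ i j : s, i ≠ j → inner ℂ (J (U i i.2)) (J (U j j.2)) = 0 := fun i j hij => by
    have h1 := hU j j.2 (U i i.2)
    have h2 := hU i i.2 (U j j.2)
    rw [← hA.symm, ← inner_conj_symm, h2, map_mul, inner_conj_symm, Complex.conj_ofReal] at h1
    have h3 : ((i : ℝ) - (j : ℝ) : ℂ) * inner ℂ (J (U i i.2)) (J (U j j.2)) = 0 := by
      linear_combination h1
    rcases mul_eq_zero.1 h3 with h | h
    · exact absurd (Subtype.ext (by exact_mod_cast sub_eq_zero.1 h)) hij
    · exact h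
  let L : s → W := fun i => G (J (U i i.2))
  have hli : LinearIndependent ℂ L := by
    rw [Fintype.linearIndependent_iff]
    intro c hc
    set X : V := ∑ i : s, c i • U i i.2 with hX
    have hGX : G (J X) = 0 := by
      rw [hX, map_sum, map_sum, ← hc]
      simp [L]
    have hpair : ∀ j : s, inner ℂ (J X) (J (U j j.2)) =
        starRingEnd ℂ (c j) * ((‖J (U j j.2)‖ ^ 2 : ℝ) : ℂ) := fun j => by
      rw [hX, map_sum, sum_inner, Finset.sum_eq_single j]
      · rw [map_smul, inner_smul_left, inner_self_eq_norm_sq_to_K]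
        simp
      · intro i _ hij
        rw [map_smul, inner_smul_left, horth i j hij, mul_zero]
      · simp
    have hcj : ∀ j, c j * (starRingEnd ℂ (c j) * ((‖J (U j j.2)‖ ^ 2 : ℝ) : ℂ)) =
        ((‖c j‖ ^ 2 * ‖J (U j j.2)‖ ^ 2 : ℝ) : ℂ) := fun j => by
      rw [← mul_assoc, Complex.mul_conj, Complex.normSq_eq_norm_sq]
      push_cast
      rfl
    have e1 : ‖J X‖ ^ 2 = ∑ j : s, ‖c j‖ ^ 2 * ‖J (U j j.2)‖ ^ 2 := by
      have h : inner ℂ (J X) (J X) =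
          ((∑ j : s, ‖c j‖ ^ 2 * ‖J (U j j.2)‖ ^ 2 : ℝ) : ℂ) := by
        have hJX : J X = ∑ j : s, c j • J (U j j.2) := by simp [hX]
        nth_rewrite 2 [hJX]
        rw [inner_sum, Complex.ofReal_sum]
        refine Finset.sum_congr rfl fun j _ => ?_
        rw [inner_smul_right, hpair, hcj]
      rw [inner_self_eq_norm_sq_to_K] at h
      refine Complex.ofReal_injective (h ▸ ?_)
      push_cast
      rfl
    have e2 : (inner ℂ X (T X)).re =
        ∑ j : s, (j : ℝ) * (‖c j‖ ^ 2 * ‖J (U j j.2)‖ ^ 2) := by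
      have h : inner ℂ X (T X) =
          ((∑ j : s, (j : ℝ) * (‖c j‖ ^ 2 * ‖J (U j j.2)‖ ^ 2) : ℝ) : ℂ) := by
        have hTX : T X = ∑ j : s, c j • T (U j j.2) := by simp [hX]
        rw [hTX, inner_sum, Complex.ofReal_sum]
        refine Finset.sum_congr rfl fun j _ => ?_
        rw [inner_smul_right, hU, hpair, mul_left_comm, hcj]
        push_cast
        ring
      rw [h, Complex.ofReal_re]
    have h := hG X
    rw [hGX, norm_zero, e1, e2, Finset.mul_sum] at h
    have h0 : ∑ j : s, (Λ - j) * (‖c j‖ ^ 2 * ‖J (U j j.2)‖ ^ 2) ≤ 0 := by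
      simp only [sub_mul, Finset.sum_sub_distrib]
      linarith
    have hnn : ∀ j ∈ Finset.univ, 0 ≤ (Λ - (j : s)) * (‖c j‖ ^ 2 * ‖J (U j j.2)‖ ^ 2) :=
      fun j _ => mul_nonneg (sub_nonneg.2 (hlt j j.2).le) (by positivity)
    intro i
    have hi := (Finset.sum_eq_zero_iff_of_nonneg hnn).1
      (le_antisymm h0 (Finset.sum_nonneg hnn)) i (Finset.mem_univ i)
    have hpos : 0 < Λ - (i : ℝ) := sub_pos.2 (hlt i i.2)
    have hJ : ‖J (U i i.2)‖ ≠ 0 := norm_ne_zero_iff.2 (hU0 i i.2)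
    simpa [hpos.ne', hJ] using hi
  simpa using hli.fintype_card_le_finrank

variable [CompleteSpace V] [CompleteSpace H]

/-- The operator on the form domain that represents the form of `A - z`. -/
abbrev shifted (J : V →L[ℂ] H) (T : V →L[ℂ] V) (z : ℂ) : V →L[ℂ] V :=
  T - z • (ContinuousLinearMap.adjoint J ∘L J)

theorem inner_shifted (z : ℂ) (X U : V) :
    inner ℂ X (shifted J T z U) = inner ℂ X (T U) - z * inner ℂ (J X) (J U) := by
  simp only [shifted, sub_apply, smul_apply, ContinuousLinearMap.comp_apply, inner_sub_right,
    inner_smul_right, ContinuousLinearMap.adjoint_inner_right]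

theorem isRegularValue_of_isUnit (hA : IsFormOperator A J T) {z : ℂ}
    (h : IsUnit (shifted J T z)) : IsRegularValue A z := by
  obtain ⟨B, hB⟩ := h
  have hr : ∀ X, shifted J T z ((↑B⁻¹ : V →L[ℂ] V) X) = X := fun X => by
    rw [← hB, ← mul_apply_eq_comp, Units.mul_inv]; rfl
  have hl : ∀ X, (↑B⁻¹ : V →L[ℂ] V) (shifted J T z X) = X := fun X => by
    rw [← hB, ← mul_apply_eq_comp, Units.inv_mul]; rfl
  refine ⟨J ∘L (↑B⁻¹ : V →L[ℂ] V) ∘L ContinuousLinearMap.adjoint J, fun f => ?_, fun u => ?_⟩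
  · set U : V := (↑B⁻¹ : V →L[ℂ] V) (ContinuousLinearMap.adjoint J f) with hU
    have hg : (J U, f + z • J U) ∈ A.graph := by
      refine (hA.mem_graph_iff _ _).2 ⟨U, rfl, fun X => ?_⟩
      have h1 := inner_shifted (J := J) (T := T) z X U
      rw [hU, hr, ContinuousLinearMap.adjoint_inner_right, ← hU] at h1
      rw [inner_add_right, inner_smul_right, h1]
      ring
    obtain ⟨y, hy1, hy2⟩ := LinearPMap.mem_graph_iff _ |>.1 hg
    refine ⟨y, hy1, ?_⟩
    simp only at hy1 hy2
    rw [hy1, hy2, add_sub_cancel_right]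
  · obtain ⟨U, hU, h⟩ := (hA.mem_graph_iff _ _).1 (A.mem_graph u)
    have h1 : shifted J T z U = ContinuousLinearMap.adjoint J (A u - z • (u : H)) := by
      refine ext_inner_left ℂ fun X => ?_
      rw [inner_shifted, h X, ContinuousLinearMap.adjoint_inner_right, inner_sub_right,
        inner_smul_right, hU]
    change J ((↑B⁻¹ : V →L[ℂ] V) (ContinuousLinearMap.adjoint J (A u - z • (u : H)))) = u
    rw [← h1, hl, hU]

theorem isUnit_of_coercive {B : V →L[ℂ] V} {κ : ℝ} (hκ : 0 < κ)
    (h : ∀ U : V, κ * ‖U‖ ^ 2 ≤ ‖inner ℂ U (B U)‖) : IsUnit B := by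
  refine ContinuousLinearMap.isUnit_of_forall_le_norm_inner_map B (c := ⟨κ, hκ.le⟩) hκ fun x => ?_
  rw [norm_inner_symm]
  exact (mul_comm _ _).trans_le (h x)

theorem isRegularValue_of_im_ne_zero (hA : IsFormOperator A J T) {z : ℂ} (hz : z.im ≠ 0) :
    IsRegularValue A z := by
  obtain ⟨κ, c, hκ, hG⟩ := hA.garding
  have hz' : 0 < |z.im| := abs_pos.2 hz
  set m : ℝ := (|c| + |z.re|) / |z.im| with hm
  have hm0 : 0 ≤ m := by positivity
  refine hA.isRegularValue_of_isUnit (isUnit_of_coercive (κ := κ / (1 + m)) (by positivity)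
    fun U => ?_)
  have e : inner ℂ U (shifted J T z U) =
      ((inner ℂ U (T U)).re : ℂ) - z * ((‖J U‖ ^ 2 : ℝ) : ℂ) := by
    rw [inner_shifted, ← hA.inner_self_eq, inner_self_eq_norm_sq_to_K]
    simp
  have h1 := Complex.abs_re_le_norm (inner ℂ U (shifted J T z U))
  have h2 := Complex.abs_im_le_norm (inner ℂ U (shifted J T z U))
  set N := ‖inner ℂ U (shifted J T z U)‖
  have hre : (inner ℂ U (shifted J T z U)).re = (inner ℂ U (T U)).re - z.re * ‖J U‖ ^ 2 := by
    rw [e]; simp [-Complex.ofReal_pow]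
  have him : (inner ℂ U (shifted J T z U)).im = -(z.im * ‖J U‖ ^ 2) := by
    rw [e]; simp [-Complex.ofReal_pow]
  rw [hre] at h1
  rw [him, abs_neg, abs_mul, abs_of_nonneg (sq_nonneg ‖J U‖)] at h2
  have h3 : (|c| + |z.re|) * ‖J U‖ ^ 2 ≤ m * N := by
    rw [hm, div_mul_eq_mul_div, le_div_iff₀ hz']
    nlinarith [abs_nonneg c, abs_nonneg z.re]
  have h4 := hG U
  have h5 := (le_abs_self _).trans h1
  have h6 : c * ‖J U‖ ^ 2 + z.re * ‖J U‖ ^ 2 ≤ (|c| + |z.re|) * ‖J U‖ ^ 2 := by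
    rw [← add_mul]
    exact mul_le_mul_of_nonneg_right (add_le_add (le_abs_self _) (le_abs_self _)) (sq_nonneg _)
  rw [div_mul_eq_mul_div, div_le_iff₀ (by positivity)]
  linarith

/-- Fredholm alternative: if the form of `A - μ` is coercive up to a form of finite rank, then
`μ` is a regular value or an eigenvalue. -/
theorem isUnit_or_exists_eigenvector (hA : IsFormOperator A J T) {Λ μ : ℝ} (hμ : μ < Λ)
    (G : H →L[ℂ] W)
    (hG : ∀ U : V, Λ * ‖J U‖ ^ 2 ≤ (inner ℂ U (T U)).re + ‖G (J U)‖ ^ 2) :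
    IsUnit (shifted J T μ) ∨ ∃ U : V, J U ≠ 0 ∧ ∀ X, inner ℂ X (T U) = μ * inner ℂ (J X) (J U) := by
  obtain ⟨κ, c, hκ, hg⟩ := hA.garding
  -- `B` is the coercive operator `T - μ J†J + J†G†GJ`; `T - μ J†J = B (1 - P)` with `P` compact
  set K : V →L[ℂ] W := G ∘L J
  set F : V →L[ℂ] V := ContinuousLinearMap.adjoint K ∘L K
  set B : V →L[ℂ] V := shifted J T μ + F
  have hF : ∀ X U, inner ℂ X (F U) = inner ℂ (K X) (K U) := fun X U => by
    simp [F, ContinuousLinearMap.adjoint_inner_right]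
  -- interpolation between the Gårding inequality and the lower bound of the form
  set δ := Λ - μ
  have hδ : 0 < δ := sub_pos.2 hμ
  set m : ℝ := (|c| + |μ|) / δ
  have hm0 : 0 ≤ m := by positivity
  have hBu : IsUnit B := by
    refine isUnit_of_coercive (κ := κ / (1 + m)) (by positivity) fun U => ?_
    refine le_trans ?_ (Complex.re_le_norm _)
    have e : (inner ℂ U (B U)).re =
        (inner ℂ U (T U)).re - μ * ‖J U‖ ^ 2 + ‖G (J U)‖ ^ 2 := by
      have : B U = shifted J T μ U + F U := rfl
      rw [this, inner_add_right, inner_shifted, hF, inner_self_eq_norm_sq_to_K,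
        inner_self_eq_norm_sq_to_K]
      have h1 : ((‖J U‖ : ℂ) ^ 2) = ((‖J U‖ ^ 2 : ℝ) : ℂ) := by push_cast; rfl
      have h2 : ((‖K U‖ : ℂ) ^ 2) = ((‖G (J U)‖ ^ 2 : ℝ) : ℂ) := by push_cast; rfl
      simp only [Complex.coe_algebraMap, h1, h2, ← Complex.ofReal_mul, Complex.add_re,
        Complex.sub_re, Complex.ofReal_re]
    set b := ‖J U‖ ^ 2
    have hb : 0 ≤ b := sq_nonneg _
    have h1 := hG U
    have h2 := hg U
    have h3 : δ * b ≤ (inner ℂ U (B U)).re := by rw [e]; simp only [δ]; linarith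
    have h4 : (|c| + |μ|) * b ≤ m * (inner ℂ U (B U)).re := by
      simp only [m]
      rw [div_mul_eq_mul_div, le_div_iff₀ hδ]
      nlinarith [abs_nonneg c, abs_nonneg μ]
    have h6 : c * b + μ * b ≤ (|c| + |μ|) * b := by
      rw [← add_mul]
      exact mul_le_mul_of_nonneg_right (add_le_add (le_abs_self _) (le_abs_self _)) hb
    have h7 : κ * ‖U‖ ^ 2 ≤ (inner ℂ U (B U)).re + (c + μ) * b := by
      rw [e]; nlinarith [sq_nonneg ‖G (J U)‖]
    rw [div_mul_eq_mul_div, div_le_iff₀ (by positivity)]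
    linarith
  obtain ⟨Bu, hBu⟩ := hBu
  set P : V →L[ℂ] V := (↑Bu⁻¹ : V →L[ℂ] V) ∘L F
  have hr : ∀ X, B ((↑Bu⁻¹ : V →L[ℂ] V) X) = X := fun X => by
    rw [← hBu, ← mul_apply_eq_comp, Units.mul_inv]; rfl
  have hdec : shifted J T μ = B * (1 - P) := by
    ext X
    simp only [mul_apply_eq_comp, sub_apply, map_sub,
      one_apply_eq_self]
    have : B (P X) = F X := hr (F X)
    rw [this]
    simp [B]
  have hP : IsCompactOperator P := by
    have hK : IsCompactOperator K := by
      have := FiniteDimensional.proper ℂ W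
      exact isCompactOperator_of_locallyCompactSpace_dom K
    exact hK.clm_comp ((↑Bu⁻¹ : V →L[ℂ] V) ∘L ContinuousLinearMap.adjoint K)
  rcases hP.hasEigenvalue_or_mem_resolventSet (μ := (1 : ℂ)) one_ne_zero with h | h
  · right
    obtain ⟨U, hU⟩ := h.exists_hasEigenvector
    have hPU : P U = U := by simpa using hU.apply_eq_smul
    have hs : shifted J T μ U = 0 := by
      rw [hdec, mul_apply_eq_comp, sub_apply, hPU]
      simp
    have hX : ∀ X, inner ℂ X (T U) = μ * inner ℂ (J X) (J U) := fun X => by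
      have := inner_shifted (J := J) (T := T) μ X U
      rw [hs, inner_zero_right] at this
      linear_combination -this
    refine ⟨U, fun h0 => hU.2 ?_, hX⟩
    have h1 := hg U
    rw [hX U, h0] at h1
    simp only [inner_zero_right, mul_zero, norm_zero, Complex.zero_re] at h1
    have : ‖U‖ ^ 2 ≤ 0 := by nlinarith
    exact norm_eq_zero.1 (by nlinarith [norm_nonneg U])
  · left
    rw [spectrum.mem_resolventSet_iff, map_one] at h
    rw [hdec]
    exact (hBu ▸ Bu.isUnit).mul h

/-- If the form is at least `Λ` up to a form of finite rank, then below `Λ` there are only finitely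
many points of the spectrum, all of them eigenvalues. Since `G` is injective on an eigenspace, their
multiplicities are finite. -/
theorem notMem_essentialSpectrum (hA : IsFormOperator A J T) {Λ lam : ℝ} (hlam : lam < Λ)
    (G : H →L[ℂ] W)
    (hG : ∀ U : V, Λ * ‖J U‖ ^ 2 ≤ (inner ℂ U (T U)).re + ‖G (J U)‖ ^ 2) :
    (lam : ℂ) ∉ essentialSpectrum A := by
  rintro ⟨hspec, hdisc⟩
  apply hdisc
  set E : Set ℝ := {μ | μ < Λ ∧
      ∃ U : V, J U ≠ 0 ∧ ∀ X, inner ℂ X (T U) = μ * inner ℂ (J X) (J U)}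
  have hfin : E.Finite := by
    by_contra hinf
    obtain ⟨s, hs, hc⟩ := Set.Infinite.exists_subset_card_eq hinf (Module.finrank ℂ W + 1)
    have := hA.card_eigenvalues_le G hG s fun μ hμ => hs hμ
    omega
  have hE : ∀ z : ℂ, z ∈ opSpectrum A → z.re < Λ → z.im = 0 ∧ z.re ∈ E := fun z hz hre => by
    have him : z.im = 0 := by
      by_contra him
      exact hz (hA.isRegularValue_of_im_ne_zero him)
    refine ⟨him, hre, ?_⟩
    have hzr : ((z.re : ℝ) : ℂ) = z := Complex.ext (by simp) (by simp [him])
    rcases hA.isUnit_or_exists_eigenvector hre G hG with h | h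
    · exact absurd (hA.isRegularValue_of_isUnit (hzr ▸ h)) hz
    · exact h
  obtain ⟨-, -, U0, hU0, hU⟩ := hE _ hspec (by simpa using hlam)
  refine ⟨?_, ?_, ?_⟩
  · have hcl : IsClosed (E \ {lam}) := (hfin.subset sdiff_subset).isClosed
    have hopen : IsOpen ((E \ {lam})ᶜ ∩ Iio Λ) := hcl.isOpen_compl.inter isOpen_Iio
    obtain ⟨ε, hε, hb⟩ := Metric.isOpen_iff.1 hopen lam ⟨fun h => h.2 rfl, hlam⟩
    refine ⟨ε, hε, Set.eq_singleton_iff_unique_mem.2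
      ⟨⟨hspec, Metric.mem_ball_self hε⟩, fun z ⟨hz, hzb⟩ => ?_⟩⟩
    have hzre : z.re ∈ Metric.ball lam ε := by
      rw [Metric.mem_ball, Real.dist_eq]
      have := Complex.abs_re_le_norm (z - lam)
      rw [Complex.sub_re, Complex.ofReal_re] at this
      exact this.trans_lt (by simpa [Complex.dist_eq] using hzb)
    obtain ⟨h1, h2⟩ := hb hzre
    obtain ⟨him, hre⟩ := hE z hz h2
    have : z.re = lam := by
      by_contra hne
      exact h1 ⟨hre, hne⟩
    exact Complex.ext (by simpa using this) (by simpa using him)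
  · intro hbot
    have := hA.mem_opEigenspace hU
    simp only [Complex.ofReal_re] at this
    rw [hbot] at this
    exact hU0 ((Submodule.mem_bot ℂ).1 this)
  · refine Module.Finite.of_injective
      ((G : H →ₗ[ℂ] W) ∘ₗ (opEigenspace A (lam : ℂ)).subtype) ?_
    rw [← LinearMap.ker_eq_bot, LinearMap.ker_eq_bot']
    rintro ⟨u, hu⟩ h
    have hGu : G u = 0 := h
    obtain ⟨X, rfl, hX⟩ := hA.exists_of_mem_opEigenspace hu
    have h1 := hG X
    rw [hGu, hX X, inner_self_eq_norm_sq_to_K] at h1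
    have h2 : ((lam : ℂ) * ((‖J X‖ : ℂ)) ^ 2).re = lam * ‖J X‖ ^ 2 := by
      rw [← Complex.ofReal_pow, ← Complex.ofReal_mul, Complex.ofReal_re]
    simp only [Complex.coe_algebraMap, h2, norm_zero] at h1
    have h3 : ‖J X‖ ^ 2 ≤ 0 := by nlinarith [sq_nonneg ‖J X‖]
    have h4 : J X = 0 := norm_eq_zero.1 (by nlinarith [norm_nonneg (J X)])
    simp [h4]

end IsFormOperator

/-- A half-line in the spectrum has no isolated points. -/
theorem subset_essentialSpectrum {A : H →ₗ.[ℂ] H} {a : ℝ}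
    (h : ∀ lam : ℝ, a ≤ lam → (lam : ℂ) ∈ opSpectrum A) :
    Complex.ofReal '' Ici a ⊆ essentialSpectrum A := by
  rintro _ ⟨lam, hlam, rfl⟩
  refine ⟨h lam hlam, fun ⟨⟨ε, hε, he⟩, _⟩ => ?_⟩
  have hmem : ((lam + ε / 2 : ℝ) : ℂ) ∈ opSpectrum A ∩ Metric.ball (lam : ℂ) ε := by
    refine ⟨h _ (le_trans hlam (by linarith)), ?_⟩
    rw [Metric.mem_ball, Complex.dist_eq, ← Complex.ofReal_sub, Complex.norm_real,
      add_sub_cancel_left, Real.norm_eq_abs, abs_of_pos (by positivity)]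
    linarith
  rw [he] at hmem
  have : lam + ε / 2 = lam := Complex.ofReal_injective hmem
  linarith

end Abstract

end

section

/-! ### The form in terms of inner products -/

section MulOp

variable {μ ν : Measure ℝ}

theorem ae_norm_le_of_lInfty (τ : Lp ℝ ⊤ ν) : ∀ᵐ y ∂ν, |τ y| ≤ ‖τ‖ := by
  filter_upwards [ae_le_eLpNormEssSup (f := (τ : ℝ → ℝ)) (μ := ν)] with y hy
  rw [Lp.norm_def, eLpNorm_exponent_top]
  have h3 : eLpNormEssSup (τ : ℝ → ℝ) ν ≠ ⊤ := by
    have := Lp.eLpNorm_ne_top τ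
    rwa [eLpNorm_exponent_top] at this
  simpa using ENNReal.toReal_mono h3 hy

theorem aestronglyMeasurable_ofReal_lInfty (hμ : μ ≪ ν) (τ : Lp ℝ ⊤ ν) :
    AEStronglyMeasurable (fun y => ((τ y : ℝ) : ℂ)) μ :=
  Complex.continuous_ofReal.comp_aestronglyMeasurable ((Lp.aestronglyMeasurable τ).mono_ac hμ)

theorem ae_norm_mul_le (hμ : μ ≪ ν) (τ : Lp ℝ ⊤ ν) (f : ℝ → ℂ) :
    ∀ᵐ y ∂μ, ‖(τ y : ℂ) * f y‖ ≤ ‖τ‖ * ‖f y‖ := by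
  filter_upwards [hμ.ae_le (ae_norm_le_of_lInfty τ)] with y hy
  rw [norm_mul, Complex.norm_real, Real.norm_eq_abs]
  gcongr

theorem memLp_mul_lInfty (hμ : μ ≪ ν) (τ : Lp ℝ ⊤ ν) {f : ℝ → ℂ} (hf : MemLp f 2 μ) :
    MemLp (fun y => (τ y : ℂ) * f y) 2 μ :=
  hf.of_le_mul ((aestronglyMeasurable_ofReal_lInfty hμ τ).mul hf.1) (ae_norm_mul_le hμ τ f)

/-- Multiplication by an element of `L^∞` as a bounded operator in `L²`. -/
def mulOp (hμ : μ ≪ ν) (τ : Lp ℝ ⊤ ν) : Lp ℂ 2 μ →L[ℂ] Lp ℂ 2 μ :=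
  LinearMap.mkContinuous
    { toFun := fun f => (memLp_mul_lInfty hμ τ (Lp.memLp f)).toLp _
      map_add' := fun f g => by
        refine Lp.ext ?_
        filter_upwards [(memLp_mul_lInfty hμ τ (Lp.memLp (f + g))).coeFn_toLp,
          (memLp_mul_lInfty hμ τ (Lp.memLp f)).coeFn_toLp,
          (memLp_mul_lInfty hμ τ (Lp.memLp g)).coeFn_toLp, Lp.coeFn_add f g,
          Lp.coeFn_add ((memLp_mul_lInfty hμ τ (Lp.memLp f)).toLp _)
            ((memLp_mul_lInfty hμ τ (Lp.memLp g)).toLp _)] with y h1 h2 h3 h4 h5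
        rw [h1, h5, Pi.add_apply, h2, h3, h4, Pi.add_apply, mul_add]
      map_smul' := fun c f => by
        refine Lp.ext ?_
        filter_upwards [(memLp_mul_lInfty hμ τ (Lp.memLp (c • f))).coeFn_toLp,
          (memLp_mul_lInfty hμ τ (Lp.memLp f)).coeFn_toLp, Lp.coeFn_smul c f,
          Lp.coeFn_smul c ((memLp_mul_lInfty hμ τ (Lp.memLp f)).toLp _)] with y h1 h2 h3 h4
        rw [h1, RingHom.id_apply, h4, Pi.smul_apply, h2, h3, Pi.smul_apply, smul_eq_mul,
          smul_eq_mul, mul_left_comm] }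
    ‖τ‖ fun f => by
      refine Lp.norm_le_mul_norm_of_ae_le_mul ?_
      filter_upwards [(memLp_mul_lInfty hμ τ (Lp.memLp f)).coeFn_toLp,
        ae_norm_mul_le hμ τ f] with y h1 h2
      change ‖(memLp_mul_lInfty hμ τ (Lp.memLp f)).toLp _ y‖ ≤ _
      rw [h1]
      exact h2

theorem mulOp_coeFn (hμ : μ ≪ ν) (τ : Lp ℝ ⊤ ν) (f : Lp ℂ 2 μ) :
    mulOp hμ τ f =ᵐ[μ] fun y => (τ y : ℂ) * f y :=
  (memLp_mul_lInfty hμ τ (Lp.memLp f)).coeFn_toLp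

theorem norm_mulOp_le (hμ : μ ≪ ν) (τ : Lp ℝ ⊤ ν) (f : Lp ℂ 2 μ) :
    ‖mulOp hμ τ f‖ ≤ ‖τ‖ * ‖f‖ :=
  LinearMap.mkContinuous_norm_le _ (norm_nonneg τ) _ |> fun h =>
    (ContinuousLinearMap.le_opNorm _ f).trans (mul_le_mul_of_nonneg_right h (norm_nonneg f))

theorem inner_mulOp (hμ : μ ≪ ν) (τ : Lp ℝ ⊤ ν) (f g : Lp ℂ 2 μ) :
    inner ℂ f (mulOp hμ τ g) = ∫ y, (τ y : ℂ) * (starRingEnd ℂ (f y) * g y) ∂μ := by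
  rw [L2.inner_def]
  refine integral_congr_ae ?_
  filter_upwards [mulOp_coeFn hμ τ g] with y hy
  rw [RCLike.inner_apply, hy]
  ring

theorem mulOp_symm (hμ : μ ≪ ν) (τ : Lp ℝ ⊤ ν) (f g : Lp ℂ 2 μ) :
    inner ℂ (mulOp hμ τ f) g = inner ℂ f (mulOp hμ τ g) := by
  rw [inner_mulOp, L2.inner_def]
  refine integral_congr_ae ?_
  filter_upwards [mulOp_coeFn hμ τ f] with y hy
  rw [RCLike.inner_apply, hy, map_mul, Complex.conj_ofReal]
  ring

end MulOp

theorem l2_inner_eq {X : Type*} [MeasurableSpace X] {μ : Measure X} (f g : Lp ℂ 2 μ) :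
    inner ℂ f g = ∫ x, starRingEnd ℂ (f x) * g x ∂μ := by
  rw [L2.inner_def]
  simp only [RCLike.inner_apply, mul_comm]

variable {d : ℝ}

theorem form_eq_inner (σ α : LInftyRay) (V U : Jet d) :
    form σ α V U = inner ℂ V.dx U.dx + inner ℂ V.dy U.dy
      - (inner ℂ V.bottom (mulOp seg_ac σ U.bottom) + inner ℂ V.left (mulOp seg_ac σ U.left))
      + inner ℂ V.diag (mulOp .rfl α U.diag) := by
  rw [inner_mulOp, inner_mulOp, inner_mulOp, l2_inner_eq, l2_inner_eq, form,
    integral_add (integrable_conj_mul V.dx U.dx) (integrable_conj_mul V.dy U.dy),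
    ← integral_add (integrable_mul_of_lInfty seg_ac σ (integrable_conj_mul V.bottom U.bottom))
      (integrable_mul_of_lInfty seg_ac σ (integrable_conj_mul V.left U.left))]
  simp only [mul_add]

theorem form_conj_symm (σ α : LInftyRay) (V U : Jet d) :
    starRingEnd ℂ (form σ α U V) = form σ α V U := by
  simp only [form_eq_inner, map_add, map_sub, inner_conj_symm, mulOp_symm]

/-! ### The form domain as a Hilbert space -/

theorem convL2_iff_tendsto {X : Type*} [MeasurableSpace X] {μ : Measure X} {f : ℕ → X → ℂ}
    {F : ℕ → Lp ℂ 2 μ} {T : Lp ℂ 2 μ} (h : ∀ n, F n =ᵐ[μ] f n) :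
    ConvL2 f T ↔ Tendsto F atTop (𝓝 T) := by
  rw [Lp.tendsto_Lp_iff_tendsto_eLpNorm', ConvL2]
  refine tendsto_congr fun n => eLpNorm_congr_ae ?_
  filter_upwards [h n] with x hx
  rw [Pi.sub_apply, hx]

/-- Along a curve with a continuous left inverse `ρ`, hence a closed embedding, restriction
preserves compact supports. -/
theorem memLp_comp_curve {φ : ℝ × ℝ → ℂ} (hφ : Continuous φ) (hc : HasCompactSupport φ)
    {γ : ℝ → ℝ × ℝ} (hγ : Continuous γ) {ρ : ℝ × ℝ → ℝ} (hρ : Continuous ρ)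
    (h : Function.LeftInverse ρ γ) (μ : Measure ℝ) [IsFiniteMeasureOnCompacts μ] :
    MemLp (fun y => φ (γ y)) 2 μ :=
  (hφ.comp hγ).memLp_of_hasCompactSupport
    (hc.comp_isClosedEmbedding (h.isClosedEmbedding hρ hγ))

/-- `Z` consists of a function in `C_c^∞(ℝ²)`, its partial derivatives, and its restrictions to the
axes, the diagonal and the two rays `|x - y| = d`. -/
structure IsSmoothJet (φ : ℝ × ℝ → ℂ) (Z : Jet d × L2Ray × L2Ray) : Prop where
  contDiff : ContDiff ℝ ∞ φ
  hasCompactSupport : HasCompactSupport φ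
  val : Z.1.val =ᵐ[volume.restrict (pencil d)] φ
  dx : Z.1.dx =ᵐ[volume.restrict (pencil d)] pd (1, 0) φ
  dy : Z.1.dy =ᵐ[volume.restrict (pencil d)] pd (0, 1) φ
  bottom : Z.1.bottom =ᵐ[volume.restrict (Icc 0 d)] fun y => φ (y, 0)
  left : Z.1.left =ᵐ[volume.restrict (Icc 0 d)] fun y => φ (0, y)
  diag : Z.1.diag =ᵐ[volume.restrict (Ici 0)] fun y => φ (y, y)
  lower : Z.2.1 =ᵐ[volume.restrict (Ici 0)] fun y => φ (y + d, y)
  upper : Z.2.2 =ᵐ[volume.restrict (Ici 0)] fun y => φ (y, y + d)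

theorem exists_isSmoothJet (d : ℝ) {φ : ℝ × ℝ → ℂ} (hs : ContDiff ℝ ∞ φ)
    (hc : HasCompactSupport φ) : ∃ Z : Jet d × L2Ray × L2Ray, IsSmoothJet φ Z := by
  have m0 : MemLp φ 2 (volume.restrict (pencil d)) := hs.continuous.memLp_of_hasCompactSupport hc
  have m : ∀ v, MemLp (pd v φ) 2 (volume.restrict (pencil d)) := fun v =>
    (continuous_pd hs v).memLp_of_hasCompactSupport (hasCompactSupport_pd hc v)
  have t1 := memLp_comp_curve hs.continuous hc (γ := fun y => (y, (0 : ℝ))) (by fun_prop)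
    continuous_fst (fun y => rfl) (volume.restrict (Icc 0 d))
  have t2 := memLp_comp_curve hs.continuous hc (γ := fun y => ((0 : ℝ), y)) (by fun_prop)
    continuous_snd (fun y => rfl) (volume.restrict (Icc 0 d))
  have t3 := memLp_comp_curve hs.continuous hc (γ := fun y => (y, y)) (by fun_prop)
    continuous_fst (fun y => rfl) (volume.restrict (Ici 0))
  have t4 := memLp_comp_curve hs.continuous hc (γ := fun y => (y + d, y)) (by fun_prop)
    continuous_snd (fun y => rfl) (volume.restrict (Ici 0))
  have t5 := memLp_comp_curve hs.continuous hc (γ := fun y => (y, y + d)) (by fun_prop)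
    continuous_fst (fun y => rfl) (volume.restrict (Ici 0))
  exact ⟨((m0.toLp _, (m (1, 0)).toLp _, (m (0, 1)).toLp _, t1.toLp _, t2.toLp _, t3.toLp _),
    t4.toLp _, t5.toLp _), hs, hc, m0.coeFn_toLp, (m _).coeFn_toLp, (m _).coeFn_toLp,
    t1.coeFn_toLp, t2.coeFn_toLp, t3.coeFn_toLp, t4.coeFn_toLp, t5.coeFn_toLp⟩

/-- The convergence in the definition of the traces is convergence in a product of `L²` spaces. -/
theorem hasTraces_iff (U : Jet d) (l u : L2Ray) :
    HasTraces U l u ↔ (U, l, u) ∈ closure {Z | ∃ φ, IsSmoothJet (d := d) φ Z} := by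
  rw [mem_closure_iff_seq_limit]
  have key : ∀ (φ : ℕ → ℝ × ℝ → ℂ) (Z : ℕ → Jet d × L2Ray × L2Ray),
      (∀ n, IsSmoothJet (φ n) (Z n)) → ((ConvL2 φ U.val ∧
    ConvL2 (fun n p => pd (1, 0) (φ n) p) U.dx ∧
    ConvL2 (fun n p => pd (0, 1) (φ n) p) U.dy ∧
    ConvL2 (fun n y => φ n (y, 0)) U.bottom ∧
    ConvL2 (fun n y => φ n (0, y)) U.left ∧
    ConvL2 (fun n y => φ n (y, y)) U.diag ∧
    ConvL2 (fun n y => φ n (y + d, y)) l ∧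
    ConvL2 (fun n y => φ n (y, y + d)) u) ↔ Tendsto Z atTop (𝓝 (U, l, u))) := fun φ Z h => by
    rw [convL2_iff_tendsto fun n => (h n).val, convL2_iff_tendsto fun n => (h n).dx,
      convL2_iff_tendsto fun n => (h n).dy, convL2_iff_tendsto fun n => (h n).bottom,
      convL2_iff_tendsto fun n => (h n).left, convL2_iff_tendsto fun n => (h n).diag,
      convL2_iff_tendsto fun n => (h n).lower, convL2_iff_tendsto fun n => (h n).upper]
    simp only [Prod.tendsto_iff, and_assoc]
  constructor
  · rintro ⟨φ, hφ, h⟩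
    choose Z hZ using fun n => exists_isSmoothJet d (hφ n).1 (hφ n).2
    exact ⟨Z, fun n => ⟨φ n, hZ n⟩, (key φ Z hZ).1 h⟩
  · rintro ⟨Z, hZ, h⟩
    choose φ hφ using hZ
    exact ⟨φ, fun n => ⟨(hφ n).contDiff, (hφ n).hasCompactSupport⟩, (key φ Z hφ).2 h⟩

theorem continuous_integral_mul {ψ : ℝ × ℝ → ℂ} (hψ : Continuous ψ) (hc : HasCompactSupport ψ) :
    Continuous fun u : L2Pencil d => ∫ p in pencil d, u p * ψ p := by
  have hm : MemLp (fun p => starRingEnd ℂ (ψ p)) 2 (volume.restrict (pencil d)) :=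
    (Complex.continuous_conj.comp hψ).memLp_of_hasCompactSupport
      (hc.comp_left (map_zero _))
  have : (fun u : L2Pencil d => ∫ p in pencil d, u p * ψ p) =
      fun u => inner ℂ (hm.toLp _) u := by
    ext u
    rw [l2_inner_eq]
    refine integral_congr_ae ?_
    filter_upwards [hm.coeFn_toLp] with p hp
    rw [hp, Complex.conj_conj, mul_comm]
  rw [this]
  fun_prop

theorem isClosed_isWeakDeriv (v : ℝ × ℝ) :
    IsClosed {w : L2Pencil d × L2Pencil d | IsWeakDeriv d v w.1 w.2} := by
  simp only [IsWeakDeriv, ofPred_forall]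
  refine isClosed_iInter fun φ => isClosed_iInter fun hs => isClosed_iInter fun hc =>
    isClosed_iInter fun _ => isClosed_eq ?_ ?_
  · exact (continuous_integral_mul (continuous_pd hs v) (hasCompactSupport_pd hc v)).comp
      continuous_fst
  · exact ((continuous_integral_mul hs.continuous hc).comp continuous_snd).neg

theorem isClosed_inFormDomain : IsClosed {U : Jet d | InFormDomain U} := by
  have h1 : IsClosed {U : Jet d | IsWeakDeriv d (1, 0) U.val U.dx} :=
    (isClosed_isWeakDeriv (d := d) (1, 0)).preimage
      (f := fun U : Jet d => (U.val, U.dx)) (by fun_prop)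
  have h2 : IsClosed {U : Jet d | IsWeakDeriv d (0, 1) U.val U.dy} :=
    (isClosed_isWeakDeriv (d := d) (0, 1)).preimage
      (f := fun U : Jet d => (U.val, U.dy)) (by fun_prop)
  have h3 : IsClosed {U : Jet d | HasTraces U 0 0} := by
    simp only [hasTraces_iff]
    exact isClosed_closure.preimage (by fun_prop)
  exact (h1.inter h2).inter h3

/-- A closed condition that holds for the smooth jets, whose traces on `|x - y| = d` need not
vanish, holds on the form domain. -/
theorem InFormDomain.induction {p : Jet d × L2Ray × L2Ray → Prop} (hp : IsClosed {Z | p Z})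
    (h : ∀ φ Z, IsSmoothJet φ Z → p Z) {U : Jet d} (hU : InFormDomain U) : p (U, 0, 0) :=
  closure_minimal (fun Z hZ => hZ.elim fun φ hφ => h φ Z hφ) hp ((hasTraces_iff U 0 0).1 hU.2)

/-- The jets with the Hilbert space norm, instead of the supremum norm of the product. -/
abbrev JetHilbert (d : ℝ) : Type :=
  WithLp 2 (L2Pencil d × WithLp 2 (L2Pencil d × WithLp 2 (L2Pencil d ×
    WithLp 2 (L2Seg d × WithLp 2 (L2Seg d × L2Ray)))))

/-- The identity from the Hilbert space of jets to the product. -/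
def toJet (d : ℝ) : JetHilbert d →L[ℂ] Jet d :=
  let e {α β γ : Type} [NormedAddCommGroup α] [NormedSpace ℂ α] [NormedAddCommGroup β]
      [NormedSpace ℂ β] [NormedAddCommGroup γ] [NormedSpace ℂ γ] (L : β →L[ℂ] γ) :
      WithLp 2 (α × β) →L[ℂ] α × γ :=
    ((ContinuousLinearMap.id ℂ α).prodMap L) ∘L
      (WithLp.prodContinuousLinearEquiv 2 ℂ α β : WithLp 2 (α × β) →L[ℂ] α × β)
  e (e (e (e (e (ContinuousLinearMap.id ℂ _)))))

theorem exists_toJet_eq (U : Jet d) : ∃ Z : JetHilbert d, toJet d Z = U :=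
  ⟨WithLp.toLp 2 (U.1, WithLp.toLp 2 (U.2.1, WithLp.toLp 2 (U.2.2.1,
    WithLp.toLp 2 (U.2.2.2.1, WithLp.toLp 2 (U.2.2.2.2.1, U.2.2.2.2.2))))), rfl⟩

theorem norm_sq_jetHilbert (Z : JetHilbert d) :
    ‖Z‖ ^ 2 = ‖(toJet d Z).val‖ ^ 2 + ‖(toJet d Z).dx‖ ^ 2 + ‖(toJet d Z).dy‖ ^ 2 +
      ‖(toJet d Z).bottom‖ ^ 2 + ‖(toJet d Z).left‖ ^ 2 + ‖(toJet d Z).diag‖ ^ 2 := by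
  simp only [WithLp.prod_norm_sq_eq_of_L2, add_assoc]
  rfl

/-- The form domain as a subspace of the Hilbert space of jets. -/
def formDomain (d : ℝ) : Submodule ℂ (JetHilbert d) where
  carrier := {Z | InFormDomain (toJet d Z)}
  zero_mem' := by
    change InFormDomain (toJet d 0)
    rw [map_zero]
    exact InFormDomain.zero
  add_mem' := fun {a b} ha hb => by
    change InFormDomain (toJet d (a + b))
    rw [map_add]
    exact InFormDomain.add ha hb
  smul_mem' := fun c a ha => by
    change InFormDomain (toJet d (c • a))
    rw [map_smul]
    exact InFormDomain.smul c ha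

/-- The form domain as a Hilbert space. -/
def FormSpace (d : ℝ) : Type := formDomain d

instance : NormedAddCommGroup (FormSpace d) := inferInstanceAs (NormedAddCommGroup (formDomain d))

instance : InnerProductSpace ℂ (FormSpace d) :=
  inferInstanceAs (InnerProductSpace ℂ (formDomain d))

instance : CompleteSpace (FormSpace d) :=
  (isClosed_inFormDomain.preimage (toJet d).continuous).completeSpace_coe (α := JetHilbert d)

/-- The inclusion of the form domain. -/
def formSpaceIncl (d : ℝ) : FormSpace d →L[ℂ] JetHilbert d := (formDomain d).subtypeL

/-- The jet of an element of the form domain. -/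
def jetL (d : ℝ) : FormSpace d →L[ℂ] Jet d := toJet d ∘L formSpaceIncl d

theorem jetL_inFormDomain (U : FormSpace d) : InFormDomain (jetL d U) := Subtype.property U

theorem exists_jetL_eq {U : Jet d} (hU : InFormDomain U) : ∃ X : FormSpace d, jetL d X = U := by
  obtain ⟨Z, rfl⟩ := exists_toJet_eq U
  exact ⟨⟨Z, hU⟩, rfl⟩

theorem norm_sq_formDomain (U : FormSpace d) :
    ‖U‖ ^ 2 = ‖(jetL d U).val‖ ^ 2 + ‖(jetL d U).dx‖ ^ 2 + ‖(jetL d U).dy‖ ^ 2 +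
      ‖(jetL d U).bottom‖ ^ 2 + ‖(jetL d U).left‖ ^ 2 + ‖(jetL d U).diag‖ ^ 2 :=
  norm_sq_jetHilbert (formSpaceIncl d U)

section Components

/-- The embedding of the form domain into `L²(Ω)`. -/
def valL (d : ℝ) : FormSpace d →L[ℂ] L2Pencil d :=
  ContinuousLinearMap.fst ℂ (L2Pencil d) _ ∘L jetL d

/-- The derivative in the first variable, on the form domain. -/
def dxL (d : ℝ) : FormSpace d →L[ℂ] L2Pencil d :=
  ContinuousLinearMap.fst ℂ (L2Pencil d) _ ∘L ContinuousLinearMap.snd ℂ (L2Pencil d) _ ∘L jetL d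

/-- The derivative in the second variable, on the form domain. -/
def dyL (d : ℝ) : FormSpace d →L[ℂ] L2Pencil d :=
  ContinuousLinearMap.fst ℂ (L2Pencil d) _ ∘L ContinuousLinearMap.snd ℂ (L2Pencil d) _ ∘L
    ContinuousLinearMap.snd ℂ (L2Pencil d) _ ∘L jetL d

/-- The three traces on the form domain. -/
def tracesL (d : ℝ) : FormSpace d →L[ℂ] L2Seg d × L2Seg d × L2Ray :=
  ContinuousLinearMap.snd ℂ (L2Pencil d) _ ∘L ContinuousLinearMap.snd ℂ (L2Pencil d) _ ∘L
    ContinuousLinearMap.snd ℂ (L2Pencil d) _ ∘L jetL d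

/-- The trace on the first axis. -/
def bottomL (d : ℝ) : FormSpace d →L[ℂ] L2Seg d :=
  ContinuousLinearMap.fst ℂ (L2Seg d) _ ∘L tracesL d

/-- The trace on the second axis. -/
def leftL (d : ℝ) : FormSpace d →L[ℂ] L2Seg d :=
  ContinuousLinearMap.fst ℂ (L2Seg d) _ ∘L ContinuousLinearMap.snd ℂ (L2Seg d) _ ∘L tracesL d

/-- The trace on the diagonal. -/
def diagL (d : ℝ) : FormSpace d →L[ℂ] L2Ray :=
  ContinuousLinearMap.snd ℂ (L2Seg d) L2Ray ∘L ContinuousLinearMap.snd ℂ (L2Seg d) _ ∘L tracesL d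

end Components

@[simp] theorem valL_apply (U : FormSpace d) : valL d U = (jetL d U).val := rfl

/-- The operator that represents the form `(X, U) ↦ ⟪L X, M (L U)⟫`. -/
def sandwich {V E : Type*} [NormedAddCommGroup V] [InnerProductSpace ℂ V] [CompleteSpace V]
    [NormedAddCommGroup E] [InnerProductSpace ℂ E] [CompleteSpace E]
    (L : V →L[ℂ] E) (M : E →L[ℂ] E) : V →L[ℂ] V :=
  ContinuousLinearMap.adjoint L ∘L M ∘L L

theorem inner_sandwich {V E : Type*} [NormedAddCommGroup V] [InnerProductSpace ℂ V]
    [CompleteSpace V] [NormedAddCommGroup E] [InnerProductSpace ℂ E] [CompleteSpace E]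
    (L : V →L[ℂ] E) (M : E →L[ℂ] E) (X U : V) :
    inner ℂ X (sandwich L M U) = inner ℂ (L X) (M (L U)) := by
  rw [sandwich, ContinuousLinearMap.comp_apply, ContinuousLinearMap.adjoint_inner_right,
    ContinuousLinearMap.comp_apply]

/-- The bounded operator on the form domain that represents the form. -/
def formOp (d : ℝ) (σ α : LInftyRay) : FormSpace d →L[ℂ] FormSpace d :=
  sandwich (dxL d) (ContinuousLinearMap.id ℂ _) + sandwich (dyL d) (ContinuousLinearMap.id ℂ _)
    - (sandwich (bottomL d) (mulOp seg_ac σ) + sandwich (leftL d) (mulOp seg_ac σ))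
    + sandwich (diagL d) (mulOp .rfl α)

theorem inner_formOp (σ α : LInftyRay) (V U : FormSpace d) :
    inner ℂ V (formOp d σ α U) = form σ α (jetL d V) (jetL d U) := by
  rw [form_eq_inner]
  simp only [formOp, add_apply, sub_apply, inner_add_right, inner_sub_right, inner_sandwich]
  rfl

theorem formOp_symm (σ α : LInftyRay) (V U : FormSpace d) :
    inner ℂ (formOp d σ α V) U = inner ℂ V (formOp d σ α U) := by
  rw [← inner_conj_symm (𝕜 := ℂ) (formOp d σ α V) U, inner_formOp, inner_formOp, form_conj_symm]

theorem mem_graph_operator_iff (σ α : LInftyRay) (u f : L2Pencil d) :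
    (u, f) ∈ (operator d σ α).graph ↔ ∃ U : FormSpace d, valL d U = u ∧
      ∀ X : FormSpace d, inner ℂ X (formOp d σ α U) = inner ℂ (valL d X) f := by
  rw [operator_graph]
  constructor
  · rintro ⟨U, hU, hu, h⟩
    obtain ⟨X, rfl⟩ := exists_jetL_eq hU
    exact ⟨X, hu, fun Y => by rw [inner_formOp, h _ (jetL_inFormDomain Y)]; rfl⟩
  · rintro ⟨U, hu, h⟩
    refine ⟨jetL d U, jetL_inFormDomain U, hu, fun V hV => ?_⟩
    obtain ⟨Y, rfl⟩ := exists_jetL_eq hV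
    rw [← inner_formOp, h]
    rfl

end

section

/-! ### A one-dimensional inequality and its integral over parallel segments -/

/-- Jacobi's trick: `‖f' + w f‖² ≥ 0`, integrated by parts, for a weight with the Riccati bound
`w² - w' ≤ C`. -/
theorem riccati_inequality {f f' : ℝ → ℂ} {w w' : ℝ → ℝ} {h : ℝ} (hh : 0 ≤ h)
    (hf : ∀ t ∈ Icc 0 h, HasDerivAt f (f' t) t) (hf' : ContinuousOn f' (Icc 0 h))
    (hw : ∀ t ∈ Icc 0 h, HasDerivAt w (w' t) t) (hw' : ContinuousOn w' (Icc 0 h))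
    {C : ℝ} (hC : ∀ t ∈ Icc 0 h, w t ^ 2 - w' t ≤ C) :
    w 0 * ‖f 0‖ ^ 2 - w h * ‖f h‖ ^ 2 ≤ ∫ t in Ioc 0 h, (‖f' t‖ ^ 2 + C * ‖f t‖ ^ 2) := by
  have hfc : ContinuousOn f (Icc 0 h) := fun t ht => (hf t ht).continuousAt.continuousWithinAt
  have hwc : ContinuousOn w (Icc 0 h) := fun t ht => (hw t ht).continuousAt.continuousWithinAt
  set g' : ℝ → ℝ := fun t => w' t * ‖f t‖ ^ 2 + w t * (2 * inner ℝ (f t) (f' t)) with hg'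
  have hg : ∀ t ∈ uIcc 0 h, HasDerivAt (fun t => w t * ‖f t‖ ^ 2) (g' t) t := fun t ht => by
    rw [uIcc_of_le hh] at ht
    exact (hw t ht).mul (hf t ht).norm_sq
  have hgc : ContinuousOn g' (Icc 0 h) :=
    (hw'.mul (hfc.norm.pow 2)).add (hwc.mul (continuousOn_const.mul (hfc.inner (𝕜 := ℝ) hf')))
  have hgi : IntervalIntegrable g' volume 0 h :=
    ContinuousOn.intervalIntegrable (by rwa [uIcc_of_le hh])
  have e := intervalIntegral.integral_eq_sub_of_hasDerivAt hg hgi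
  rw [intervalIntegral.integral_of_le hh] at e
  have hi : ContinuousOn (fun t => ‖f' t‖ ^ 2 + C * ‖f t‖ ^ 2) (Icc 0 h) :=
    (hf'.norm.pow 2).add (continuousOn_const.mul (hfc.norm.pow 2))
  have i1 : IntegrableOn (fun t => -g' t) (Ioc 0 h) :=
    (hgc.neg.integrableOn_Icc).mono_set Ioc_subset_Icc_self
  have i2 := (hi.integrableOn_Icc (μ := volume)).mono_set Ioc_subset_Icc_self
  have h1 : ∫ t in Ioc 0 h, -g' t ≤ ∫ t in Ioc 0 h, (‖f' t‖ ^ 2 + C * ‖f t‖ ^ 2) := by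
    refine setIntegral_mono_on i1 i2 measurableSet_Ioc fun t ht => ?_
    have h2 := norm_add_sq_real (f' t) (w t • f t)
    rw [inner_smul_right, norm_smul, mul_pow, Real.norm_eq_abs, sq_abs, real_inner_comm] at h2
    have h3 := hC t (Ioc_subset_Icc_self ht)
    have h4 := mul_le_mul_of_nonneg_right h3 (sq_nonneg ‖f t‖)
    simp only [hg']
    nlinarith [sq_nonneg ‖f' t + w t • f t‖]
  rw [integral_neg, e] at h1
  linarith

section LinearImage

variable {e v : ℝ × ℝ}

theorem linComb_leftInverse (hD : e.1 * v.2 - e.2 * v.1 ≠ 0) :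
    Function.LeftInverse (fun q : ℝ × ℝ => ((q.1 * v.2 - q.2 * v.1) / (e.1 * v.2 - e.2 * v.1),
      (e.1 * q.2 - e.2 * q.1) / (e.1 * v.2 - e.2 * v.1)))
      (fun p : ℝ × ℝ => p.1 • e + p.2 • v) := fun p => by
  simp only [Prod.fst_add, Prod.smul_fst, Prod.snd_add, Prod.smul_snd, smul_eq_mul]
  ext
  · simp only
    rw [div_eq_iff hD]
    ring
  · simp only
    rw [div_eq_iff hD]
    ring

theorem hasCompactSupport_comp_linComb {E : Type*} [Zero E] (hD : e.1 * v.2 - e.2 * v.1 ≠ 0)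
    {G : ℝ × ℝ → E} (hc : HasCompactSupport G) :
    HasCompactSupport fun p : ℝ × ℝ => G (p.1 • e + p.2 • v) :=
  hc.comp_isClosedEmbedding ((linComb_leftInverse hD).isClosedEmbedding (by fun_prop)
    (by fun_prop))

theorem setIntegral_image_linComb {E : Type*} [NormedAddCommGroup E] [NormedSpace ℝ E]
    (hD : e.1 * v.2 - e.2 * v.1 ≠ 0) {S : Set (ℝ × ℝ)} (hS : MeasurableSet S) (G : ℝ × ℝ → E) :
    ∫ p in (fun p : ℝ × ℝ => p.1 • e + p.2 • v) '' S, G p =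
      |e.1 * v.2 - e.2 * v.1| • ∫ p in S, G (p.1 • e + p.2 • v) := by
  set L : ℝ × ℝ →L[ℝ] ℝ × ℝ := (ContinuousLinearMap.fst ℝ ℝ ℝ).smulRight e +
    (ContinuousLinearMap.snd ℝ ℝ ℝ).smulRight v
  have hL : ∀ p : ℝ × ℝ, L p = p.1 • e + p.2 • v := fun p => rfl
  have hdet : L.det = e.1 * v.2 - e.2 * v.1 := by
    rw [ContinuousLinearMap.det, ← LinearMap.det_toMatrix (Module.Basis.finTwoProd ℝ),
      Matrix.det_fin_two]
    simp [LinearMap.toMatrix_apply, hL]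
    ring
  have := integral_image_eq_integral_abs_det_fderiv_smul volume hS
    (f := fun p : ℝ × ℝ => p.1 • e + p.2 • v) (f' := fun _ => L)
    (fun x _ => L.hasFDerivWithinAt) (linComb_leftInverse hD).injective.injOn G
  rw [this, hdet, integral_smul]

end LinearImage

theorem hasDerivAt_line {φ : ℝ × ℝ → ℂ} (hs : ContDiff ℝ ∞ φ) (q v : ℝ × ℝ) (t : ℝ) :
    HasDerivAt (fun t : ℝ => φ (q + t • v)) (pd v φ (q + t • v)) t := by
  have h1 : HasFDerivAt φ (fderiv ℝ φ (q + t • v)) (q + t • v) :=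
    (hs.differentiable (by simp) _).hasFDerivAt
  have h2 : HasDerivAt (fun t : ℝ => q + t • v) v t := by
    simpa using ((hasDerivAt_id t).smul_const v).const_add q
  exact h1.comp_hasDerivAt t h2

theorem hasCompactSupport_norm_sq {X : Type*} [TopologicalSpace X] {ψ : X → ℂ}
    (hc : HasCompactSupport ψ) : HasCompactSupport fun x => ‖ψ x‖ ^ 2 :=
  hc.comp_left (g := fun z : ℂ => ‖z‖ ^ 2) (by simp)

/-- The Riccati inequality on the segments `b • e + [0, h] • v`, `b ∈ I`, integrated over `b`. -/
theorem riccati_transverse {φ : ℝ × ℝ → ℂ} (hs : ContDiff ℝ ∞ φ) (hc : HasCompactSupport φ)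
    {e v : ℝ × ℝ} (hD : e.1 * v.2 - e.2 * v.1 ≠ 0) {I : Set ℝ} (hI : MeasurableSet I)
    {w w' : ℝ → ℝ} {h : ℝ} (hh : 0 ≤ h)
    (hw : ∀ t ∈ Icc 0 h, HasDerivAt w (w' t) t) (hw' : ContinuousOn w' (Icc 0 h))
    {C : ℝ} (hC : ∀ t ∈ Icc 0 h, w t ^ 2 - w' t ≤ C) :
    |e.1 * v.2 - e.2 * v.1| *
      (w 0 * (∫ b in I, ‖φ (b • e)‖ ^ 2) - w h * ∫ b in I, ‖φ (b • e + h • v)‖ ^ 2) ≤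
      ∫ p in (fun p : ℝ × ℝ => p.1 • e + p.2 • v) '' (I ×ˢ Ioc 0 h),
        (‖pd v φ p‖ ^ 2 + C * ‖φ p‖ ^ 2) := by
  rw [setIntegral_image_linComb hD (hI.prod measurableSet_Ioc), smul_eq_mul]
  refine mul_le_mul_of_nonneg_left ?_ (abs_nonneg _)
  set G : ℝ × ℝ → ℝ := fun p => ‖pd v φ p‖ ^ 2 + C * ‖φ p‖ ^ 2
  have hGc : Continuous G := ((continuous_pd hs v).norm.pow 2).add
    (continuous_const.mul (hs.continuous.norm.pow 2))
  have hGs : HasCompactSupport G := (hasCompactSupport_norm_sq (hasCompactSupport_pd hc v)).add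
    ((hasCompactSupport_norm_sq hc).mul_left)
  have hGi : Integrable fun p : ℝ × ℝ => G (p.1 • e + p.2 • v) :=
    (hGc.comp (f := fun p : ℝ × ℝ => p.1 • e + p.2 • v)
      (by fun_prop)).integrable_of_hasCompactSupport (hasCompactSupport_comp_linComb hD hGs)
  have hslice : ∀ t : ℝ, Integrable fun b : ℝ => ‖φ (b • e + t • v)‖ ^ 2 := fun t => by
    have hcl : Topology.IsClosedEmbedding fun b : ℝ => (b, t) :=
      Function.LeftInverse.isClosedEmbedding (f := Prod.fst) (fun b => rfl) (by fun_prop)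
        (by fun_prop)
    have hcont : Continuous fun b : ℝ => ‖φ (b • e + t • v)‖ ^ 2 :=
      (hs.continuous.comp (f := fun b : ℝ => b • e + t • v) (by fun_prop)).norm.pow 2
    have hcs : HasCompactSupport ((fun p : ℝ × ℝ => ‖φ (p.1 • e + p.2 • v)‖ ^ 2) ∘
        fun b : ℝ => (b, t)) :=
      (hasCompactSupport_comp_linComb (G := fun p => ‖φ p‖ ^ 2) hD
        (hasCompactSupport_norm_sq hc)).comp_isClosedEmbedding hcl
    exact hcont.integrable_of_hasCompactSupport hcs
  have h0 := hslice 0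
  simp only [zero_smul, add_zero] at h0
  rw [Measure.volume_eq_prod, setIntegral_prod _ hGi.integrableOn,
    ← integral_const_mul, ← integral_const_mul,
    ← integral_sub (h0.integrableOn.const_mul _) ((hslice h).integrableOn.const_mul _)]
  refine setIntegral_mono_on ((h0.integrableOn.const_mul _).sub
    ((hslice h).integrableOn.const_mul _)) ?_ hI fun b _ => ?_
  · have := hGi.integrableOn (s := I ×ˢ Ioc 0 h)
    rw [Measure.volume_eq_prod, IntegrableOn, ← Measure.prod_restrict] at this
    exact this.integral_prod_left
  · have := riccati_inequality hh (fun t _ => hasDerivAt_line hs (b • e) v t)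
      ((continuous_pd hs v).comp (f := fun t : ℝ => b • e + t • v)
        (by fun_prop)).continuousOn hw hw' hC
    simpa using this

/-- The trace inequality on the segments `b • e + [0, h] • v`, `b ∈ I`, from the weight
`K (1 - t / h)`, which vanishes at the far end. -/
theorem trace_transverse {φ : ℝ × ℝ → ℂ} (hs : ContDiff ℝ ∞ φ) (hc : HasCompactSupport φ)
    {e v : ℝ × ℝ} (hD : |e.1 * v.2 - e.2 * v.1| = 1) {I : Set ℝ} (hI : MeasurableSet I)
    {h K : ℝ} (hh : 0 < h) (hK : 0 ≤ K) {N : Set (ℝ × ℝ)}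
    (hsub : ∀ b ∈ I, ∀ t ∈ Ioc 0 h, b • e + t • v ∈ N) :
    K * ∫ b in I, ‖φ (b • e)‖ ^ 2 ≤
      ∫ p in N, (‖pd v φ p‖ ^ 2 + (K ^ 2 + K / h) * ‖φ p‖ ^ 2) := by
  have hD' : e.1 * v.2 - e.2 * v.1 ≠ 0 := fun h0 => by simp [h0] at hD
  have hw : ∀ t ∈ Icc 0 h, HasDerivAt (fun t => K * (1 - t / h)) (-(K / h)) t := fun t _ => by
    have := (((hasDerivAt_id t).div_const h).const_sub 1).const_mul K
    rw [show -(K / h) = K * -(1 / h) by ring]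
    exact this
  have key := riccati_transverse hs hc hD' hI hh.le hw continuousOn_const
    (C := K ^ 2 + K / h) (fun t ht => by
      have h1 : 0 ≤ 1 - t / h := sub_nonneg.2 ((div_le_one hh).2 ht.2)
      have h2 : 1 - t / h ≤ 1 := by linarith [div_nonneg ht.1 hh.le]
      have h3 : (1 - t / h) ^ 2 ≤ 1 := by nlinarith
      nlinarith [mul_le_mul_of_nonneg_left h3 (sq_nonneg K)])
  rw [hD, one_mul] at key
  simp only [zero_div, sub_zero, mul_one, div_self hh.ne', sub_self, mul_zero, zero_mul] at key
  refine key.trans (setIntegral_mono_set ?_ ?_ ?_)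
  · refine Continuous.integrable_of_hasCompactSupport ?_ ?_ |>.integrableOn
    · exact ((continuous_pd hs v).norm.pow 2).add
        (continuous_const.mul (hs.continuous.norm.pow 2))
    · exact (hasCompactSupport_norm_sq (hasCompactSupport_pd hc v)).add
        ((hasCompactSupport_norm_sq hc).mul_left)
  · exact ae_of_all _ fun p => by simp only [Pi.zero_apply]; positivity
  · refine LE.le.eventuallyLE ?_
    rintro _ ⟨p, hp, rfl⟩
    exact hsub _ hp.1 _ hp.2

end

section

/-! ### The Poincaré inequality on convex sets -/

/-- `|∇φ|²`. -/
def gradSq (φ : ℝ × ℝ → ℂ) (p : ℝ × ℝ) : ℝ := ‖pd (1, 0) φ p‖ ^ 2 + ‖pd (0, 1) φ p‖ ^ 2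

theorem gradSq_nonneg (φ : ℝ × ℝ → ℂ) (p : ℝ × ℝ) : 0 ≤ gradSq φ p := by
  unfold gradSq
  positivity

theorem continuous_gradSq {φ : ℝ × ℝ → ℂ} (hs : ContDiff ℝ ∞ φ) : Continuous (gradSq φ) :=
  ((continuous_pd hs _).norm.pow 2).add ((continuous_pd hs _).norm.pow 2)

theorem hasCompactSupport_gradSq {φ : ℝ × ℝ → ℂ} (hc : HasCompactSupport φ) :
    HasCompactSupport (gradSq φ) :=
  (hasCompactSupport_norm_sq (hasCompactSupport_pd hc _)).add
    (hasCompactSupport_norm_sq (hasCompactSupport_pd hc _))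

theorem pd_eq (φ : ℝ × ℝ → ℂ) (v p : ℝ × ℝ) :
    pd v φ p = v.1 * pd (1, 0) φ p + v.2 * pd (0, 1) φ p := by
  have : v = v.1 • ((1, 0) : ℝ × ℝ) + v.2 • ((0, 1) : ℝ × ℝ) := by ext <;> simp
  conv_lhs => rw [this]
  simp only [pd, map_add, map_smul, Complex.real_smul]

theorem norm_pd_sq_le (φ : ℝ × ℝ → ℂ) {v : ℝ × ℝ} {l : ℝ} (h1 : |v.1| ≤ l) (h2 : |v.2| ≤ l)
    (p : ℝ × ℝ) : ‖pd v φ p‖ ^ 2 ≤ 2 * l ^ 2 * gradSq φ p := by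
  have h := norm_add_le (v.1 * pd (1, 0) φ p) (v.2 * pd (0, 1) φ p)
  rw [← pd_eq, norm_mul, norm_mul, Complex.norm_real, Complex.norm_real, Real.norm_eq_abs,
    Real.norm_eq_abs] at h
  have hl : 0 ≤ l := (abs_nonneg _).trans h1
  have h3 : ‖pd v φ p‖ ≤ l * ‖pd (1, 0) φ p‖ + l * ‖pd (0, 1) φ p‖ := by
    refine h.trans ?_
    gcongr
  have h4 : ‖pd v φ p‖ ^ 2 ≤ (l * ‖pd (1, 0) φ p‖ + l * ‖pd (0, 1) φ p‖) ^ 2 := by gcongr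
  refine h4.trans ?_
  unfold gradSq
  nlinarith [sq_nonneg (l * ‖pd (1, 0) φ p‖ - l * ‖pd (0, 1) φ p‖)]

theorem integrableOn_of_isBounded {X E : Type*} [MetricSpace X] [ProperSpace X]
    [MeasurableSpace X] [OpensMeasurableSpace X] [NormedAddCommGroup E]
    {μ : Measure X} [IsFiniteMeasureOnCompacts μ]
    {f : X → E} (hf : Continuous f) {S : Set X} (hS : Bornology.IsBounded S) :
    IntegrableOn f S μ :=
  (hf.continuousOn.integrableOn_compact hS.isCompact_closure).mono_set subset_closure

variable {Q : Set (ℝ × ℝ)}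

/-- Contraction of a convex set with ratio `τ ≥ 1/2` towards one of its points; the Jacobian `τ²` is
at least `1/4`. -/
theorem setIntegral_homothety_le (hm : MeasurableSet Q) (hb : Bornology.IsBounded Q)
    (hQ : Convex ℝ Q) {g : ℝ × ℝ → ℝ} (hg : Continuous g) (h0 : ∀ p, 0 ≤ g p) {q : ℝ × ℝ}
    (hq : q ∈ Q) {τ : ℝ} (h1 : 1 / 2 ≤ τ) (h2 : τ ≤ 1) :
    ∫ p in Q, g (q + τ • (p - q)) ≤ 4 * ∫ p in Q, g p := by
  set f : ℝ × ℝ → ℝ × ℝ := fun p => q + τ • (p - q)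
  have hτ : τ ≠ 0 := by linarith
  set L : ℝ × ℝ →L[ℝ] ℝ × ℝ := τ • ContinuousLinearMap.id ℝ (ℝ × ℝ) with hL
  have hdet : L.det = τ ^ 2 := by
    have : (L : ℝ × ℝ →ₗ[ℝ] ℝ × ℝ) = τ • LinearMap.id := rfl
    rw [ContinuousLinearMap.det, this, LinearMap.det_smul, LinearMap.det_id, mul_one]
    simp
  have hf : ∀ p ∈ Q, HasFDerivWithinAt f L Q p := fun p _ =>
    ((((hasFDerivAt_id p).sub_const q).const_smul τ).const_add q).hasFDerivWithinAt
  have hinj : InjOn f Q := fun a _ b _ hab => by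
    have := smul_right_injective _ hτ (add_left_cancel hab)
    exact sub_left_injective this
  have h := integral_image_eq_integral_abs_det_fderiv_smul volume hm hf hinj g
  rw [hdet, abs_of_nonneg (sq_nonneg τ), integral_smul, smul_eq_mul] at h
  have hsub : f '' Q ⊆ Q := by
    rintro _ ⟨p, hp, rfl⟩
    exact hQ.add_smul_sub_mem hq hp ⟨by linarith, h2⟩
  have h3 : ∫ p in f '' Q, g p ≤ ∫ p in Q, g p :=
    setIntegral_mono_set (integrableOn_of_isBounded hg hb) (ae_of_all _ h0) hsub.eventuallyLE
  have h4 : 0 ≤ ∫ p in Q, g (f p) := integral_nonneg fun p => h0 _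
  have h5 : 1 / 4 ≤ τ ^ 2 := by nlinarith
  nlinarith

/-- If `τ ≥ 1/2`, the contraction in the second endpoint is used, otherwise that in the first. -/
theorem setIntegral_segment_le (hm : MeasurableSet Q) (hb : Bornology.IsBounded Q)
    (hQ : Convex ℝ Q) {g : ℝ × ℝ → ℝ} (hg : Continuous g) (h0 : ∀ p, 0 ≤ g p) {τ : ℝ}
    (h1 : 0 ≤ τ) (h2 : τ ≤ 1) :
    ∫ z in Q ×ˢ Q, g (z.1 + τ • (z.2 - z.1)) ≤ 4 * volume.real Q * ∫ p in Q, g p := by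
  have hgz : Continuous fun z : (ℝ × ℝ) × (ℝ × ℝ) => g (z.1 + τ • (z.2 - z.1)) := by fun_prop
  have hi : IntegrableOn (fun z : (ℝ × ℝ) × (ℝ × ℝ) => g (z.1 + τ • (z.2 - z.1))) (Q ×ˢ Q) :=
    integrableOn_of_isBounded hgz (hb.prod hb)
  have hfin : volume Q ≠ ⊤ := hb.measure_lt_top.ne
  have hconst : ∫ _ in Q, 4 * ∫ p in Q, g p = 4 * volume.real Q * ∫ p in Q, g p := by
    rw [setIntegral_const, smul_eq_mul]
    ring
  rw [← hconst]
  rw [Measure.volume_eq_prod, IntegrableOn, ← Measure.prod_restrict] at hi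
  rw [Measure.volume_eq_prod]
  rcases le_total (1 / 2) τ with h | h
  · rw [← Measure.prod_restrict, integral_prod _ hi]
    exact setIntegral_mono_on hi.integral_prod_left (integrableOn_const hfin) hm fun q hq =>
      setIntegral_homothety_le hm hb hQ hg h0 hq h h2
  · rw [← Measure.prod_restrict, integral_prod_symm _ hi]
    refine setIntegral_mono_on hi.integral_prod_right (integrableOn_const hfin) hm
      fun p hp => ?_
    have := setIntegral_homothety_le hm hb hQ hg h0 hp (τ := 1 - τ) (by linarith) (by linarith)
    refine le_of_eq_of_le (integral_congr_ae (ae_of_all _ fun q => ?_)) this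
    simp only
    congr 1
    module

theorem norm_sub_sq_le_integral {φ : ℝ × ℝ → ℂ} (hs : ContDiff ℝ ∞ φ) (p q : ℝ × ℝ) :
    ‖φ p - φ q‖ ^ 2 ≤ ∫ τ in Ioc (0 : ℝ) 1, ‖pd (p - q) φ (q + τ • (p - q))‖ ^ 2 := by
  set F : ℝ → ℂ := fun τ => pd (p - q) φ (q + τ • (p - q)) with hF
  have hFc : Continuous F := (continuous_pd hs _).comp
    (f := fun τ : ℝ => q + τ • (p - q)) (by fun_prop)
  have e : ∫ τ in Ioc (0 : ℝ) 1, F τ = φ p - φ q := by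
    rw [← intervalIntegral.integral_of_le zero_le_one,
      intervalIntegral.integral_eq_sub_of_hasDerivAt
        (fun τ _ => hasDerivAt_line hs q (p - q) τ) (hFc.intervalIntegrable 0 1)]
    simp
  have : IsProbabilityMeasure (volume.restrict (Ioc (0 : ℝ) 1)) :=
    ⟨by simp⟩
  have hconv : ConvexOn ℝ univ fun z : ℂ => ‖z‖ ^ 2 :=
    (convexOn_norm convex_univ).pow (fun z _ => norm_nonneg z) 2
  have := hconv.map_integral_le (μ := volume.restrict (Ioc (0 : ℝ) 1)) (f := F)
    (by fun_prop) isClosed_univ (by simp)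
    ((hFc.integrableOn_Icc (a := 0) (b := 1)).mono_set Ioc_subset_Icc_self)
    (((hFc.norm.pow 2).integrableOn_Icc (a := 0) (b := 1)).mono_set Ioc_subset_Icc_self)
  rw [e] at this
  exact this

theorem integral_sub_add {X : Type*} [MeasurableSpace X] {μ : Measure X} {f g h : X → ℝ}
    (hf : Integrable f μ) (hg : Integrable g μ) (hh : Integrable h μ) :
    ∫ x, (f x - g x + h x) ∂μ = ∫ x, f x ∂μ - ∫ x, g x ∂μ + ∫ x, h x ∂μ := by
  rw [← integral_sub hf hg]
  exact integral_add (f := fun x => f x - g x) (hf.sub hg) hh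

/-- The variance of `φ` on `Q` as a double integral. -/
theorem setIntegral_norm_sub_sq {φ : ℝ × ℝ → ℂ} (hφ : Continuous φ)
    (hb : Bornology.IsBounded Q) :
    ∫ z in Q ×ˢ Q, ‖φ z.2 - φ z.1‖ ^ 2 =
      2 * (volume.real Q * (∫ p in Q, ‖φ p‖ ^ 2) - ‖∫ p in Q, φ p‖ ^ 2) := by
  have hfin : volume Q ≠ ⊤ := hb.measure_lt_top.ne
  have hz : Continuous fun z : (ℝ × ℝ) × (ℝ × ℝ) => ‖φ z.2 - φ z.1‖ ^ 2 := by fun_prop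
  have i1 : IntegrableOn φ Q := integrableOn_of_isBounded hφ hb
  have i2 : IntegrableOn (fun p => ‖φ p‖ ^ 2) Q := integrableOn_of_isBounded (by fun_prop) hb
  rw [Measure.volume_eq_prod, setIntegral_prod]
  · have hin : ∀ q, ∫ p in Q, ‖φ p - φ q‖ ^ 2 =
        (∫ p in Q, ‖φ p‖ ^ 2) - 2 * inner ℝ (φ q) (∫ p in Q, φ p) +
          volume.real Q * ‖φ q‖ ^ 2 := fun q => by
      have i3 : IntegrableOn (fun p => inner ℝ (φ q) (φ p)) Q :=
        integrableOn_of_isBounded (by fun_prop) hb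
      have : ∀ p, ‖φ p - φ q‖ ^ 2 = ‖φ p‖ ^ 2 - 2 * inner ℝ (φ q) (φ p) + ‖φ q‖ ^ 2 := fun p => by
        rw [norm_sub_sq_real, real_inner_comm]
      simp only [this]
      rw [integral_sub_add i2 (i3.const_mul 2) (integrableOn_const hfin), integral_const_mul,
        integral_inner i1,
        setIntegral_const, smul_eq_mul]
    simp only [hin]
    have i3 : IntegrableOn (fun q => inner ℝ (φ q) (∫ p in Q, φ p)) Q :=
      integrableOn_of_isBounded (by fun_prop) hb
    have i4 : ∫ q in Q, inner ℝ (φ q) (∫ p in Q, φ p) = ‖∫ p in Q, φ p‖ ^ 2 := by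
      simp only [real_inner_comm (∫ p in Q, φ p)]
      rw [integral_inner i1, real_inner_self_eq_norm_sq]
    rw [integral_sub_add (integrableOn_const hfin) (i3.const_mul 2) (i2.const_mul _),
      integral_const_mul,
      integral_const_mul, setIntegral_const, smul_eq_mul, i4]
    ring
  · rw [← Measure.volume_eq_prod]
    exact integrableOn_of_isBounded hz (hb.prod hb)

/-- The Poincaré inequality on a convex set contained in a square of side `l`. -/
theorem poincare_convex {φ : ℝ × ℝ → ℂ} (hs : ContDiff ℝ ∞ φ) (hm : MeasurableSet Q)
    (hb : Bornology.IsBounded Q) (hQ : Convex ℝ Q) {l : ℝ}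
    (hl : ∀ p ∈ Q, ∀ q ∈ Q, |p.1 - q.1| ≤ l ∧ |p.2 - q.2| ≤ l) :
    ∫ p in Q, ‖φ p‖ ^ 2 ≤ (volume.real Q)⁻¹ * ‖∫ p in Q, φ p‖ ^ 2 +
      4 * l ^ 2 * ∫ p in Q, gradSq φ p := by
  have hg := continuous_gradSq hs
  have hfin : volume Q ≠ ⊤ := hb.measure_lt_top.ne
  set A : Set ((ℝ × ℝ) × (ℝ × ℝ)) := Q ×ˢ Q
  have hA : MeasurableSet A := hm.prod hm
  have hAb : Bornology.IsBounded A := hb.prod hb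
  have hcont : Continuous fun x : ((ℝ × ℝ) × (ℝ × ℝ)) × ℝ =>
      gradSq φ (x.1.1 + x.2 • (x.1.2 - x.1.1)) := by fun_prop
  have hi : Integrable (fun x : ((ℝ × ℝ) × (ℝ × ℝ)) × ℝ =>
      gradSq φ (x.1.1 + x.2 • (x.1.2 - x.1.1)))
      ((volume.restrict A).prod (volume.restrict (Ioc (0 : ℝ) 1))) := by
    rw [Measure.prod_restrict, ← Measure.volume_eq_prod]
    exact integrableOn_of_isBounded hcont (hAb.prod (Metric.isBounded_Ioc 0 1))
  have h1 : ∫ z in A, ‖φ z.2 - φ z.1‖ ^ 2 ≤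
      ∫ z in A, 2 * l ^ 2 * ∫ τ in Ioc (0 : ℝ) 1, gradSq φ (z.1 + τ • (z.2 - z.1)) := by
    refine setIntegral_mono_on ?_ (hi.integral_prod_left.const_mul _) hA fun z hz => ?_
    · have hz : Continuous fun z : (ℝ × ℝ) × (ℝ × ℝ) => ‖φ z.2 - φ z.1‖ ^ 2 := by
        have := hs.continuous
        fun_prop
      exact integrableOn_of_isBounded hz hAb
    · refine (norm_sub_sq_le_integral hs z.2 z.1).trans ?_
      rw [← integral_const_mul]
      have hc1 : Continuous fun τ : ℝ => z.1 + τ • (z.2 - z.1) := by fun_prop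
      refine setIntegral_mono_on ?_ ?_ measurableSet_Ioc fun τ _ =>
        norm_pd_sq_le φ (hl _ hz.2 _ hz.1).1 (hl _ hz.2 _ hz.1).2 _
      · exact integrableOn_of_isBounded (((continuous_pd hs _).comp hc1).norm.pow 2)
          (Metric.isBounded_Ioc 0 1)
      · exact integrableOn_of_isBounded (continuous_const.mul (hg.comp hc1))
          (Metric.isBounded_Ioc 0 1)
  rw [integral_const_mul, integral_integral_swap hi,
    setIntegral_norm_sub_sq hs.continuous hb] at h1
  have h2 : ∫ τ in Ioc (0 : ℝ) 1, ∫ z in A, gradSq φ (z.1 + τ • (z.2 - z.1)) ≤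
      ∫ _ in Ioc (0 : ℝ) 1, 4 * volume.real Q * ∫ p in Q, gradSq φ p :=
    setIntegral_mono_on hi.integral_prod_right (integrableOn_const (by simp)) measurableSet_Ioc
      fun τ hτ => setIntegral_segment_le hm hb hQ hg (gradSq_nonneg φ) hτ.1.le hτ.2
  rw [setIntegral_const, smul_eq_mul] at h2
  simp only [Real.volume_real_Ioc, sub_zero, max_eq_left zero_le_one, one_mul] at h2
  rcases eq_or_lt_of_le (measureReal_nonneg (μ := volume) (s := Q)) with h0 | h0
  · have hQ0 : volume.restrict Q = 0 := by
      rw [Measure.restrict_eq_zero]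
      exact ((measureReal_eq_zero_iff hfin).1 h0.symm)
    simp [hQ0]
  · have h3 : volume.real Q * (∫ p in Q, ‖φ p‖ ^ 2) ≤ ‖∫ p in Q, φ p‖ ^ 2 +
        volume.real Q * (4 * l ^ 2 * ∫ p in Q, gradSq φ p) := by
      nlinarith [mul_le_mul_of_nonneg_left h2 (sq_nonneg l)]
    rw [inv_mul_eq_div, ← sub_le_iff_le_add, le_div_iff₀ h0]
    linarith

/-- A bounded convex set is cut by a fine grid into convex cells; on each cell the Poincaré
inequality applies. -/
theorem exists_cells {N : Set (ℝ × ℝ)} (hm : MeasurableSet N) (hN : Convex ℝ N) {R : ℝ}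
    (hR : 0 < R) (hsub : N ⊆ Ico 0 R ×ˢ Ico 0 R) {ε : ℝ} (hε : 0 < ε) :
    ∃ (n : ℕ) (Q : Fin n × Fin n → Set (ℝ × ℝ)), (∀ i, MeasurableSet (Q i)) ∧
      (∀ i, Q i ⊆ N) ∧ ∀ φ : ℝ × ℝ → ℂ, ContDiff ℝ ∞ φ →
        ∫ p in N, ‖φ p‖ ^ 2 ≤ (∑ i, (volume.real (Q i))⁻¹ * ‖∫ p in Q i, φ p‖ ^ 2) +
          ε * ∫ p in N, gradSq φ p := by
  have hNb : Bornology.IsBounded N :=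
    ((Metric.isBounded_Ico 0 R).prod (Metric.isBounded_Ico 0 R)).subset hsub
  obtain ⟨n, hn⟩ := exists_nat_gt (max 1 (4 * R ^ 2 / ε))
  have hn1 : (1 : ℝ) < n := (le_max_left _ _).trans_lt hn
  have hn0 : (0 : ℝ) < n := by linarith
  set l : ℝ := R / n with hl
  have hl0 : 0 < l := div_pos hR hn0
  have hlε : 4 * l ^ 2 ≤ ε := by
    have h1 : 4 * R ^ 2 / ε < n := (le_max_right _ _).trans_lt hn
    rw [div_lt_iff₀ hε] at h1
    rw [hl, div_pow, ← mul_div_assoc, div_le_iff₀ (by positivity)]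
    nlinarith
  -- the cells are the intersections of `N` with the squares `S a × S b` of side `l = R / n`
  set S : ℕ → Set ℝ := fun k => Ico (k * l) ((k + 1) * l) with hS
  have hSd : ∀ a b : ℕ, ∀ x, x ∈ S a → x ∈ S b → a = b := by
    have : ∀ (a : ℕ) (x : ℝ), x ∈ S a → ⌊x / l⌋₊ = a := fun a x hx => by
      have h0 : 0 ≤ x / l := div_nonneg ((by positivity : (0 : ℝ) ≤ a * l).trans hx.1) hl0.le
      rw [Nat.floor_eq_iff h0, le_div_iff₀ hl0, div_lt_iff₀ hl0]
      exact hx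
    intro a b x ha hb
    rw [← this a x ha, this b x hb]
  have hSc : ∀ x ∈ Ico 0 R, ∃ k : Fin n, x ∈ S k := fun x hx => by
    have h0 : 0 ≤ x / l := div_nonneg hx.1 hl0.le
    refine ⟨⟨⌊x / l⌋₊, ?_⟩, ?_⟩
    · rw [Nat.floor_lt h0, div_lt_iff₀ hl0, hl, mul_div_cancel₀ _ hn0.ne']
      exact hx.2
    · have h1 := Nat.floor_le h0
      have h2 := Nat.lt_floor_add_one (x / l)
      rw [le_div_iff₀ hl0] at h1
      rw [div_lt_iff₀ hl0] at h2
      exact ⟨h1, h2⟩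
  set Q : Fin n × Fin n → Set (ℝ × ℝ) := fun i => N ∩ S i.1 ×ˢ S i.2 with hQ
  have hQm : ∀ i, MeasurableSet (Q i) := fun i =>
    hm.inter (measurableSet_Ico.prod measurableSet_Ico)
  have hQu : ⋃ i, Q i = N := by
    refine subset_antisymm (iUnion_subset fun i => inter_subset_left) fun p hp => ?_
    obtain ⟨a, ha⟩ := hSc _ (hsub hp).1
    obtain ⟨b, hb⟩ := hSc _ (hsub hp).2
    exact mem_iUnion.2 ⟨(a, b), hp, ha, hb⟩
  have hQd : Pairwise (Function.onFun Disjoint Q) := fun i j hij =>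
    Set.disjoint_left.2 fun p hi hj => hij (Prod.ext
      (Fin.ext (hSd _ _ _ hi.2.1 hj.2.1)) (Fin.ext (hSd _ _ _ hi.2.2 hj.2.2)))
  refine ⟨n, Q, hQm, fun i => inter_subset_left, fun φ hs => ?_⟩
  have hsum : ∀ f : ℝ × ℝ → ℝ, Continuous f → ∫ p in N, f p = ∑ i, ∫ p in Q i, f p :=
    fun f hf => by
    conv_lhs => rw [← hQu]
    exact integral_iUnion_fintype hQm hQd fun i =>
      integrableOn_of_isBounded hf (hNb.subset inter_subset_left)
  rw [hsum (fun p => ‖φ p‖ ^ 2) (hs.continuous.norm.pow 2), hsum _ (continuous_gradSq hs),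
    Finset.mul_sum, ← Finset.sum_add_distrib]
  refine Finset.sum_le_sum fun i _ => ?_
  have hside : ∀ (k : ℕ) (x y : ℝ), x ∈ S k → y ∈ S k → |x - y| ≤ l := fun k x y hx hy => by
    have h1 := hx.1; have h2 := hx.2; have h3 := hy.1; have h4 := hy.2
    rw [abs_le]
    constructor <;> linarith
  have hP := poincare_convex hs (hQm i) (hNb.subset inter_subset_left)
    (hN.inter ((convex_Ico _ _).prod (convex_Ico _ _))) (l := l)
    fun p hp q hq => ⟨hside _ _ _ hp.2.1 hq.2.1, hside _ _ _ hp.2.2 hq.2.2⟩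
  have h0 : 0 ≤ ∫ p in Q i, gradSq φ p := integral_nonneg (gradSq_nonneg φ)
  nlinarith

end

section

/-! ### Inequalities for smooth functions on the pencil -/

variable {d : ℝ}

theorem convex_pencil (d : ℝ) : Convex ℝ (pencil d) := by
  have h1 : Convex ℝ {p : ℝ × ℝ | 0 ≤ p.1} := convex_halfSpace_ge (by constructor <;> simp) 0
  have h2 : Convex ℝ {p : ℝ × ℝ | 0 ≤ p.2} := convex_halfSpace_ge (by constructor <;> simp) 0
  have h3 : Convex ℝ {p : ℝ × ℝ | |p.1 - p.2| ≤ d} := by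
    have ha : Convex ℝ {p : ℝ × ℝ | p.1 - p.2 ≤ d} :=
      convex_halfSpace_le (IsLinearMap.mk (fun _ _ => by simp; ring)
        (fun _ _ => by simp; ring)) d
    have hb : Convex ℝ {p : ℝ × ℝ | -d ≤ p.1 - p.2} :=
      convex_halfSpace_ge (IsLinearMap.mk (fun _ _ => by simp; ring)
        (fun _ _ => by simp; ring)) (-d)
    have he : {p : ℝ × ℝ | |p.1 - p.2| ≤ d} =
        {p : ℝ × ℝ | -d ≤ p.1 - p.2} ∩ {p : ℝ × ℝ | p.1 - p.2 ≤ d} := by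
      ext p
      simp [abs_le]
    rw [he]
    exact hb.inter ha
  exact h1.inter (h2.inter h3)

/-- The bounded part `x + y < R` of the pencil. -/
def nearPart (d R : ℝ) : Set (ℝ × ℝ) := pencil d ∩ {p | p.1 + p.2 < R}

/-- The part `x + y ≥ R` of the pencil, a half-strip if `d ≤ R`. -/
def farPart (d R : ℝ) : Set (ℝ × ℝ) := pencil d ∩ {p | R ≤ p.1 + p.2}

theorem measurableSet_nearPart (d R : ℝ) : MeasurableSet (nearPart d R) :=
  (measurableSet_pencil d).inter (measurableSet_lt (by fun_prop) measurable_const)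

theorem measurableSet_farPart (d R : ℝ) : MeasurableSet (farPart d R) :=
  (measurableSet_pencil d).inter (measurableSet_le measurable_const (by fun_prop))

theorem convex_nearPart (d R : ℝ) : Convex ℝ (nearPart d R) :=
  (convex_pencil d).inter (convex_halfSpace_lt
    (IsLinearMap.mk (fun _ _ => by simp; ring) (fun _ _ => by simp; ring)) R)

theorem nearPart_subset (d R : ℝ) : nearPart d R ⊆ Ico 0 R ×ˢ Ico 0 R := fun p hp => by
  obtain ⟨⟨h1, h2, -⟩, h3⟩ := hp
  have h4 : p.1 + p.2 < R := h3
  exact ⟨⟨h1, by linarith⟩, h2, by linarith⟩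

theorem setIntegral_near_add_far {R : ℝ} {f : ℝ × ℝ → ℝ} (hf : IntegrableOn f (pencil d)) :
    ∫ p in pencil d, f p = (∫ p in nearPart d R, f p) + ∫ p in farPart d R, f p := by
  have hu : pencil d = nearPart d R ∪ farPart d R := by
    rw [nearPart, farPart, ← inter_union_distrib_left]
    refine (inter_eq_left.2 fun p _ => ?_).symm
    exact lt_or_ge (p.1 + p.2) R
  conv_lhs => rw [hu]
  have hdisj : Disjoint (nearPart d R) (farPart d R) :=
    Set.disjoint_left.2 fun p hp hq => not_le.2 (show p.1 + p.2 < R from hp.2) hq.2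
  exact setIntegral_union hdisj (measurableSet_farPart d R) (hf.mono_set inter_subset_left)
    (hf.mono_set inter_subset_left)

section Smooth

variable {φ : ℝ × ℝ → ℂ} (hs : ContDiff ℝ ∞ φ) (hc : HasCompactSupport φ)
include hs hc

theorem integrable_norm_sq : Integrable fun p => ‖φ p‖ ^ 2 :=
  (hs.continuous.norm.pow 2).integrable_of_hasCompactSupport (hasCompactSupport_norm_sq hc)

theorem integrable_norm_sq_pd (v : ℝ × ℝ) : Integrable fun p => ‖pd v φ p‖ ^ 2 :=
  ((continuous_pd hs v).norm.pow 2).integrable_of_hasCompactSupport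
    (hasCompactSupport_norm_sq (hasCompactSupport_pd hc v))

theorem integrable_gradSq : Integrable (gradSq φ) :=
  (continuous_gradSq hs).integrable_of_hasCompactSupport (hasCompactSupport_gradSq hc)

theorem integrable_diag_norm_sq : Integrable fun y : ℝ => ‖φ (y, y)‖ ^ 2 :=
  (memLp_two_iff_integrable_sq_norm (by
    have := hs.continuous
    fun_prop)).1 (memLp_comp_curve hs.continuous hc (γ := fun y => (y, y)) (by fun_prop)
      continuous_fst (fun y => rfl) volume)

/-- The trace inequality, localized to the bounded part of the pencil: the traces are estimated
along segments of length `d / 2` that are parallel to the axes. -/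
theorem near_traces (hd : 0 < d) {R : ℝ} (hR : 2 * d ≤ R) {K : ℝ} (hK : 0 ≤ K) :
    K * ((∫ y in Icc 0 d, ‖φ (y, 0)‖ ^ 2) + (∫ y in Icc 0 d, ‖φ (0, y)‖ ^ 2) +
      ∫ y in Ico 0 (R / 2), ‖φ (y, y)‖ ^ 2) ≤
      4 * (∫ p in nearPart d R, gradSq φ p) +
        4 * (K ^ 2 + K / (d / 2)) * ∫ p in nearPart d R, ‖φ p‖ ^ 2 := by
  have hd2 : 0 < d / 2 := by linarith
  set C := K ^ 2 + K / (d / 2)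
  have hC : 0 ≤ C := by positivity
  have i1 := (integrable_norm_sq hs hc).integrableOn (s := nearPart d R)
  have i2 := (integrable_gradSq hs hc).integrableOn (s := nearPart d R)
  have main : ∀ (e v : ℝ × ℝ) (I : Set ℝ), |e.1 * v.2 - e.2 * v.1| = 1 → MeasurableSet I →
      (∀ p, ‖pd v φ p‖ ^ 2 ≤ gradSq φ p) →
      (∀ b ∈ I, ∀ t ∈ Ioc 0 (d / 2), b • e + t • v ∈ nearPart d R) →
      K * ∫ b in I, ‖φ (b • e)‖ ^ 2 ≤ (∫ p in nearPart d R, gradSq φ p) +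
        C * ∫ p in nearPart d R, ‖φ p‖ ^ 2 := fun e v I hD hI hv hsub => by
    refine (trace_transverse hs hc hD hI hd2 hK hsub).trans ?_
    rw [← integral_const_mul, ← integral_add i2 (i1.const_mul C)]
    refine integral_mono_of_nonneg (ae_of_all _ fun p => ?_) (i2.add (i1.const_mul C))
      (ae_of_all _ fun p => ?_)
    · simp only [Pi.zero_apply]; positivity
    · exact add_le_add_left (hv p) _
  have g1 : ∀ p, ‖pd (1, 0) φ p‖ ^ 2 ≤ gradSq φ p := fun p => by
    unfold gradSq; nlinarith [sq_nonneg ‖pd (0, 1) φ p‖]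
  have g2 : ∀ p, ‖pd (0, 1) φ p‖ ^ 2 ≤ gradSq φ p := fun p => by
    unfold gradSq; nlinarith [sq_nonneg ‖pd (1, 0) φ p‖]
  have g3 : ∀ p, ‖pd (-1, 0) φ p‖ ^ 2 ≤ gradSq φ p := fun p => by
    have : pd (-1, 0) φ p = -pd (1, 0) φ p := by rw [pd_eq]; simp
    rw [this, norm_neg]
    exact g1 p
  have t1 := main (1, 0) (0, 1) (Icc 0 d) (by simp) measurableSet_Icc g2 fun b hb t ht => by
    have := hb.1; have := hb.2; have := ht.1; have := ht.2
    refine ⟨⟨?_, ?_, ?_⟩, ?_⟩ <;> simp [abs_le] <;> (try constructor) <;> linarith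
  have t2 := main (0, 1) (1, 0) (Icc 0 d) (by simp) measurableSet_Icc g1 fun b hb t ht => by
    have := hb.1; have := hb.2; have := ht.1; have := ht.2
    refine ⟨⟨?_, ?_, ?_⟩, ?_⟩ <;> simp [abs_le] <;> (try constructor) <;> linarith
  have t3 := main (1, 1) (1, 0) (Ico 0 (d / 2)) (by simp) measurableSet_Ico g1
    fun b hb t ht => by
    have := hb.1; have := hb.2; have := ht.1; have := ht.2
    refine ⟨⟨?_, ?_, ?_⟩, ?_⟩ <;> simp [abs_le] <;> (try constructor) <;> linarith
  have t4 := main (1, 1) (-1, 0) (Ico (d / 2) (R / 2)) (by simp) measurableSet_Ico g3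
    fun b hb t ht => by
    have := hb.1; have := hb.2; have := ht.1; have := ht.2
    refine ⟨⟨?_, ?_, ?_⟩, ?_⟩ <;> simp [abs_le] <;> (try constructor) <;> linarith
  simp only [Prod.smul_mk, smul_eq_mul, mul_one, mul_zero] at t1 t2 t3 t4
  have hD : ∫ y in Ico 0 (R / 2), ‖φ (y, y)‖ ^ 2 =
      (∫ y in Ico 0 (d / 2), ‖φ (y, y)‖ ^ 2) + ∫ y in Ico (d / 2) (R / 2), ‖φ (y, y)‖ ^ 2 := by
    rw [← Ico_union_Ico_eq_Ico hd2.le (by linarith : d / 2 ≤ R / 2)]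
    refine setIntegral_union ?_ measurableSet_Ico
      (integrable_diag_norm_sq hs hc).integrableOn (integrable_diag_norm_sq hs hc).integrableOn
    exact Set.disjoint_left.2 fun y hy hy' => not_le.2 hy.2 hy'.1
  rw [hD]
  linarith

/-- The trace inequality on the pencil. -/
theorem smooth_traces (hd : 0 < d) {K : ℝ} (hK : 0 ≤ K) :
    K * ((∫ y in Icc 0 d, ‖φ (y, 0)‖ ^ 2) + (∫ y in Icc 0 d, ‖φ (0, y)‖ ^ 2) +
      ∫ y in Ici (0 : ℝ), ‖φ (y, y)‖ ^ 2) ≤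
      4 * (∫ p in pencil d, gradSq φ p) +
        4 * (K ^ 2 + K / (d / 2)) * ∫ p in pencil d, ‖φ p‖ ^ 2 := by
  -- for `R` beyond the support, nothing is lost in `near_traces`
  obtain ⟨r, hr⟩ := hc.isBounded.subset_closedBall (0 : ℝ × ℝ)
  set R := max (2 * d) (2 * (r + 1))
  have hz : ∀ y ∈ Ici (0 : ℝ) \ Ico 0 (R / 2), ‖φ (y, y)‖ ^ 2 = 0 := fun y hy => by
    have h1 : R / 2 ≤ y := by
      by_contra h
      exact hy.2 ⟨hy.1, not_le.1 h⟩
    have h2 : 2 * (r + 1) ≤ R := le_max_right _ _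
    have : (y, y) ∉ tsupport φ := fun h => by
      have := hr h
      rw [mem_closedBall_zero_iff, Prod.norm_mk, max_self, Real.norm_eq_abs] at this
      linarith [le_abs_self y]
    rw [image_eq_zero_of_notMem_tsupport this]
    simp
  have hD : ∫ y in Ici (0 : ℝ), ‖φ (y, y)‖ ^ 2 = ∫ y in Ico 0 (R / 2), ‖φ (y, y)‖ ^ 2 :=
    setIntegral_eq_of_subset_of_forall_sdiff_eq_zero measurableSet_Ici Ico_subset_Ici_self hz
  rw [hD]
  refine (near_traces hs hc hd (le_max_left _ _) hK).trans ?_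
  have m1 : ∫ p in nearPart d R, gradSq φ p ≤ ∫ p in pencil d, gradSq φ p :=
    setIntegral_mono_set (integrable_gradSq hs hc).integrableOn
      (ae_of_all _ (gradSq_nonneg φ)) inter_subset_left.eventuallyLE
  have m2 : ∫ p in nearPart d R, ‖φ p‖ ^ 2 ≤ ∫ p in pencil d, ‖φ p‖ ^ 2 :=
    setIntegral_mono_set (integrable_norm_sq hs hc).integrableOn
      (ae_of_all _ fun p => sq_nonneg _) inter_subset_left.eventuallyLE
  gcongr

end Smooth

/-- The image of a half-strip in the coordinates `(b, t) ↦ (b + t, b - t)`. -/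
theorem image_halfStrip (R h : ℝ) : (fun p : ℝ × ℝ => p.1 • ((1, 1) : ℝ × ℝ) + p.2 • (1, -1)) ''
    (Ici (R / 2) ×ˢ Ioc 0 h) = {p | R ≤ p.1 + p.2 ∧ 0 < p.1 - p.2 ∧ p.1 - p.2 ≤ 2 * h} := by
  ext p
  constructor
  · rintro ⟨⟨b, t⟩, ⟨hb, h1, h2⟩, rfl⟩
    simp only [mem_Ici] at hb h1 h2
    refine ⟨?_, ?_, ?_⟩ <;> simp <;> linarith
  · rintro ⟨h1, h2, h3⟩
    refine ⟨((p.1 + p.2) / 2, (p.1 - p.2) / 2), ⟨?_, ?_, ?_⟩, ?_⟩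
    · simp only [mem_Ici]; linarith
    · simp only; linarith
    · simp only; linarith
    · ext <;> simp <;> ring

/-- The image of a half-strip in the coordinates `(b, t) ↦ (b - t, b + t)`. -/
theorem image_halfStrip' (R h : ℝ) :
    (fun p : ℝ × ℝ => p.1 • ((1, 1) : ℝ × ℝ) + p.2 • (-1, 1)) ''
    (Ici (R / 2) ×ˢ Ioc 0 h) = {p | R ≤ p.1 + p.2 ∧ 0 < p.2 - p.1 ∧ p.2 - p.1 ≤ 2 * h} := by
  ext p
  constructor
  · rintro ⟨⟨b, t⟩, ⟨hb, h1, h2⟩, rfl⟩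
    simp only [mem_Ici] at hb h1 h2
    refine ⟨?_, ?_, ?_⟩ <;> simp <;> linarith
  · rintro ⟨h1, h2, h3⟩
    refine ⟨((p.1 + p.2) / 2, (p.2 - p.1) / 2), ⟨?_, ?_, ?_⟩, ?_⟩
    · simp only [mem_Ici]; linarith
    · simp only; linarith
    · simp only; linarith
    · ext <;> simp <;> ring

/-- The two halves of the half-strip `x + y ≥ R`, on either side of the diagonal. -/
theorem setIntegral_farPart {R : ℝ} (hR : d ≤ R) {f : ℝ × ℝ → ℝ} (hf : Integrable f) :
    ∫ p in farPart d R, f p =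
      (∫ p in (fun p : ℝ × ℝ => p.1 • ((1, 1) : ℝ × ℝ) + p.2 • (1, -1)) ''
        (Ici (R / 2) ×ˢ Ioc 0 (d / 2)), f p) +
      ∫ p in (fun p : ℝ × ℝ => p.1 • ((1, 1) : ℝ × ℝ) + p.2 • (-1, 1)) ''
        (Ici (R / 2) ×ˢ Ioc 0 (d / 2)), f p := by
  rw [image_halfStrip, image_halfStrip', mul_div_cancel₀ _ (two_ne_zero' ℝ)]
  set A : Set (ℝ × ℝ) := {p | R ≤ p.1 + p.2 ∧ 0 < p.1 - p.2 ∧ p.1 - p.2 ≤ d}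
  set B : Set (ℝ × ℝ) := {p | R ≤ p.1 + p.2 ∧ 0 < p.2 - p.1 ∧ p.2 - p.1 ≤ d}
  have hB : MeasurableSet B := by
    have b1 : MeasurableSet {p : ℝ × ℝ | R ≤ p.1 + p.2} :=
      measurableSet_le measurable_const (by fun_prop)
    have b2 : MeasurableSet {p : ℝ × ℝ | 0 < p.2 - p.1} :=
      measurableSet_lt measurable_const (by fun_prop)
    have b3 : MeasurableSet {p : ℝ × ℝ | p.2 - p.1 ≤ d} :=
      measurableSet_le (by fun_prop) measurable_const
    exact b1.inter (b2.inter b3)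
  have hAB : Disjoint A B := Set.disjoint_left.2 fun p hp hq => by
    have := hp.2.1; have := hq.2.1; linarith
  rw [← setIntegral_union hAB hB hf.integrableOn hf.integrableOn]
  refine setIntegral_congr_set ?_
  have h1 := ae_mem_slit d
  rw [ae_restrict_iff' (measurableSet_pencil d)] at h1
  filter_upwards [h1] with p hp
  refine propext ⟨fun h => ?_, fun h => ?_⟩
  · have h2 := hp h.1
    have h3 := abs_le.1 h2.2.2.1.le
    have h4 : R ≤ p.1 + p.2 := h.2
    rcases lt_or_gt_of_ne h2.2.2.2 with h5 | h5
    · exact Or.inr ⟨h4, by linarith, by linarith⟩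
    · exact Or.inl ⟨h4, by linarith, by linarith⟩
  · rcases h with ⟨a, b, c⟩ | ⟨a, b, c⟩
    · exact ⟨⟨by linarith, by linarith, abs_le.2 ⟨by linarith, c⟩⟩, a⟩
    · exact ⟨⟨by linarith, by linarith, abs_le.2 ⟨by linarith, by linarith⟩⟩, a⟩

/-- On the half-strip `x + y ≥ R`, the transverse operator with Neumann condition on the diagonal
and Dirichlet condition at `|x - y| = d` is bounded below by `π² / (2 d²)`. For a smaller constant
there is room for a small multiple of the trace on the diagonal. The function need not vanish at
`|x - y| = d`; the last term accounts for its values there. -/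
theorem far_inequality (hd : 0 < d) {μ : ℝ} (hμ : 0 < μ) (hμd : μ < Real.pi / d) :
    ∃ η C : ℝ, 0 < η ∧ ∀ R : ℝ, d ≤ R → ∀ φ : ℝ × ℝ → ℂ, ContDiff ℝ ∞ φ → HasCompactSupport φ →
      μ ^ 2 / 2 * (∫ p in farPart d R, ‖φ p‖ ^ 2) + η * (∫ y in Ici (R / 2), ‖φ (y, y)‖ ^ 2) ≤
        (∫ p in farPart d R, gradSq φ p) + C * ((∫ y in Ici 0, ‖φ (y + d, y)‖ ^ 2) +
          ∫ y in Ici 0, ‖φ (y, y + d)‖ ^ 2) := by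
  have hd2 : 0 < d / 2 := by linarith
  rw [lt_div_iff₀ hd] at hμd
  -- the weight `w t = μ tan (μ t + δ)` solves `w² - w' = -μ²`; the shift `δ` makes `w 0` positive
  -- and keeps the angle below `π / 2` up to `t = d / 2`
  set δ : ℝ := (Real.pi / 2 - μ * (d / 2)) / 2 with hδ
  have hδ0 : 0 < δ := by rw [hδ]; linarith
  have hang : ∀ t ∈ Icc 0 (d / 2), 0 < μ * t + δ ∧ μ * t + δ < Real.pi / 2 := fun t ht => by
    have h1 := mul_nonneg hμ.le ht.1
    have h2 := mul_le_mul_of_nonneg_left ht.2 hμ.le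
    constructor
    · linarith
    · rw [hδ] at hδ0 ⊢
      linarith
  have hcos : ∀ t ∈ Icc 0 (d / 2), Real.cos (μ * t + δ) ≠ 0 := fun t ht =>
    (Real.cos_pos_of_mem_Ioo ⟨by linarith [(hang t ht).1, Real.pi_pos], (hang t ht).2⟩).ne'
  set w : ℝ → ℝ := fun t => μ * Real.tan (μ * t + δ)
  set w' : ℝ → ℝ := fun t => μ * (1 / Real.cos (μ * t + δ) ^ 2 * μ)
  have hw : ∀ t ∈ Icc 0 (d / 2), HasDerivAt w (w' t) t := fun t ht => by
    have h1 : HasDerivAt (fun t => μ * t + δ) μ t := by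
      simpa using ((hasDerivAt_id t).const_mul μ).add_const δ
    exact ((Real.hasDerivAt_tan (hcos t ht)).comp t h1).const_mul μ
  have hw' : ContinuousOn w' (Icc 0 (d / 2)) := by
    refine continuousOn_const.mul ((continuousOn_const.div ?_ fun t ht =>
      pow_ne_zero 2 (hcos t ht)).mul continuousOn_const)
    fun_prop
  have hC : ∀ t ∈ Icc 0 (d / 2), w t ^ 2 - w' t ≤ -μ ^ 2 := fun t ht => by
    refine le_of_eq ?_
    simp only [w, w', Real.tan_eq_sin_div_cos]
    have := hcos t ht
    field_simp
    have h := Real.sin_sq_add_cos_sq (μ * t + δ)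
    linear_combination h
  have hw0 : 0 < w 0 := mul_pos hμ (Real.tan_pos_of_pos_of_lt_pi_div_two
    (hang 0 ⟨le_rfl, hd2.le⟩).1 (hang 0 ⟨le_rfl, hd2.le⟩).2)
  have hwh : 0 < w (d / 2) := mul_pos hμ (Real.tan_pos_of_pos_of_lt_pi_div_two
    (hang _ ⟨hd2.le, le_rfl⟩).1 (hang _ ⟨hd2.le, le_rfl⟩).2)
  refine ⟨2 * w 0, w (d / 2), by positivity, fun R hR φ hs hc => ?_⟩
  have i1 := integrable_norm_sq hs hc
  have i2 := integrable_gradSq hs hc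
  have half : ∀ v : ℝ × ℝ, ((1 : ℝ) * v.2 - 1 * v.1 ≠ 0) → |(1 : ℝ) * v.2 - 1 * v.1| = 2 →
      |v.1| ≤ 1 → |v.2| ≤ 1 →
      w 0 * (∫ b in Ici (R / 2), ‖φ (b, b)‖ ^ 2) -
        w (d / 2) * (∫ b in Ici (R / 2), ‖φ (b • (1, 1) + (d / 2) • v)‖ ^ 2) ≤
      (∫ p in (fun p : ℝ × ℝ => p.1 • ((1, 1) : ℝ × ℝ) + p.2 • v) ''
        (Ici (R / 2) ×ˢ Ioc 0 (d / 2)), gradSq φ p) - μ ^ 2 / 2 *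
      ∫ p in (fun p : ℝ × ℝ => p.1 • ((1, 1) : ℝ × ℝ) + p.2 • v) ''
        (Ici (R / 2) ×ˢ Ioc 0 (d / 2)), ‖φ p‖ ^ 2 := fun v hD hD2 h1 h2 => by
    have key := riccati_transverse hs hc (e := (1, 1)) (v := v) hD (measurableSet_Ici (a := R / 2))
      hd2.le hw hw' hC
    simp only [hD2] at key
    set S := (fun p : ℝ × ℝ => p.1 • ((1, 1) : ℝ × ℝ) + p.2 • v) ''
        (Ici (R / 2) ×ˢ Ioc 0 (d / 2))
    have i3 := integrable_norm_sq_pd hs hc v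
    rw [integral_add i3.integrableOn (i1.integrableOn.const_mul _), integral_const_mul] at key
    have h3 : ∫ p in S, ‖pd v φ p‖ ^ 2 ≤ ∫ p in S, 2 * gradSq φ p :=
      integral_mono i3.integrableOn (i2.integrableOn.const_mul 2) fun p => by
        have := norm_pd_sq_le φ h1 h2 p
        simpa using this
    rw [integral_const_mul] at h3
    simp only [Prod.smul_mk, smul_eq_mul, mul_one] at key ⊢
    linarith
  have hb1 : ∫ b in Ici (R / 2), ‖φ (b • (1, 1) + (d / 2) • (1, -1))‖ ^ 2 ≤
      ∫ y in Ici 0, ‖φ (y + d, y)‖ ^ 2 := by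
    have hi : Integrable fun y : ℝ => ‖φ (y + d, y)‖ ^ 2 :=
      (memLp_two_iff_integrable_sq_norm (by
        have := hs.continuous
        fun_prop)).1 (memLp_comp_curve hs.continuous hc (γ := fun y => (y + d, y)) (by fun_prop)
          continuous_snd (fun y => rfl) volume)
    have he : ∀ b : ℝ, (b • ((1, 1) : ℝ × ℝ) + (d / 2) • (1, -1)) =
        ((b - d / 2) + d, b - d / 2) := fun b => by ext <;> simp <;> ring
    simp only [he]
    have := (measurePreserving_sub_right volume (d / 2)).setIntegral_preimage_emb
      (measurableEmbedding_subRight (d / 2)) (fun y : ℝ => ‖φ (y + d, y)‖ ^ 2)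
      (Ici (R / 2 - d / 2))
    rw [preimage_sub_const_Ici, sub_add_cancel] at this
    rw [this]
    exact setIntegral_mono_set hi.integrableOn (ae_of_all _ fun y => sq_nonneg _)
      (Ici_subset_Ici.2 (by linarith)).eventuallyLE
  have hb2 : ∫ b in Ici (R / 2), ‖φ (b • (1, 1) + (d / 2) • (-1, 1))‖ ^ 2 ≤
      ∫ y in Ici 0, ‖φ (y, y + d)‖ ^ 2 := by
    have hi : Integrable fun y : ℝ => ‖φ (y, y + d)‖ ^ 2 :=
      (memLp_two_iff_integrable_sq_norm (by
        have := hs.continuous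
        fun_prop)).1 (memLp_comp_curve hs.continuous hc (γ := fun y => (y, y + d)) (by fun_prop)
          continuous_fst (fun y => rfl) volume)
    have he : ∀ b : ℝ, (b • ((1, 1) : ℝ × ℝ) + (d / 2) • (-1, 1)) =
        (b - d / 2, (b - d / 2) + d) := fun b => by ext <;> simp <;> ring
    simp only [he]
    have := (measurePreserving_sub_right volume (d / 2)).setIntegral_preimage_emb
      (measurableEmbedding_subRight (d / 2)) (fun y : ℝ => ‖φ (y, y + d)‖ ^ 2)
      (Ici (R / 2 - d / 2))
    rw [preimage_sub_const_Ici, sub_add_cancel] at this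
    rw [this]
    exact setIntegral_mono_set hi.integrableOn (ae_of_all _ fun y => sq_nonneg _)
      (Ici_subset_Ici.2 (by linarith)).eventuallyLE
  have h1 := half (1, -1) (by norm_num) (by norm_num) (by norm_num) (by norm_num)
  have h2 := half (-1, 1) (by norm_num) (by norm_num) (by norm_num) (by norm_num)
  rw [setIntegral_farPart hR i1, setIntegral_farPart hR i2]
  have h3 := mul_le_mul_of_nonneg_left hb1 hwh.le
  have h4 := mul_le_mul_of_nonneg_left hb2 hwh.le
  linarith

end

section

/-! ### Lower bounds of the form -/

variable {d : ℝ}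

theorem norm_sq_eq_integral {X : Type*} [MeasurableSpace X] {μ : Measure X} {f : Lp ℂ 2 μ}
    {φ : X → ℂ} (h : f =ᵐ[μ] φ) : ‖f‖ ^ 2 = ∫ x, ‖φ x‖ ^ 2 ∂μ := by
  have h1 := congrArg RCLike.re (inner_self_eq_norm_sq_to_K (𝕜 := ℂ) f)
  have h2 : inner ℂ f f = ((∫ x, ‖φ x‖ ^ 2 ∂μ : ℝ) : ℂ) := by
    rw [l2_inner_eq, ← integral_complex_ofReal]
    refine integral_congr_ae ?_
    filter_upwards [h] with x hx
    rw [hx, mul_comm, Complex.mul_conj, Complex.normSq_eq_norm_sq]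
  rw [h2] at h1
  simpa [← Complex.ofReal_pow] using h1.symm

theorem IsSmoothJet.norm_sq_grad {φ : ℝ × ℝ → ℂ} {Z : Jet d × L2Ray × L2Ray}
    (h : IsSmoothJet φ Z) :
    ‖Z.1.dx‖ ^ 2 + ‖Z.1.dy‖ ^ 2 = ∫ p in pencil d, gradSq φ p := by
  rw [norm_sq_eq_integral h.dx, norm_sq_eq_integral h.dy, ← integral_add]
  · rfl
  · exact (integrable_norm_sq_pd h.contDiff h.hasCompactSupport _).integrableOn
  · exact (integrable_norm_sq_pd h.contDiff h.hasCompactSupport _).integrableOn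

theorem traces_le {U : Jet d} (hU : InFormDomain U) (hd : 0 < d) {K : ℝ} (hK : 0 ≤ K) :
    K * (‖U.bottom‖ ^ 2 + ‖U.left‖ ^ 2 + ‖U.diag‖ ^ 2) ≤
      4 * (‖U.dx‖ ^ 2 + ‖U.dy‖ ^ 2) + 4 * (K ^ 2 + K / (d / 2)) * ‖U.val‖ ^ 2 := by
  refine hU.induction (p := fun Z => K * (‖Z.1.bottom‖ ^ 2 + ‖Z.1.left‖ ^ 2 + ‖Z.1.diag‖ ^ 2) ≤
      4 * (‖Z.1.dx‖ ^ 2 + ‖Z.1.dy‖ ^ 2) + 4 * (K ^ 2 + K / (d / 2)) * ‖Z.1.val‖ ^ 2)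
    (isClosed_le (by fun_prop) (by fun_prop)) fun φ Z h => ?_
  rw [h.norm_sq_grad, norm_sq_eq_integral h.val, norm_sq_eq_integral h.bottom,
    norm_sq_eq_integral h.left, norm_sq_eq_integral h.diag]
  exact smooth_traces h.contDiff h.hasCompactSupport hd hK

theorem re_inner_mulOp_le {μ ν : Measure ℝ} (hμ : μ ≪ ν) (τ : Lp ℝ ⊤ ν) (f : Lp ℂ 2 μ) :
    |(inner ℂ f (mulOp hμ τ f)).re| ≤ ‖τ‖ * ‖f‖ ^ 2 := by
  refine (Complex.abs_re_le_norm _).trans ((norm_inner_le_norm _ _).trans ?_)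
  have := norm_mulOp_le hμ τ f
  nlinarith [norm_nonneg f]

theorem re_form_self (σ α : LInftyRay) (U : Jet d) :
    (form σ α U U).re = ‖U.dx‖ ^ 2 + ‖U.dy‖ ^ 2
      - ((inner ℂ U.bottom (mulOp seg_ac σ U.bottom)).re +
        (inner ℂ U.left (mulOp seg_ac σ U.left)).re)
      + (inner ℂ U.diag (mulOp .rfl α U.diag)).re := by
  have h : ∀ f : L2Pencil d, (inner ℂ f f).re = ‖f‖ ^ 2 := fun f => by
    rw [inner_self_eq_norm_sq_to_K]
    simp [← Complex.ofReal_pow]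
  rw [form_eq_inner]
  simp only [Complex.add_re, Complex.sub_re, h]

theorem isFormOperator (hd : 0 < d) (σ α : LInftyRay) :
    IsFormOperator (operator d σ α) (valL d) (formOp d σ α) where
  mem_graph_iff := mem_graph_operator_iff σ α
  symm := formOp_symm σ α
  garding := by
    set m : ℝ := ‖σ‖ + ‖α‖
    have hm : 0 ≤ m := by positivity
    set K : ℝ := 8 * (m + 1)
    set C : ℝ := 4 * (K ^ 2 + K / (d / 2))
    set C₁ : ℝ := 4 * ((1 : ℝ) ^ 2 + 1 / (d / 2))
    -- with `K = 8 (m + 1)` the boundary terms are at most half of the Dirichlet integral; the other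
    -- half controls the traces in the norm, through the trace inequality with constant `1`
    refine ⟨1 / 10, C / 8 + (1 + C₁) / 10, by norm_num, fun U => ?_⟩
    have hU := jetL_inFormDomain U
    have hK : 0 ≤ K := by positivity
    have t1 := traces_le hU hd hK
    have t2 := traces_le hU hd zero_le_one
    have n := norm_sq_formDomain U
    have f := re_form_self σ α (jetL d U)
    rw [← inner_formOp] at f
    have b1 := abs_le.1 (re_inner_mulOp_le seg_ac σ (jetL d U).bottom)
    have b2 := abs_le.1 (re_inner_mulOp_le seg_ac σ (jetL d U).left)
    have b3 := abs_le.1 (re_inner_mulOp_le .rfl α (jetL d U).diag)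
    rw [valL_apply]
    set G := ‖(jetL d U).dx‖ ^ 2 + ‖(jetL d U).dy‖ ^ 2
    have hG : 0 ≤ G := by positivity
    set B := ‖(jetL d U).bottom‖ ^ 2
    set L := ‖(jetL d U).left‖ ^ 2
    set D := ‖(jetL d U).diag‖ ^ 2
    set v := ‖(jetL d U).val‖ ^ 2
    have hB : 0 ≤ B := sq_nonneg _
    have hL : 0 ≤ L := sq_nonneg _
    have hD : 0 ≤ D := sq_nonneg _
    have hv : 0 ≤ v := sq_nonneg _
    have e1 : ‖σ‖ * B + ‖σ‖ * L + ‖α‖ * D ≤ m * (B + L + D) := by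
      simp only [m]
      nlinarith [norm_nonneg σ, norm_nonneg α]
    have e2 : 8 * (m * (B + L + D)) ≤ K * (B + L + D) := by
      simp only [K]
      nlinarith
    have e3 : m * (B + L + D) ≤ G / 2 + C / 8 * v := by
      have : K * (B + L + D) ≤ 4 * G + C * v := t1
      linarith
    have e4 : B + L + D ≤ 4 * G + C₁ * v := (one_mul _).symm.trans_le t2
    have e5 : ‖U‖ ^ 2 ≤ 5 * G + (1 + C₁) * v := by
      have : ‖U‖ ^ 2 = v + G + (B + L + D) := by rw [n]; simp only [G, B, L, D, v]; ring
      linarith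
    linarith

/-! ### Lower bounds up to forms of finite rank -/

theorem re_inner_mulOp_eq {μ ν : Measure ℝ} (hμ : μ ≪ ν) (τ : Lp ℝ ⊤ ν) {f : Lp ℂ 2 μ}
    {φ : ℝ → ℂ} (h : f =ᵐ[μ] φ) :
    (inner ℂ f (mulOp hμ τ f)).re = ∫ y, τ y * ‖φ y‖ ^ 2 ∂μ := by
  have : inner ℂ f (mulOp hμ τ f) = ((∫ y, τ y * ‖φ y‖ ^ 2 ∂μ : ℝ) : ℂ) := by
    rw [inner_mulOp, ← integral_complex_ofReal]
    refine integral_congr_ae ?_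
    filter_upwards [h] with x hx
    rw [hx, mul_comm (starRingEnd ℂ _), Complex.mul_conj, Complex.normSq_eq_norm_sq]
    push_cast
    rfl
  rw [this, Complex.ofReal_re]

/-- The diagonal term is controlled by `‖α‖` near the corner, and by the size of `α` at infinity
on the rest of the diagonal. -/
theorem diag_term_ge {α : LInftyRay} {η R : ℝ} (hR : 0 ≤ R) (hα : ∀ᵐ y : ℝ, R ≤ y → |α y| < η)
    {f : L2Ray} {ψ : ℝ → ℂ} (hf : f =ᵐ[volume.restrict (Ici 0)] ψ)
    (hψ : Integrable fun y => ‖ψ y‖ ^ 2) :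
    -(‖α‖ * ∫ y in Ico 0 R, ‖ψ y‖ ^ 2) - η * (∫ y in Ici R, ‖ψ y‖ ^ 2) ≤
      (inner ℂ f (mulOp .rfl α f)).re := by
  rw [re_inner_mulOp_eq .rfl α hf]
  have hb := ae_norm_le_of_lInfty α
  have hi : IntegrableOn (fun y => α y * ‖ψ y‖ ^ 2) (Ici 0) := by
    refine hψ.integrableOn.bdd_mul (c := ‖α‖) (Lp.aestronglyMeasurable α) ?_
    filter_upwards [hb] with y hy
    simpa using hy
  have hdisj : Disjoint (Ico 0 R) (Ici R) :=
    Set.disjoint_left.2 fun y hy hy' => not_le.2 hy.2 hy'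
  have hu := setIntegral_union hdisj measurableSet_Ici (hi.mono_set Ico_subset_Ici_self)
    (hi.mono_set (Ici_subset_Ici.2 hR))
  rw [Ico_union_Ici_eq_Ici hR] at hu
  rw [hu, ← integral_const_mul, ← integral_const_mul,
    ← integral_neg, sub_eq_add_neg, ← integral_neg]
  rw [ae_restrict_iff' measurableSet_Ici] at hb
  refine add_le_add ?_ ?_
  · refine setIntegral_mono_on_ae (hψ.integrableOn.const_mul _).neg
      (hi.mono_set Ico_subset_Ici_self) measurableSet_Ico ?_
    filter_upwards [hb] with y hy hy'
    have := (abs_le.1 (hy hy'.1)).1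
    nlinarith [sq_nonneg ‖ψ y‖]
  · refine setIntegral_mono_on_ae (hψ.integrableOn.const_mul _).neg
      (hi.mono_set (Ici_subset_Ici.2 hR)) measurableSet_Ici ?_
    filter_upwards [hα] with y hy hy'
    have := (abs_lt.1 (hy hy')).1
    nlinarith [sq_nonneg ‖ψ y‖]

/-- If `α` tends to `0`, then for every `Λ < π² / (2 d²)` the form is at least `Λ` up to a form of
finite rank. -/
theorem exists_finiteRank_bound (hd : 0 < d) (σ α : LInftyRay)
    (hα : ∀ ε : ℝ, 0 < ε → ∃ R : ℝ, 0 ≤ R ∧ ∀ᵐ y : ℝ, R ≤ y → |α y| < ε) {Λ : ℝ}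
    (hΛ : Λ < Real.pi ^ 2 / (2 * d ^ 2)) :
    ∃ (n : ℕ) (G : L2Pencil d →L[ℂ] EuclideanSpace ℂ (Fin n × Fin n)), ∀ U : FormSpace d,
      Λ * ‖valL d U‖ ^ 2 ≤ (inner ℂ U (formOp d σ α U)).re + ‖G (valL d U)‖ ^ 2 := by
  -- a transverse frequency below the Neumann-Dirichlet threshold, but still above `Λ`
  obtain ⟨μ, hμ0, hμ1, hμΛ⟩ : ∃ μ : ℝ, 0 < μ ∧ μ < Real.pi / d ∧ Λ ≤ μ ^ 2 / 2 := by
    have hpd : 0 < Real.pi / d := div_pos Real.pi_pos hd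
    have hlt : Real.sqrt (max 0 (2 * Λ)) < Real.pi / d := by
      rw [Real.sqrt_lt' hpd, max_lt_iff]
      refine ⟨by positivity, ?_⟩
      rw [div_pow]
      have : Real.pi ^ 2 / d ^ 2 = 2 * (Real.pi ^ 2 / (2 * d ^ 2)) := by field_simp
      linarith
    obtain ⟨μ, h1, h2⟩ := exists_between hlt
    have h0 := Real.sqrt_nonneg (max 0 (2 * Λ))
    refine ⟨μ, h0.trans_lt h1, h2, ?_⟩
    have h3 : max 0 (2 * Λ) ≤ μ ^ 2 := by
      rw [← Real.sq_sqrt (le_max_left 0 (2 * Λ))]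
      exact pow_le_pow_left₀ h0 h1.le 2
    linarith [le_max_right 0 (2 * Λ)]
  obtain ⟨η, C, hη, hfar⟩ := far_inequality hd hμ0 hμ1
  obtain ⟨R₀, hR₀, hαR⟩ := hα η hη
  set R : ℝ := max (2 * d) (2 * R₀)
  have hR1 : 2 * d ≤ R := le_max_left _ _
  have hR2 : R₀ ≤ R / 2 := by linarith [le_max_right (2 * d) (2 * R₀)]
  have hR0 : 0 < R := by linarith
  set m : ℝ := ‖σ‖ + ‖α‖
  have hm : 0 ≤ m := by positivity
  set K : ℝ := 8 * (m + 1)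
  have hK : 0 ≤ K := by positivity
  set C' : ℝ := 4 * (K ^ 2 + K / (d / 2)) / 8
  have hC' : 0 ≤ C' := by positivity
  -- on the near part, half of the Dirichlet integral absorbs the boundary terms at the cost of
  -- `C' ‖φ‖²`, and the other half has to pay for `M ‖φ‖²`
  set M : ℝ := C' + |Λ|
  have hM : 0 ≤ M := by positivity
  obtain ⟨n, Q, hQm, hQN, hQ⟩ := exists_cells (measurableSet_nearPart d R)
    (convex_nearPart d R) hR0 (nearPart_subset d R) (ε := 1 / (2 * (M + 1))) (by positivity)
  have hQfin : ∀ i, (volume.restrict (pencil d)) (Q i) ≠ ⊤ := fun i => by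
    refine ((Measure.restrict_apply_le _ _).trans_lt ?_).ne
    exact (((Metric.isBounded_Ico 0 R).prod (Metric.isBounded_Ico 0 R)).subset
      ((hQN i).trans (nearPart_subset d R))).measure_lt_top
  set χ : Fin n × Fin n → L2Pencil d := fun i => indicatorConstLp 2 (hQm i) (hQfin i) (1 : ℂ)
  have hχ : ∀ i (f : L2Pencil d), inner ℂ (χ i) f = ∫ p in Q i, f p := fun i f => by
    have := L2.inner_indicatorConstLp_one (𝕜 := ℂ) (hQm i) (hQfin i) f
    rw [this, Measure.restrict_restrict (hQm i),
      inter_eq_left.2 ((hQN i).trans inter_subset_left)]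
  -- `G` collects the weighted means over the cells
  set c : Fin n × Fin n → ℝ := fun i => M * (volume.real (Q i))⁻¹
  have hc : ∀ i, 0 ≤ c i := fun i => by positivity
  set G : L2Pencil d →L[ℂ] EuclideanSpace ℂ (Fin n × Fin n) :=
    ((EuclideanSpace.equiv (Fin n × Fin n) ℂ).symm :
      (Fin n × Fin n → ℂ) →L[ℂ] EuclideanSpace ℂ (Fin n × Fin n)) ∘L
    ContinuousLinearMap.pi fun i => (Real.sqrt (c i) : ℂ) • innerSL ℂ (χ i)
  have hG : ∀ f, ‖G f‖ ^ 2 = ∑ i, c i * ‖∫ p in Q i, f p‖ ^ 2 := fun f => by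
    rw [EuclideanSpace.norm_sq_eq]
    refine Finset.sum_congr rfl fun i _ => ?_
    have : G f i = (Real.sqrt (c i) : ℂ) * inner ℂ (χ i) f := rfl
    rw [this, hχ, norm_mul, mul_pow, Complex.norm_real, Real.norm_eq_abs, sq_abs,
      Real.sq_sqrt (hc i)]
  refine ⟨n, G, fun U => ?_⟩
  rw [inner_formOp, valL_apply, re_form_self]
  have key := (jetL_inFormDomain U).induction
    (p := fun Z => Λ * ‖Z.1.val‖ ^ 2 ≤ ‖Z.1.dx‖ ^ 2 + ‖Z.1.dy‖ ^ 2
      - ((inner ℂ Z.1.bottom (mulOp seg_ac σ Z.1.bottom)).re +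
        (inner ℂ Z.1.left (mulOp seg_ac σ Z.1.left)).re)
      + (inner ℂ Z.1.diag (mulOp .rfl α Z.1.diag)).re + ‖G Z.1.val‖ ^ 2 +
      C * (‖Z.2.1‖ ^ 2 + ‖Z.2.2‖ ^ 2))
    (isClosed_le (by fun_prop) (by fun_prop)) fun φ Z h => ?_
  -- on the form domain the values on `|x - y| = d` are zero
  · simpa using key
  have hs := h.contDiff
  have hcs := h.hasCompactSupport
  have hGφ : ‖G Z.1.val‖ ^ 2 = M * ∑ i, (volume.real (Q i))⁻¹ * ‖∫ p in Q i, φ p‖ ^ 2 := by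
    rw [hG, Finset.mul_sum]
    refine Finset.sum_congr rfl fun i _ => ?_
    have : ∫ p in Q i, Z.1.val p = ∫ p in Q i, φ p := by
      refine integral_congr_ae ?_
      exact ae_restrict_of_ae_restrict_of_subset ((hQN i).trans inter_subset_left) h.val
    rw [this, mul_assoc]
  have hnear := near_traces hs hcs hd hR1 hK
  have hcell := hQ φ hs
  have hf := hfar R (by linarith) φ hs hcs
  have hdiag := diag_term_ge (R := R / 2) (by linarith)
    (hαR.mono fun y hy h => hy (hR2.trans h)) h.diag (integrable_diag_norm_sq hs hcs)
  have b1 := abs_le.1 (re_inner_mulOp_le seg_ac σ Z.1.bottom)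
  have b2 := abs_le.1 (re_inner_mulOp_le seg_ac σ Z.1.left)
  rw [norm_sq_eq_integral h.bottom] at b1
  rw [norm_sq_eq_integral h.left] at b2
  rw [hGφ, h.norm_sq_grad, norm_sq_eq_integral h.val, norm_sq_eq_integral h.lower,
    norm_sq_eq_integral h.upper,
    setIntegral_near_add_far (R := R) (integrable_norm_sq hs hcs).integrableOn,
    setIntegral_near_add_far (R := R) (integrable_gradSq hs hcs).integrableOn]
  set gN := ∫ p in nearPart d R, gradSq φ p
  set gF := ∫ p in farPart d R, gradSq φ p
  set vN := ∫ p in nearPart d R, ‖φ p‖ ^ 2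
  set vF := ∫ p in farPart d R, ‖φ p‖ ^ 2
  set B := ∫ y in Icc 0 d, ‖φ (y, 0)‖ ^ 2
  set L := ∫ y in Icc 0 d, ‖φ (0, y)‖ ^ 2
  set D := ∫ y in Ico 0 (R / 2), ‖φ (y, y)‖ ^ 2
  set S := ∑ i, (volume.real (Q i))⁻¹ * ‖∫ p in Q i, φ p‖ ^ 2
  have hB : 0 ≤ B := integral_nonneg fun _ => sq_nonneg _
  have hL : 0 ≤ L := integral_nonneg fun _ => sq_nonneg _
  have hD : 0 ≤ D := integral_nonneg fun _ => sq_nonneg _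
  have hvN : 0 ≤ vN := integral_nonneg fun _ => sq_nonneg _
  have hvF : 0 ≤ vF := integral_nonneg fun _ => sq_nonneg _
  have hgN : 0 ≤ gN := integral_nonneg (gradSq_nonneg φ)
  have e1 : ‖σ‖ * B + ‖σ‖ * L + ‖α‖ * D ≤ m * (B + L + D) := by
    simp only [m]
    nlinarith [norm_nonneg σ, norm_nonneg α]
  have e2 : 8 * (m * (B + L + D)) ≤ K * (B + L + D) := by
    simp only [K]
    nlinarith
  have e3 : m * (B + L + D) ≤ gN / 2 + C' * vN := by
    have : K * (B + L + D) ≤ 4 * gN + 8 * C' * vN := by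
      refine hnear.trans_eq ?_
      simp only [C']
      ring
    linarith
  have e4 : M * vN ≤ M * S + gN / 2 := by
    have h1 : M * vN ≤ M * (S + 1 / (2 * (M + 1)) * gN) := mul_le_mul_of_nonneg_left hcell hM
    have h2 : M * (1 / (2 * (M + 1))) ≤ 1 / 2 := by
      rw [mul_one_div, div_le_div_iff₀ (by positivity) (by norm_num)]
      linarith
    have h3 := mul_le_mul_of_nonneg_right h2 hgN
    linarith
  have e5 : Λ * vN ≤ |Λ| * vN := mul_le_mul_of_nonneg_right (le_abs_self Λ) hvN
  have e6 : Λ * vF ≤ μ ^ 2 / 2 * vF := mul_le_mul_of_nonneg_right hμΛ hvF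
  have e7 : M * vN = C' * vN + |Λ| * vN := by simp only [M]; ring
  linarith

/-- If `α` tends to `0`, the essential spectrum lies in `[π² / (2 d²), ∞)`. -/
theorem essentialSpectrum_subset (hd : 0 < d) (σ α : LInftyRay)
    (hα : ∀ ε : ℝ, 0 < ε → ∃ R : ℝ, 0 ≤ R ∧ ∀ᵐ y : ℝ, R ≤ y → |α y| < ε) :
    essentialSpectrum (operator d σ α) ⊆
      Complex.ofReal '' Ici (Real.pi ^ 2 / (2 * d ^ 2)) := by
  intro z hz
  have hA := isFormOperator hd σ α
  have him : z.im = 0 := by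
    by_contra him
    exact hz.1 (hA.isRegularValue_of_im_ne_zero him)
  have hzr : (z.re : ℂ) = z := Complex.ext (by simp) (by simp [him])
  refine ⟨z.re, ?_, hzr⟩
  by_contra hlt
  obtain ⟨Λ, h1, h2⟩ := exists_between (not_le.1 (mem_Ici.not.1 hlt))
  obtain ⟨n, G, hG⟩ := exists_finiteRank_bound hd σ α hα h2
  exact hA.notMem_essentialSpectrum h1 G hG (hzr ▸ hz)

end

section

/-! ### Green's formula on the pencil -/

variable {d : ℝ}

theorem isWeakDeriv_of_contDiff {u : ℝ × ℝ → ℂ} (hs : ContDiff ℝ ∞ u) (hc : HasCompactSupport u)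
    {v : ℝ × ℝ} {T D : L2Pencil d} (hT : T =ᵐ[volume.restrict (pencil d)] u)
    (hD : D =ᵐ[volume.restrict (pencil d)] pd v u) : IsWeakDeriv d v T D := by
  intro ψ hψ hψc hψt
  have hout : ∀ p, p ∉ pencil d → p ∉ tsupport ψ := fun p hp h => hp (interior_subset (hψt h))
  have hout' : ∀ p, p ∉ pencil d → pd v ψ p = 0 := fun p hp => by
    have hn : p ∉ tsupport (fderiv ℝ ψ) := fun h => hout p hp (tsupport_fderiv_subset ℝ h)
    simp [pd, image_eq_zero_of_notMem_tsupport hn]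
  have e1 : ∫ p in pencil d, T p * pd v ψ p = ∫ p, u p * pd v ψ p := by
    rw [← setIntegral_eq_integral_of_forall_compl_eq_zero (s := pencil d)
      (f := fun p => u p * pd v ψ p) (fun p hp => by rw [hout' p hp, mul_zero])]
    refine integral_congr_ae ?_
    filter_upwards [hT] with p hp
    rw [hp]
  have e2 : ∫ p in pencil d, D p * ψ p = ∫ p, pd v u p * ψ p := by
    rw [← setIntegral_eq_integral_of_forall_compl_eq_zero (s := pencil d)
      (f := fun p => pd v u p * ψ p)
      (fun p hp => by rw [image_eq_zero_of_notMem_tsupport (hout p hp), mul_zero])]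
    refine integral_congr_ae ?_
    filter_upwards [hD] with p hp
    rw [hp]
  rw [e1, e2]
  refine integral_mul_fderiv_eq_neg_fderiv_mul_of_integrable ?_ ?_ ?_
    (fun x _ => hs.differentiable (by simp) x) (fun x _ => hψ.differentiable (by simp) x)
  · exact ((continuous_pd hs v).mul hψ.continuous).integrable_of_hasCompactSupport hψc.mul_left
  · exact (hs.continuous.mul (continuous_pd hψ v)).integrable_of_hasCompactSupport hc.mul_right
  · exact (hs.continuous.mul hψ.continuous).integrable_of_hasCompactSupport hc.mul_right

theorem IsSmoothJet.inFormDomain {u : ℝ × ℝ → ℂ} {Z : Jet d × L2Ray × L2Ray}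
    (h : IsSmoothJet u Z) (h1 : ∀ y, u (y + d, y) = 0) (h2 : ∀ y, u (y, y + d) = 0) :
    InFormDomain Z.1 := by
  refine ⟨⟨isWeakDeriv_of_contDiff h.contDiff h.hasCompactSupport h.val h.dx,
    isWeakDeriv_of_contDiff h.contDiff h.hasCompactSupport h.val h.dy⟩, ?_⟩
  have z1 : Z.2.1 = 0 := by
    rw [Lp.eq_zero_iff_ae_eq_zero]
    filter_upwards [h.lower] with y hy
    rw [hy, h1, Pi.zero_apply]
  have z2 : Z.2.2 = 0 := by
    rw [Lp.eq_zero_iff_ae_eq_zero]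
    filter_upwards [h.upper] with y hy
    rw [hy, h2, Pi.zero_apply]
  have : (Z.1, (0 : L2Ray), (0 : L2Ray)) = Z :=
    Prod.ext rfl (Prod.ext z1.symm z2.symm)
  rw [hasTraces_iff, this]
  exact subset_closure ⟨u, h⟩

theorem setIntegral_pencil {G : ℝ × ℝ → ℂ} (hG : Integrable G) :
    ∫ p in pencil d, G p =
      ∫ y in Ici (0 : ℝ), ∫ x in Icc (max 0 (y - d)) (y + d), G (x, y) := by
  have hi := hG.indicator (measurableSet_pencil d)
  rw [← integral_indicator (measurableSet_pencil d), Measure.volume_eq_prod,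
    integral_prod_symm _ (by rwa [← Measure.volume_eq_prod]), ← integral_indicator measurableSet_Ici]
  refine integral_congr_ae (ae_of_all _ fun y => ?_)
  by_cases hy : y ∈ Ici (0 : ℝ)
  · simp only [indicator_of_mem hy]
    rw [← integral_indicator measurableSet_Icc]
    refine integral_congr_ae (ae_of_all _ fun x => ?_)
    have hiff : (x, y) ∈ pencil d ↔ x ∈ Icc (max 0 (y - d)) (y + d) := by
      simp only [pencil, mem_ofPred_eq, mem_Icc, max_le_iff, abs_le]
      simp only [mem_Ici] at hy
      constructor
      · rintro ⟨a, b, c, e⟩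
        exact ⟨⟨a, by linarith⟩, by linarith⟩
      · rintro ⟨⟨a, b⟩, c⟩
        exact ⟨a, hy, by linarith, by linarith⟩
    by_cases hx : (x, y) ∈ pencil d
    · simp only [indicator_of_mem hx, indicator_of_mem (hiff.1 hx)]
    · simp only [indicator_of_notMem hx, indicator_of_notMem (mt hiff.2 hx)]
  · have hz : ∀ x, (pencil d).indicator G (x, y) = 0 := fun x =>
      indicator_of_notMem (fun h => hy h.2.1) _
    simp only [indicator_of_notMem hy, hz, integral_zero]

/-- The divergence theorem for a field in the first direction that vanishes on the second axis. -/
theorem integral_pd_fst (hd : 0 < d) {F : ℝ × ℝ → ℂ} (hs : ContDiff ℝ ∞ F)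
    (hc : HasCompactSupport F) (h0 : ∀ y ∈ Icc 0 d, F (0, y) = 0) :
    ∫ p in pencil d, pd (1, 0) F p =
      (∫ y in Ici (0 : ℝ), F (y + d, y)) - ∫ y in Ici (0 : ℝ), F (y, y + d) := by
  have hFi : ∀ γ : ℝ → ℝ × ℝ, Continuous γ → Function.LeftInverse Prod.snd γ →
      Integrable fun y => F (γ y) := fun γ hγ hl =>
    (hs.continuous.comp hγ).integrable_of_hasCompactSupport
      (hc.comp_isClosedEmbedding (hl.isClosedEmbedding continuous_snd hγ))
  have hpi : Integrable (pd (1, 0) F) :=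
    (continuous_pd hs _).integrable_of_hasCompactSupport (hasCompactSupport_pd hc _)
  rw [setIntegral_pencil hpi]
  have hinner : ∀ y ∈ Ici (0 : ℝ), ∫ x in Icc (max 0 (y - d)) (y + d), pd (1, 0) F (x, y) =
      F (y + d, y) - F (max 0 (y - d), y) := fun y hy => by
    have hy' : 0 ≤ y := hy
    have hle : max 0 (y - d) ≤ y + d := max_le (by linarith) (by linarith)
    have hder : ∀ x : ℝ, HasDerivAt (fun x => F (x, y)) (pd (1, 0) F (x, y)) x := fun x => by
      have := hasDerivAt_line hs (0, y) (1, 0) x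
      simpa using this
    rw [integral_Icc_eq_integral_Ioc, ← intervalIntegral.integral_of_le hle]
    refine intervalIntegral.integral_eq_sub_of_hasDerivAt (fun x _ => hder x) ?_
    exact ((continuous_pd hs _).comp
      (f := fun x : ℝ => (x, y)) (by fun_prop)).intervalIntegrable _ _
  rw [setIntegral_congr_fun measurableSet_Ici hinner]
  rw [integral_sub (hFi (fun y => (y + d, y)) (by fun_prop) (fun y => rfl)).integrableOn
    (hFi (fun y => (max 0 (y - d), y)) (by fun_prop) (fun y => rfl)).integrableOn]
  congr 1
  have e1 : ∫ y in Ici (0 : ℝ), F (max 0 (y - d), y) = ∫ y in Ici d, F (y - d, (y - d) + d) := by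
    have hcut : ∫ y in Ici (0 : ℝ), F (max 0 (y - d), y) =
        ∫ y in Ici d, F (max 0 (y - d), y) :=
      setIntegral_eq_of_subset_of_forall_sdiff_eq_zero measurableSet_Ici
        (Ici_subset_Ici.2 hd.le) fun y hy => by
          have h1 : y < d := not_le.1 hy.2
          rw [max_eq_left (by linarith)]
          exact h0 y ⟨hy.1, h1.le⟩
    rw [hcut]
    refine setIntegral_congr_fun measurableSet_Ici fun y hy => ?_
    have : 0 ≤ y - d := sub_nonneg.2 hy
    simp only [max_eq_right this, sub_add_cancel]
  rw [e1]
  have := (measurePreserving_sub_right volume d).setIntegral_preimage_emb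
    (measurableEmbedding_subRight d) (fun y : ℝ => F (y, y + d)) (Ici 0)
  rw [preimage_sub_const_Ici, zero_add] at this
  exact this

theorem pd_comp_swap {F : ℝ × ℝ → ℂ} (hs : ContDiff ℝ ∞ F) (v p : ℝ × ℝ) :
    pd v (fun q => F q.swap) p = pd v.swap F p.swap := by
  have h1 : HasFDerivAt F (fderiv ℝ F p.swap) p.swap :=
    (hs.differentiable (by simp) _).hasFDerivAt
  have h2 : HasFDerivAt (fun q : ℝ × ℝ => q.swap)
      ((ContinuousLinearMap.snd ℝ ℝ ℝ).prod (ContinuousLinearMap.fst ℝ ℝ ℝ)) p :=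
    ((ContinuousLinearMap.snd ℝ ℝ ℝ).prod (ContinuousLinearMap.fst ℝ ℝ ℝ)).hasFDerivAt
  have := (h1.comp p h2).fderiv
  simp only [pd]
  change fderiv ℝ (F ∘ fun q : ℝ × ℝ => q.swap) p v = _
  rw [this]
  rfl

theorem setIntegral_pencil_swap (G : ℝ × ℝ → ℂ) :
    ∫ p in pencil d, G p.swap = ∫ p in pencil d, G p := by
  have h : (Prod.swap ⁻¹' pencil d : Set (ℝ × ℝ)) = pencil d := by
    ext p
    simp only [pencil, mem_preimage, mem_ofPred_eq, Prod.fst_swap, Prod.snd_swap]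
    rw [abs_sub_comm]
    tauto
  have hm : MeasurePreserving (Prod.swap : ℝ × ℝ → ℝ × ℝ) volume volume :=
    Measure.measurePreserving_swap
  have := hm.setIntegral_preimage_emb MeasurableEquiv.prodComm.measurableEmbedding G (pencil d)
  rwa [h] at this

theorem integral_pd_snd (hd : 0 < d) {F : ℝ × ℝ → ℂ} (hs : ContDiff ℝ ∞ F)
    (hc : HasCompactSupport F) (h0 : ∀ x ∈ Icc 0 d, F (x, 0) = 0) :
    ∫ p in pencil d, pd (0, 1) F p =
      (∫ y in Ici (0 : ℝ), F (y, y + d)) - ∫ y in Ici (0 : ℝ), F (y + d, y) := by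
  have hs' : ContDiff ℝ ∞ fun q : ℝ × ℝ => F q.swap := hs.comp (contDiff_snd.prodMk contDiff_fst)
  have hc' : HasCompactSupport fun q : ℝ × ℝ => F q.swap :=
    hc.comp_isClosedEmbedding (Homeomorph.prodComm ℝ ℝ).isClosedEmbedding
  have := integral_pd_fst hd hs' hc' h0
  simp only [pd_comp_swap hs, Prod.swap_prod_mk] at this
  rwa [setIntegral_pencil_swap (pd (0, 1) F)] at this

theorem contDiff_pd {u : ℝ × ℝ → ℂ} (hs : ContDiff ℝ ∞ u) (v : ℝ × ℝ) : ContDiff ℝ ∞ (pd v u) :=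
  (hs.fderiv_right (m := ∞) (by simp)).clm_apply contDiff_const

theorem pd_conj (φ : ℝ × ℝ → ℂ) (hs : ContDiff ℝ ∞ φ) (v p : ℝ × ℝ) :
    pd v (fun q => starRingEnd ℂ (φ q)) p = starRingEnd ℂ (pd v φ p) := by
  have h1 : HasFDerivAt φ (fderiv ℝ φ p) p := (hs.differentiable (by simp) _).hasFDerivAt
  have h2 := (Complex.conjCLE.toContinuousLinearMap.hasFDerivAt (x := φ p)).comp p h1
  have := h2.fderiv
  simp only [pd]
  change fderiv ℝ ((Complex.conjCLE : ℂ → ℂ) ∘ φ) p v = _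
  erw [this]
  rfl

theorem pd_mul {φ ψ : ℝ × ℝ → ℂ} (hφ : ContDiff ℝ ∞ φ) (hψ : ContDiff ℝ ∞ ψ) (v p : ℝ × ℝ) :
    pd v (fun q => φ q * ψ q) p = pd v φ p * ψ p + φ p * pd v ψ p := by
  have h1 := (hφ.differentiable (by simp)) p
  have h2 := (hψ.differentiable (by simp)) p
  simp only [pd]
  rw [fderiv_fun_mul h1 h2]
  simp
  ring

/-- The Laplacian. -/
def lap (u : ℝ × ℝ → ℂ) (p : ℝ × ℝ) : ℂ := pd (1, 0) (pd (1, 0) u) p + pd (0, 1) (pd (0, 1) u) p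

/-- Green's formula; `φ` is arbitrary on `|x - y| = d`, where the boundary terms remain. -/
theorem smooth_green (hd : 0 < d) {φ u : ℝ × ℝ → ℂ} (hφ : ContDiff ℝ ∞ φ) (hs : ContDiff ℝ ∞ u)
    (hc : HasCompactSupport u) (h0 : ∀ p : ℝ × ℝ, p.1 + p.2 ≤ d → ∀ v, pd v u p = 0) :
    (∫ p in pencil d, starRingEnd ℂ (pd (1, 0) φ p) * pd (1, 0) u p) +
      (∫ p in pencil d, starRingEnd ℂ (pd (0, 1) φ p) * pd (0, 1) u p) =
      (∫ p in pencil d, starRingEnd ℂ (φ p) * -lap u p) +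
      (∫ y in Ici (0 : ℝ), starRingEnd ℂ (φ (y + d, y)) *
        (pd (1, 0) u (y + d, y) - pd (0, 1) u (y + d, y))) +
      ∫ y in Ici (0 : ℝ), starRingEnd ℂ (φ (y, y + d)) *
        (pd (0, 1) u (y, y + d) - pd (1, 0) u (y, y + d)) := by
  have hψ : ContDiff ℝ ∞ fun p => starRingEnd ℂ (φ p) :=
    Complex.conjCLE.contDiff.comp hφ
  have hψ' := hψ.continuous
  have s1 := contDiff_pd hs (1, 0)
  have s2 := contDiff_pd hs (0, 1)
  have c1 := hasCompactSupport_pd hc (1, 0)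
  have c2 := hasCompactSupport_pd hc (0, 1)
  have hmul : ∀ v w : ℝ × ℝ, ∀ p, pd v (fun q => starRingEnd ℂ (φ q) * pd w u q) p =
      starRingEnd ℂ (pd v φ p) * pd w u p + starRingEnd ℂ (φ p) * pd v (pd w u) p :=
    fun v w p => by rw [pd_mul hψ (contDiff_pd hs w), pd_conj φ hφ]
  have k1 := integral_pd_fst hd (hψ.mul s1) c1.mul_left fun y hy => by
    rw [h0 (0, y) (by simpa using hy.2), mul_zero]
  have k2 := integral_pd_snd hd (hψ.mul s2) c2.mul_left fun y hy => by
    rw [h0 (y, 0) (by simpa using hy.2), mul_zero]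
  simp only [hmul] at k1 k2
  have ip : ∀ v w : ℝ × ℝ, Integrable (fun p => starRingEnd ℂ (pd v φ p) * pd w u p)
      (volume.restrict (pencil d)) := fun v w =>
    (((Complex.continuous_conj.comp (continuous_pd hφ v)).mul
      (continuous_pd hs w)).integrable_of_hasCompactSupport
      (hasCompactSupport_pd hc w).mul_left).integrableOn
  have iq : ∀ v w : ℝ × ℝ, Integrable (fun p => starRingEnd ℂ (φ p) * pd v (pd w u) p)
      (volume.restrict (pencil d)) := fun v w =>
    ((hψ'.mul (continuous_pd (contDiff_pd hs w) v)).integrable_of_hasCompactSupport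
      (hasCompactSupport_pd (hasCompactSupport_pd hc w) v).mul_left).integrableOn
  rw [integral_add (ip _ _) (iq _ _)] at k1 k2
  have e1 : ∫ p in pencil d, starRingEnd ℂ (φ p) * -lap u p =
      -((∫ p in pencil d, starRingEnd ℂ (φ p) * pd (1, 0) (pd (1, 0) u) p) +
        ∫ p in pencil d, starRingEnd ℂ (φ p) * pd (0, 1) (pd (0, 1) u) p) := by
    rw [← integral_add (iq _ _) (iq _ _), ← integral_neg]
    simp only [lap, mul_neg, mul_add]
  have il : ∀ (γ : ℝ → ℝ × ℝ) (ρ : ℝ × ℝ → ℝ), Continuous γ → Continuous ρ →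
      Function.LeftInverse ρ γ → ∀ w, Integrable
        (fun y => starRingEnd ℂ (φ (γ y)) * pd w u (γ y)) (volume.restrict (Ici (0 : ℝ))) :=
    fun γ ρ hγ hρ hl w => (((hψ'.mul (continuous_pd hs w)).comp
      hγ).integrable_of_hasCompactSupport (((hasCompactSupport_pd hc w).mul_left
        (f := fun p => starRingEnd ℂ (φ p))).comp_isClosedEmbedding
        (hl.isClosedEmbedding hρ hγ))).integrableOn
  have l1 := il (fun y => (y + d, y)) Prod.snd (by fun_prop) continuous_snd fun y => rfl
  have l2 := il (fun y => (y, y + d)) Prod.fst (by fun_prop) continuous_fst fun y => rfl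
  simp only [mul_sub]
  rw [integral_sub (l1 _) (l1 _), integral_sub (l2 _) (l2 _), e1]
  linear_combination k1 + k2

/-- Green's formula for a jet in the form domain and a smooth function whose gradient vanishes for
`x + y ≤ d`, in particular on the axes: no boundary terms remain. -/
theorem exists_green (hd : 0 < d) {u : ℝ × ℝ → ℂ} {Z : Jet d × L2Ray × L2Ray}
    (h : IsSmoothJet u Z) (h0 : ∀ p : ℝ × ℝ, p.1 + p.2 ≤ d → ∀ v, pd v u p = 0) :
    ∃ W : L2Pencil d, W =ᵐ[volume.restrict (pencil d)] (fun p => -lap u p) ∧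
      ∀ X : Jet d, InFormDomain X →
        inner ℂ X.dx Z.1.dx + inner ℂ X.dy Z.1.dy = inner ℂ X.val W := by
  have hs := h.contDiff
  have hc := h.hasCompactSupport
  have s1 := contDiff_pd hs (1, 0)
  have s2 := contDiff_pd hs (0, 1)
  have c1 := hasCompactSupport_pd hc (1, 0)
  have c2 := hasCompactSupport_pd hc (0, 1)
  have mW : MemLp (fun p => -lap u p) 2 (volume.restrict (pencil d)) :=
    (((continuous_pd s1 _).add (continuous_pd s2 _)).memLp_of_hasCompactSupport
      ((hasCompactSupport_pd c1 _).add (hasCompactSupport_pd c2 _))).neg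
  have m1 := memLp_comp_curve (s1.continuous.sub s2.continuous) (c1.sub c2)
    (γ := fun y => (y + d, y)) (by fun_prop) continuous_snd (fun y => rfl)
    (volume.restrict (Ici 0))
  have m2 := memLp_comp_curve (s2.continuous.sub s1.continuous) (c2.sub c1)
    (γ := fun y => (y, y + d)) (by fun_prop) continuous_fst (fun y => rfl)
    (volume.restrict (Ici 0))
  refine ⟨mW.toLp _, mW.coeFn_toLp, fun X hX => ?_⟩
  have key := hX.induction (p := fun Y => inner ℂ Y.1.dx Z.1.dx + inner ℂ Y.1.dy Z.1.dy =
    inner ℂ Y.1.val (mW.toLp _) + inner ℂ Y.2.1 (m1.toLp _) + inner ℂ Y.2.2 (m2.toLp _))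
    (isClosed_eq (by fun_prop) (by fun_prop)) fun φ Y hY => ?_
  · simpa using key
  have conv : ∀ {E : Type} [MeasurableSpace E] {μ : Measure E} {f g : Lp ℂ 2 μ} {a b : E → ℂ},
      f =ᵐ[μ] a → g =ᵐ[μ] b → inner ℂ f g = ∫ x, starRingEnd ℂ (a x) * b x ∂μ := by
    intro E _ μ f g a b ha hb
    rw [l2_inner_eq]
    refine integral_congr_ae ?_
    filter_upwards [ha, hb] with x h1 h2
    rw [h1, h2]
  rw [conv hY.dx h.dx, conv hY.dy h.dy, conv hY.val mW.coeFn_toLp, conv hY.lower m1.coeFn_toLp,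
    conv hY.upper m2.coeFn_toLp]
  exact smooth_green hd hY.contDiff hs hc h0

end

section

/-! ### Approximate eigenfunctions -/

variable {d : ℝ}

theorem integral_comp_affine (g : ℝ → ℝ) {δ : ℝ} (hδ : 0 < δ) (a : ℝ) :
    ∫ s, g (δ * (s - a)) = δ⁻¹ * ∫ s, g s := by
  rw [integral_sub_right_eq_self (fun s => g (δ * s)) a, Measure.integral_comp_mul_left,
    abs_of_pos (inv_pos.2 hδ), smul_eq_mul]

/-- The function `s ↦ r (δ (s - a)) e^{iks}`. -/
def modulation (k δ a : ℝ) (r : ℝ → ℝ) (s : ℝ) : ℂ :=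
  ((r (δ * (s - a)) : ℝ) : ℂ) * Complex.exp (Complex.I * k * s)

theorem contDiff_modulation (k δ a : ℝ) {r : ℝ → ℝ} (hr : ContDiff ℝ ∞ r) :
    ContDiff ℝ ∞ (modulation k δ a r) := by
  have h1 : ContDiff ℝ ∞ fun s : ℝ => ((r (δ * (s - a)) : ℝ) : ℂ) :=
    Complex.ofRealCLM.contDiff.comp (hr.comp (by fun_prop))
  have h2 : ContDiff ℝ ∞ fun s : ℝ => Complex.exp (Complex.I * k * s) :=
    (contDiff_const.mul Complex.ofRealCLM.contDiff).cexp
  exact h1.mul h2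

theorem hasDerivAt_modulation (k δ a : ℝ) {r : ℝ → ℝ} (hr : ContDiff ℝ ∞ r) (s : ℝ) :
    HasDerivAt (modulation k δ a r)
      (δ * modulation k δ a (deriv r) s + Complex.I * k * modulation k δ a r s) s := by
  have h0 : HasDerivAt r (deriv r (δ * (s - a))) (δ * (s - a)) :=
    (hr.differentiable (by simp) _).hasDerivAt
  have h1 : HasDerivAt (fun s => δ * (s - a)) δ s := by
    simpa using ((hasDerivAt_id s).sub_const a).const_mul δ
  have h2 := (h0.comp s h1).ofReal_comp
  have h3 : HasDerivAt (fun s : ℝ => Complex.I * k * s) (Complex.I * k) s := by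
    simpa using (hasDerivAt_id s).ofReal_comp.const_mul (Complex.I * k)
  refine (h2.mul h3.cexp).congr_deriv ?_
  simp only [modulation, Function.comp]
  push_cast
  ring

theorem deriv_deriv_modulation (k δ a : ℝ) {r : ℝ → ℝ} (hr : ContDiff ℝ ∞ r) (s : ℝ) :
    deriv (deriv (modulation k δ a r)) s + (k : ℂ) ^ 2 * modulation k δ a r s =
      δ ^ 2 * modulation k δ a (deriv (deriv r)) s +
        2 * Complex.I * k * δ * modulation k δ a (deriv r) s := by
  have e1 : deriv (modulation k δ a r) =
      fun s => δ * modulation k δ a (deriv r) s + Complex.I * k * modulation k δ a r s :=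
    funext fun s => (hasDerivAt_modulation k δ a hr s).deriv
  have e2 := (((hasDerivAt_modulation k δ a (contDiff_infty_iff_deriv.1 hr).2 s).const_mul
    (δ : ℂ)).add ((hasDerivAt_modulation k δ a hr s).const_mul (Complex.I * k))).deriv
  rw [e1]
  refine (congrArg (· + (k : ℂ) ^ 2 * modulation k δ a r s) e2).trans ?_
  linear_combination (k : ℂ) ^ 2 * modulation k δ a r s * Complex.I_sq

theorem norm_sq_modulation (k δ a : ℝ) (r : ℝ → ℝ) (s : ℝ) :
    ‖modulation k δ a r s‖ ^ 2 = r (δ * (s - a)) ^ 2 := by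
  have : Complex.I * k * s = ((k * s : ℝ) : ℂ) * Complex.I := by push_cast; ring
  rw [modulation, norm_mul, this, Complex.norm_exp_ofReal_mul_I, mul_one, Complex.norm_real,
    Real.norm_eq_abs, sq_abs]

theorem integral_norm_sq_modulation (k a : ℝ) {δ : ℝ} (hδ : 0 < δ) (r : ℝ → ℝ) :
    ∫ s, ‖modulation k δ a r s‖ ^ 2 = δ⁻¹ * ∫ s, r s ^ 2 := by
  simp only [norm_sq_modulation]
  exact integral_comp_affine (fun x => r x ^ 2) hδ a

theorem hasCompactSupport_modulation (k a : ℝ) {δ : ℝ} (hδ : 0 < δ) {r : ℝ → ℝ}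
    (hr : HasCompactSupport r) : HasCompactSupport (modulation k δ a r) := by
  have h1 : HasCompactSupport fun s : ℝ => r (δ * (s - a)) := by
    have hl : Function.LeftInverse (fun x : ℝ => x / δ + a) fun s : ℝ => δ * (s - a) :=
      fun s => by field_simp; ring
    exact hr.comp_isClosedEmbedding (hl.isClosedEmbedding (by fun_prop) (by fun_prop))
  exact (h1.comp_left (g := Complex.ofReal) rfl).mul_right

theorem integrable_norm_sq_modulation (k a : ℝ) {δ : ℝ} (hδ : 0 < δ) {r : ℝ → ℝ}
    (hr : ContDiff ℝ ∞ r) (hc : HasCompactSupport r) :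
    Integrable fun s => ‖modulation k δ a r s‖ ^ 2 :=
  ((contDiff_modulation k δ a hr).continuous.norm.pow 2).integrable_of_hasCompactSupport
    (hasCompactSupport_norm_sq (hasCompactSupport_modulation k a hδ hc))

theorem integral_modulation_le (k a : ℝ) {δ : ℝ} (hδ : 0 < δ) (hδ1 : δ ≤ 1) {r : ℝ → ℝ}
    (hr : ContDiff ℝ ∞ r) (hc : HasCompactSupport r) :
    ∫ s, ‖deriv (deriv (modulation k δ a r)) s + (k : ℂ) ^ 2 * modulation k δ a r s‖ ^ 2 ≤
      δ⁻¹ * (δ * (2 * (∫ s, deriv (deriv r) s ^ 2) + 8 * k ^ 2 * ∫ s, deriv r s ^ 2)) := by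
  have r1 : ContDiff ℝ ∞ (deriv r) := (contDiff_infty_iff_deriv.1 hr).2
  have r2 : ContDiff ℝ ∞ (deriv (deriv r)) := (contDiff_infty_iff_deriv.1 r1).2
  have i1 := integrable_norm_sq_modulation k a hδ r1 hc.deriv
  have i2 := integrable_norm_sq_modulation k a hδ r2 hc.deriv.deriv
  have hb : ∀ s, ‖deriv (deriv (modulation k δ a r)) s + (k : ℂ) ^ 2 * modulation k δ a r s‖ ^ 2 ≤
      2 * δ * ‖modulation k δ a (deriv (deriv r)) s‖ ^ 2 +
        8 * k ^ 2 * δ * ‖modulation k δ a (deriv r) s‖ ^ 2 := fun s => by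
    rw [deriv_deriv_modulation k δ a hr]
    generalize modulation k δ a (deriv (deriv r)) s = z
    generalize modulation k δ a (deriv r) s = w
    have h1 := norm_add_le ((δ : ℂ) ^ 2 * z) (2 * Complex.I * k * δ * w)
    have h2 : ‖(δ : ℂ) ^ 2 * z‖ = δ ^ 2 * ‖z‖ := by simp
    have h3 : ‖2 * Complex.I * k * δ * w‖ = 2 * |k| * δ * ‖w‖ := by simp [abs_of_pos hδ]
    rw [h2, h3] at h1
    have h4 : (δ ^ 2 * ‖z‖ + 2 * |k| * δ * ‖w‖) ^ 2 ≤
        δ ^ 4 * (2 * ‖z‖ ^ 2) + δ ^ 2 * (8 * k ^ 2 * ‖w‖ ^ 2) := by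
      rw [← sq_abs k]
      linarith [sq_nonneg (δ ^ 2 * ‖z‖ - 2 * |k| * δ * ‖w‖)]
    have h5 : δ ^ 4 ≤ δ := pow_le_of_le_one hδ.le hδ1 (by norm_num)
    have h6 : δ ^ 2 ≤ δ := pow_le_of_le_one hδ.le hδ1 (by norm_num)
    have h7 : δ ^ 4 * (2 * ‖z‖ ^ 2) ≤ δ * (2 * ‖z‖ ^ 2) := by gcongr
    have h8 : δ ^ 2 * (8 * k ^ 2 * ‖w‖ ^ 2) ≤ δ * (8 * k ^ 2 * ‖w‖ ^ 2) := by gcongr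
    have h9 := pow_le_pow_left₀ (norm_nonneg _) h1 2
    linarith
  refine (integral_mono_of_nonneg (ae_of_all _ fun s => sq_nonneg _)
    ((i2.const_mul _).add (i1.const_mul _)) (ae_of_all _ hb)).trans_eq ?_
  refine (integral_add (i2.const_mul _) (i1.const_mul _)).trans ?_
  rw [integral_const_mul, integral_const_mul, integral_norm_sq_modulation k a hδ,
    integral_norm_sq_modulation k a hδ]
  ring

theorem exists_profile : ∃ r : ℝ → ℝ, ContDiff ℝ ∞ r ∧ HasCompactSupport r ∧
    (∀ x ≤ -2, r x = 0) ∧ 0 < ∫ s, r s ^ 2 := by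
  let ρ : ContDiffBump (0 : ℝ) := ⟨1, 2, one_pos, one_lt_two⟩
  refine ⟨ρ, ρ.contDiff, ρ.hasCompactSupport, fun x hx => ρ.zero_of_le_dist ?_, ?_⟩
  · rw [Real.dist_eq, sub_zero, abs_of_neg (by linarith)]
    change (2 : ℝ) ≤ _
    linarith
  · refine Continuous.integral_pos_of_hasCompactSupport_nonneg_nonzero (x := 0)
      (ρ.continuous.pow 2) (ρ.hasCompactSupport.comp_left (g := fun x : ℝ => x ^ 2) (by simp))
      (fun s => sq_nonneg _) ?_
    have : ρ 0 = 1 := ρ.one_of_mem_closedBall (by simp [ρ])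
    simp [this]

/-- Slowly varying modulations of `s ↦ e^{iks}`, supported far away, are approximate solutions of
`c'' + k² c = 0`. -/
theorem exists_longitudinal (k R : ℝ) {ε : ℝ} (hε : 0 < ε) :
    ∃ c : ℝ → ℂ, ContDiff ℝ ∞ c ∧ HasCompactSupport c ∧ (∀ s ≤ R, c s = 0) ∧
      0 < ∫ s, ‖c s‖ ^ 2 ∧
      ∫ s, ‖deriv (deriv c) s + (k : ℂ) ^ 2 * c s‖ ^ 2 ≤ ε * ∫ s, ‖c s‖ ^ 2 := by
  obtain ⟨r, hr, hc, h0, hA⟩ := exists_profile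
  have hB : 0 ≤ 2 * (∫ s, deriv (deriv r) s ^ 2) + 8 * k ^ 2 * ∫ s, deriv r s ^ 2 := by
    have h1 : 0 ≤ ∫ s, deriv (deriv r) s ^ 2 := integral_nonneg fun s => sq_nonneg _
    have h2 : 0 ≤ ∫ s, deriv r s ^ 2 := integral_nonneg fun s => sq_nonneg _
    positivity
  obtain ⟨B, hB'⟩ : ∃ B, B =
    2 * (∫ s, deriv (deriv r) s ^ 2) + 8 * k ^ 2 * ∫ s, deriv r s ^ 2 := ⟨_, rfl⟩
  rw [← hB'] at hB
  obtain ⟨δ, hδ, hδ1, hδB⟩ : ∃ δ : ℝ, 0 < δ ∧ δ ≤ 1 ∧ δ * B ≤ ε * ∫ s, r s ^ 2 := by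
    refine ⟨min 1 ((ε * ∫ s, r s ^ 2) / (B + 1)), lt_min one_pos (by positivity),
      min_le_left _ _, ?_⟩
    have h1 : min 1 ((ε * ∫ s, r s ^ 2) / (B + 1)) ≤ (ε * ∫ s, r s ^ 2) / (B + 1) :=
      min_le_right _ _
    refine (mul_le_mul_of_nonneg_right h1 hB).trans ?_
    rw [div_mul_eq_mul_div, div_le_iff₀ (by positivity)]
    nlinarith [mul_pos hε hA]
  -- the support `[-2, 2]` of the profile is stretched by `1 / δ` and moved to the right of `R`
  refine ⟨modulation k δ (R + 2 / δ) r, contDiff_modulation _ _ _ hr,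
    hasCompactSupport_modulation _ _ hδ hc, fun s hs => ?_, ?_, ?_⟩
  · have h1 : δ * (s - (R + 2 / δ)) ≤ -2 := by
      have h2 : δ * (s - (R + 2 / δ)) = δ * (s - R) - 2 := by
        field_simp
        ring
      nlinarith
    rw [modulation, h0 _ h1, Complex.ofReal_zero, zero_mul]
  · rw [integral_norm_sq_modulation _ _ hδ]
    positivity
  · refine (integral_modulation_le k _ hδ hδ1 hr hc).trans ?_
    rw [← hB', integral_norm_sq_modulation _ _ hδ, mul_left_comm ε]
    exact mul_le_mul_of_nonneg_left hδB (inv_pos.2 hδ).le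

/-- A solution of `h'' = -ν² h` on `[-d, d]`, cut off outside. -/
theorem exists_transverse (hd : 0 < d) {ν : ℝ} {h : ℝ → ℂ} (hh : ContDiff ℝ ∞ h)
    (h2 : ∀ t, deriv (deriv h) t = -(ν : ℂ) ^ 2 * h t) :
    ∃ g : ℝ → ℂ, ContDiff ℝ ∞ g ∧ HasCompactSupport g ∧ ∀ t, |t| ≤ d →
      g t = h t ∧ deriv (deriv g) t = -(ν : ℂ) ^ 2 * g t := by
  set ρ : ContDiffBump (0 : ℝ) := ⟨2 * d, 3 * d, by positivity, by linarith⟩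
  refine ⟨fun t => ((ρ t : ℝ) : ℂ) * h t, (Complex.ofRealCLM.contDiff.comp ρ.contDiff).mul hh,
    (ρ.hasCompactSupport.comp_left (g := Complex.ofReal) rfl).mul_right, fun t ht => ?_⟩
  have hev : (fun t => ((ρ t : ℝ) : ℂ) * h t) =ᶠ[𝓝 t] h := by
    have : Metric.ball (0 : ℝ) (2 * d) ∈ 𝓝 t := Metric.isOpen_ball.mem_nhds (by
      rw [Metric.mem_ball, Real.dist_eq, sub_zero]
      linarith)
    filter_upwards [this] with x hx
    have : ρ x = 1 := ρ.one_of_mem_closedBall (Metric.ball_subset_closedBall hx)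
    simp [this]
  have e0 := hev.eq_of_nhds
  have e2 := hev.deriv.deriv_eq
  exact ⟨e0, by rw [e2, h2, ← e0]⟩

/-- The function `(x, y) ↦ c (x + y) g (x - y)`. -/
def rotatedProd (c g : ℝ → ℂ) (p : ℝ × ℝ) : ℂ := c (p.1 + p.2) * g (p.1 - p.2)

theorem contDiff_rotatedProd {c g : ℝ → ℂ} (hc : ContDiff ℝ ∞ c) (hg : ContDiff ℝ ∞ g) :
    ContDiff ℝ ∞ (rotatedProd c g) :=
  (hc.comp (contDiff_fst.add contDiff_snd)).mul (hg.comp (contDiff_fst.sub contDiff_snd))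

theorem hasCompactSupport_rotatedProd {c g : ℝ → ℂ} (hc : HasCompactSupport c)
    (hg : HasCompactSupport g) : HasCompactSupport (rotatedProd c g) := by
  have h : HasCompactSupport fun q : ℝ × ℝ => c q.1 * g q.2 := by
    refine HasCompactSupport.intro (hc.isCompact.prod hg.isCompact) fun q hq => ?_
    by_cases h1 : q.1 ∈ tsupport c
    · rw [image_eq_zero_of_notMem_tsupport fun h2 => hq ⟨h1, h2⟩, mul_zero]
    · rw [image_eq_zero_of_notMem_tsupport h1, zero_mul]
  have := hasCompactSupport_comp_linComb (e := (1, 1)) (v := (1, -1)) (by norm_num) h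
  have e : rotatedProd c g = fun p : ℝ × ℝ => (fun q : ℝ × ℝ => c q.1 * g q.2)
      (p.1 • ((1, 1) : ℝ × ℝ) + p.2 • ((1, -1) : ℝ × ℝ)) := by
    ext p
    simp [rotatedProd, sub_eq_add_neg]
  rw [e]
  exact this

theorem pd_rotatedProd {c g : ℝ → ℂ} (hc : ContDiff ℝ ∞ c) (hg : ContDiff ℝ ∞ g)
    (v p : ℝ × ℝ) : pd v (rotatedProd c g) p =
      (v.1 + v.2 : ℝ) * rotatedProd (deriv c) g p + (v.1 - v.2 : ℝ) * rotatedProd c (deriv g) p := by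
  have h1 := hasDerivAt_line (contDiff_rotatedProd hc hg) p v 0
  rw [zero_smul, add_zero] at h1
  have a1 : HasDerivAt (fun t : ℝ => (p.1 + p.2) + t * (v.1 + v.2)) (v.1 + v.2) 0 := by
    simpa using ((hasDerivAt_id (0 : ℝ)).mul_const (v.1 + v.2)).const_add (p.1 + p.2)
  have a2 : HasDerivAt (fun t : ℝ => (p.1 - p.2) + t * (v.1 - v.2)) (v.1 - v.2) 0 := by
    simpa using ((hasDerivAt_id (0 : ℝ)).mul_const (v.1 - v.2)).const_add (p.1 - p.2)
  have b1 : HasDerivAt c (deriv c (p.1 + p.2)) ((p.1 + p.2) + 0 * (v.1 + v.2)) := by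
    rw [zero_mul, add_zero]
    exact (hc.differentiable (by simp) _).hasDerivAt
  have b2 : HasDerivAt g (deriv g (p.1 - p.2)) ((p.1 - p.2) + 0 * (v.1 - v.2)) := by
    rw [zero_mul, add_zero]
    exact (hg.differentiable (by simp) _).hasDerivAt
  have h2 := (b1.scomp (0 : ℝ) a1).mul (b2.scomp (0 : ℝ) a2)
  have h3 : (fun t : ℝ => rotatedProd c g (p + t • v)) =
      (c ∘ fun t : ℝ => (p.1 + p.2) + t * (v.1 + v.2)) *
        (g ∘ fun t : ℝ => (p.1 - p.2) + t * (v.1 - v.2)) := by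
    ext t
    simp only [rotatedProd, Prod.fst_add, Prod.snd_add, Prod.smul_fst, Prod.smul_snd, smul_eq_mul,
      Pi.mul_apply, Function.comp]
    congr 2 <;> ring
  rw [h3] at h1
  rw [h1.unique h2]
  simp only [rotatedProd, Function.comp, zero_mul, add_zero, Complex.real_smul]
  ring

theorem lap_rotatedProd {c g : ℝ → ℂ} (hc : ContDiff ℝ ∞ c) (hg : ContDiff ℝ ∞ g) (p : ℝ × ℝ) :
    lap (rotatedProd c g) p =
      2 * (rotatedProd (deriv (deriv c)) g p + rotatedProd c (deriv (deriv g)) p) := by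
  have hc' : ContDiff ℝ ∞ (deriv c) := (contDiff_infty_iff_deriv.1 hc).2
  have hg' : ContDiff ℝ ∞ (deriv g) := (contDiff_infty_iff_deriv.1 hg).2
  have s1 := contDiff_rotatedProd hc' hg
  have s2 := contDiff_rotatedProd hc hg'
  have e1 : pd (1, 0) (rotatedProd c g) = rotatedProd (deriv c) g + rotatedProd c (deriv g) := by
    ext p
    rw [pd_rotatedProd hc hg]
    simp
  have e2 : pd (0, 1) (rotatedProd c g) =
      rotatedProd (deriv c) g + fun p => (-1 : ℂ) • rotatedProd c (deriv g) p := by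
    ext p
    rw [pd_rotatedProd hc hg]
    simp
  rw [lap, e1, e2, pd_add s1 s2, pd_add s1 (s2.const_smul (-1 : ℂ)),
    show (fun p => (-1 : ℂ) • rotatedProd c (deriv g) p) =
      (-1 : ℂ) • rotatedProd c (deriv g) from rfl,
    pd_smul s2,
    pd_rotatedProd hc' hg, pd_rotatedProd hc hg', pd_rotatedProd hc' hg, pd_rotatedProd hc hg']
  simp
  ring

theorem setIntegral_rotatedProd (hd : 0 < d) {c g : ℝ → ℂ} (h0 : ∀ s ≤ 2 * d, c s = 0) :
    ∫ p in pencil d, ‖rotatedProd c g p‖ ^ 2 =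
      1 / 2 * (∫ s, ‖c s‖ ^ 2) * ∫ t in Icc (-d) d, ‖g t‖ ^ 2 := by
  have him : (fun p : ℝ × ℝ => p.1 • ((1 / 2, 1 / 2) : ℝ × ℝ) + p.2 • (1 / 2, -(1 / 2))) ''
      (Ici d ×ˢ Icc (-d) d) = farPart d d := by
    ext p
    constructor
    · rintro ⟨⟨s, t⟩, ⟨hs, h1, h2⟩, rfl⟩
      simp only [mem_Ici] at hs h1 h2
      refine ⟨⟨?_, ?_, ?_⟩, ?_⟩ <;> simp [abs_le] <;> (try constructor) <;> linarith
    · rintro ⟨⟨h1, h2, h3⟩, h4⟩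
      refine ⟨(p.1 + p.2, p.1 - p.2), ⟨h4, abs_le.1 h3⟩, ?_⟩
      ext <;> simp <;> ring
  have e1 : ∫ p in pencil d, ‖rotatedProd c g p‖ ^ 2 =
      ∫ p in farPart d d, ‖rotatedProd c g p‖ ^ 2 := by
    refine setIntegral_eq_of_subset_of_forall_sdiff_eq_zero (measurableSet_pencil d)
      inter_subset_left fun p hp => ?_
    have : p.1 + p.2 < d := by
      by_contra h
      exact hp.2 ⟨hp.1, not_lt.1 h⟩
    simp [rotatedProd, h0 (p.1 + p.2) (by linarith)]
  have hD : ((1 / 2, 1 / 2) : ℝ × ℝ).1 * ((1 / 2, -(1 / 2)) : ℝ × ℝ).2 -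
      ((1 / 2, 1 / 2) : ℝ × ℝ).2 * ((1 / 2, -(1 / 2)) : ℝ × ℝ).1 = -(1 / 2) := by norm_num
  rw [e1, ← him, setIntegral_image_linComb (by rw [hD]; norm_num)
    (measurableSet_Ici.prod measurableSet_Icc), hD]
  have e2 : ∀ p : ℝ × ℝ, ‖rotatedProd c g
      (p.1 • ((1 / 2, 1 / 2) : ℝ × ℝ) + p.2 • (1 / 2, -(1 / 2)))‖ ^ 2 =
      ‖c p.1‖ ^ 2 * ‖g p.2‖ ^ 2 := fun p => by
    have f1 : (p.1 • ((1 / 2, 1 / 2) : ℝ × ℝ) + p.2 • (1 / 2, -(1 / 2))).1 +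
        (p.1 • ((1 / 2, 1 / 2) : ℝ × ℝ) + p.2 • (1 / 2, -(1 / 2))).2 = p.1 := by
      simp; ring
    have f2 : (p.1 • ((1 / 2, 1 / 2) : ℝ × ℝ) + p.2 • (1 / 2, -(1 / 2))).1 -
        (p.1 • ((1 / 2, 1 / 2) : ℝ × ℝ) + p.2 • (1 / 2, -(1 / 2))).2 = p.2 := by
      simp; ring
    rw [rotatedProd, f1, f2, norm_mul, mul_pow]
  simp only [e2]
  rw [Measure.volume_eq_prod, setIntegral_prod_mul (fun s => ‖c s‖ ^ 2) (fun t => ‖g t‖ ^ 2)]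
  have e3 : ∫ s in Ici d, ‖c s‖ ^ 2 = ∫ s, ‖c s‖ ^ 2 :=
    setIntegral_eq_integral_of_forall_compl_eq_zero fun s hs => by
      have : s < d := not_le.1 hs
      simp [h0 s (by linarith)]
  rw [e3, smul_eq_mul, abs_neg, abs_of_pos (by norm_num)]
  ring

end

section

variable {d : ℝ}

theorem norm_le_of_norm_sq_le {X : Type*} [NormedAddCommGroup X] {x : X} {t y : ℝ} (ht : 0 ≤ t)
    (hy : 0 ≤ y) (h : ‖x‖ ^ 2 ≤ t ^ 2 * y ^ 2) : ‖x‖ ≤ t * y := by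
  rw [← mul_pow] at h
  exact (pow_le_pow_iff_left₀ (norm_nonneg _) (by positivity) two_ne_zero).1 h

/-- Approximate eigenfunctions `c (x + y) g (x - y)`: the remainder consists of the longitudinal
error `-2 (c'' + k² c) g` and of the trace of `α` on the diagonal, which is small far away. The traces on
the axes vanish. -/
theorem mem_opSpectrum_of_transverse (hd : 0 < d) (σ α : LInftyRay) {g : ℝ → ℂ}
    (hg : ContDiff ℝ ∞ g) (hgc : HasCompactSupport g) (g1 : g d = 0) (g2 : g (-d) = 0) {ν : ℝ}
    (h2 : ∀ t, |t| ≤ d → deriv (deriv g) t = -(ν : ℂ) ^ 2 * g t)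
    (hΓ : 0 < ∫ t in Icc (-d) d, ‖g t‖ ^ 2)
    (hα : ∀ ε : ℝ, 0 < ε → ∃ R : ℝ, ∀ᵐ y : ℝ, R ≤ y → |α y| * ‖g 0‖ ≤ ε)
    {lam : ℝ} (hl : 2 * ν ^ 2 ≤ lam) : (lam : ℂ) ∈ opSpectrum (operator d σ α) := by
  refine (isFormOperator hd σ α).mem_opSpectrum fun ε hε => ?_
  set Γ : ℝ := ∫ t in Icc (-d) d, ‖g t‖ ^ 2
  obtain ⟨k, hk⟩ : ∃ k : ℝ, 2 * k ^ 2 + 2 * ν ^ 2 = lam :=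
    ⟨√((lam - 2 * ν ^ 2) / 2), by rw [Real.sq_sqrt (by linarith)]; ring⟩
  obtain ⟨R₀, hR₀⟩ := hα (ε / 2 * √Γ) (by positivity)
  -- on the axes `x + y ≤ d` and on the diagonal `x + y = 2 y`; the added `1` makes `c` vanish near
  -- `2 d`, together with its derivatives
  obtain ⟨c, hc, hcc, hc0, hN, hcε⟩ := exists_longitudinal k (max (2 * d) (2 * R₀) + 1)
    (ε := (ε / 4) ^ 2) (by positivity)
  set N : ℝ := ∫ s, ‖c s‖ ^ 2
  have cev : ∀ s ≤ 2 * d, c =ᶠ[𝓝 s] 0 := fun s hs => by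
    filter_upwards [Iio_mem_nhds (show s < max (2 * d) (2 * R₀) + 1 by
      linarith [le_max_left (2 * d) (2 * R₀)])] with x hx
    exact hc0 x (le_of_lt hx)
  have c1 : ∀ s ≤ 2 * d, deriv c s = 0 := fun s hs => by
    rw [(cev s hs).deriv_eq]
    simp
  have c2 : ∀ s ≤ 2 * d, deriv (deriv c) s = 0 := fun s hs => by
    rw [(cev s hs).deriv.deriv_eq]
    simp
  have c0 : ∀ s ≤ 2 * d, c s = 0 := fun s hs => (cev s hs).eq_of_nhds
  obtain ⟨Z, hZ⟩ := exists_isSmoothJet d (contDiff_rotatedProd hc hg)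
    (hasCompactSupport_rotatedProd hcc hgc)
  obtain ⟨U, hU⟩ := exists_jetL_eq (hZ.inFormDomain (fun y => by simp [rotatedProd, g1])
    (fun y => by simp [rotatedProd, g2]))
  obtain ⟨W, hW, hWg⟩ := exists_green hd hZ fun p hp v => by
    rw [pd_rotatedProd hc hg, rotatedProd, rotatedProd, c0 _ (by linarith), c1 _ (by linarith)]
    simp
  have hv : ‖Z.1.val‖ ^ 2 = 1 / 2 * N * Γ := by
    rw [norm_sq_eq_integral hZ.val, setIntegral_rotatedProd hd c0]
  have hb : Z.1.bottom = 0 := by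
    rw [Lp.eq_zero_iff_ae_eq_zero]
    filter_upwards [hZ.bottom, ae_restrict_mem measurableSet_Icc] with y hy hy'
    rw [hy, rotatedProd, c0 _ (by simp only; linarith [hy'.2]), zero_mul, Pi.zero_apply]
  have hlf : Z.1.left = 0 := by
    rw [Lp.eq_zero_iff_ae_eq_zero]
    filter_upwards [hZ.left, ae_restrict_mem measurableSet_Icc] with y hy hy'
    rw [hy, rotatedProd, c0 _ (by simp only; linarith [hy'.2]), zero_mul, Pi.zero_apply]
  have hrem : ‖W - (lam : ℂ) • Z.1.val‖ ≤ ε / 2 * ‖Z.1.val‖ := by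
    refine norm_le_of_norm_sq_le (by positivity) (norm_nonneg _) ?_
    have e : (W - (lam : ℂ) • Z.1.val : L2Pencil d) =ᵐ[volume.restrict (pencil d)]
        fun p => -2 * rotatedProd (fun s => deriv (deriv c) s + (k : ℂ) ^ 2 * c s) g p := by
      filter_upwards [Lp.coeFn_sub W ((lam : ℂ) • Z.1.val), Lp.coeFn_smul (lam : ℂ) Z.1.val, hW,
        hZ.val, ae_restrict_mem (measurableSet_pencil d)] with p h3 h4 h5 h6 h7
      rw [h3, Pi.sub_apply, h4, Pi.smul_apply, h5, h6, lap_rotatedProd hc hg, smul_eq_mul, ← hk]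
      simp only [rotatedProd]
      rw [h2 _ h7.2.2]
      push_cast
      ring
    rw [norm_sq_eq_integral e, hv]
    simp only [norm_mul, mul_pow]
    rw [integral_const_mul, setIntegral_rotatedProd hd fun s hs => by
      rw [c2 s hs, c0 s hs, mul_zero, add_zero]]
    have := mul_le_mul_of_nonneg_right hcε hΓ.le
    have n2 : ‖(-2 : ℂ)‖ = 2 := by simp
    rw [n2]
    linarith
  have hdiag : ‖mulOp .rfl α Z.1.diag‖ ≤ ε / 2 * ‖Z.1.val‖ := by
    refine norm_le_of_norm_sq_le (by positivity) (norm_nonneg _) ?_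
    have e : mulOp .rfl α Z.1.diag =ᵐ[volume.restrict (Ici (0 : ℝ))]
        fun y => (α y : ℂ) * (c (2 * y) * g 0) := by
      filter_upwards [mulOp_coeFn .rfl α Z.1.diag, hZ.diag] with y h3 h4
      rw [h3, h4, rotatedProd, sub_self, ← two_mul]
    have hi : Integrable fun y : ℝ => (ε / 2 * √Γ) ^ 2 * ‖c (2 * y)‖ ^ 2 := by
      refine Integrable.const_mul ?_ _
      exact ((hc.continuous.norm.pow 2).integrable_of_hasCompactSupport
        (hasCompactSupport_norm_sq hcc)).comp_mul_left' two_ne_zero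
    rw [norm_sq_eq_integral e, hv]
    calc ∫ y in Ici (0 : ℝ), ‖(α y : ℂ) * (c (2 * y) * g 0)‖ ^ 2
        ≤ ∫ y in Ici (0 : ℝ), (ε / 2 * √Γ) ^ 2 * ‖c (2 * y)‖ ^ 2 := by
          refine integral_mono_of_nonneg (ae_of_all _ fun y => sq_nonneg _) hi.integrableOn ?_
          filter_upwards [ae_restrict_of_ae hR₀] with y hy
          rcases le_or_gt R₀ y with h | h
          · rw [← mul_pow]
            refine pow_le_pow_left₀ (norm_nonneg _) ?_ 2
            rw [norm_mul, norm_mul, Complex.norm_real, Real.norm_eq_abs, mul_left_comm, mul_comm]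
            exact mul_le_mul_of_nonneg_right (hy h) (norm_nonneg _)
          · rw [hc0 (2 * y) (by linarith [le_max_right (2 * d) (2 * R₀)])]
            simp
      _ ≤ ∫ y : ℝ, (ε / 2 * √Γ) ^ 2 * ‖c (2 * y)‖ ^ 2 :=
          setIntegral_le_integral hi (ae_of_all _ fun y => by positivity)
      _ = (ε / 2) ^ 2 * (1 / 2 * N * Γ) := by
          rw [integral_const_mul, Measure.integral_comp_mul_left (fun s => ‖c s‖ ^ 2) 2, mul_pow,
            Real.sq_sqrt hΓ.le, smul_eq_mul, abs_of_pos (by norm_num)]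
          ring
  refine ⟨U, fun h0 => ?_, fun X => ?_⟩
  · rw [valL_apply, hU] at h0
    rw [h0, norm_zero] at hv
    have : 0 < 1 / 2 * N * Γ := by positivity
    norm_num at hv
    rcases hv with h | h <;> linarith
  · have hn := norm_sq_formDomain X
    have n1 : ‖(jetL d X).val‖ ≤ ‖X‖ := 
      (pow_le_pow_iff_left₀ (norm_nonneg _) (norm_nonneg _) two_ne_zero).1 (by nlinarith)
    have n2 : ‖(jetL d X).diag‖ ≤ ‖X‖ := 
      (pow_le_pow_iff_left₀ (norm_nonneg _) (norm_nonneg _) two_ne_zero).1 (by nlinarith)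
    have e : inner ℂ X (formOp d σ α U) - lam * inner ℂ (valL d X) (valL d U) =
        inner ℂ (jetL d X).val (W - (lam : ℂ) • Z.1.val) +
          inner ℂ (jetL d X).diag (mulOp .rfl α Z.1.diag) := by
      rw [inner_formOp, form_eq_inner, valL_apply, valL_apply, hU,
        hWg _ (jetL_inFormDomain X), hb, hlf, map_zero, inner_zero_right, inner_zero_right,
        inner_sub_right, inner_smul_right]
      ring
    rw [e, valL_apply, hU]
    refine (norm_add_le _ _).trans ?_
    have m1 := (norm_inner_le_norm (𝕜 := ℂ) (jetL d X).val (W - (lam : ℂ) • Z.1.val)).trans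
      (mul_le_mul n1 hrem (norm_nonneg _) (norm_nonneg _))
    have m2 := (norm_inner_le_norm (𝕜 := ℂ) (jetL d X).diag (mulOp .rfl α Z.1.diag)).trans
      (mul_le_mul n2 hdiag (norm_nonneg _) (norm_nonneg _))
    linarith

/-- A Dirichlet mode `h` of `(-d, d)` produces the half-line `[2 ν², ∞)` in the spectrum, provided
that `α` is small at infinity or `h` vanishes at `0`. -/
theorem mem_opSpectrum_of_mode (hd : 0 < d) (σ α : LInftyRay) {h : ℝ → ℂ}
    (hh : ContDiff ℝ ∞ h) (h1 : h d = 0) (h1' : h (-d) = 0) {ν : ℝ}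
    (h2 : ∀ t, deriv (deriv h) t = -(ν : ℂ) ^ 2 * h t) {t : ℝ} (ht : t ∈ Ioo (-d) d)
    (ht0 : h t ≠ 0)
    (hα : ∀ ε : ℝ, 0 < ε → ∃ R : ℝ, ∀ᵐ y : ℝ, R ≤ y → |α y| * ‖h 0‖ ≤ ε)
    {lam : ℝ} (hl : 2 * ν ^ 2 ≤ lam) : (lam : ℂ) ∈ opSpectrum (operator d σ α) := by
  obtain ⟨g, hg, hgc, hgh⟩ := exists_transverse hd hh h2
  have a1 : |d| ≤ d := by rw [abs_of_pos hd]
  have a2 : |-d| ≤ d := by rw [abs_neg, abs_of_pos hd]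
  refine mem_opSpectrum_of_transverse hd σ α hg hgc ((hgh d a1).1.trans h1)
    ((hgh (-d) a2).1.trans h1') (fun t ht => (hgh t ht).2) ?_ ?_ hl
  · rw [integral_Icc_eq_integral_Ioc, ← intervalIntegral.integral_of_le (by linarith)]
    refine intervalIntegral.integral_pos (by linarith) (hg.continuous.norm.pow 2).continuousOn
      (fun x _ => sq_nonneg _) ⟨t, Ioo_subset_Icc_self ht, ?_⟩
    rw [(hgh t (abs_le.2 ⟨ht.1.le, ht.2.le⟩)).1]
    have := norm_pos_iff.2 ht0
    positivity
  · rwa [(hgh 0 (by rw [abs_zero]; exact hd.le)).1]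

theorem contDiff_sin_mul (ν : ℝ) : ContDiff ℝ ∞ fun t : ℝ => Complex.sin ((ν : ℂ) * t) :=
  (Complex.contDiff_sin.restrict_scalars ℝ).comp
    (contDiff_const.mul Complex.ofRealCLM.contDiff)

theorem contDiff_cos_mul (ν : ℝ) : ContDiff ℝ ∞ fun t : ℝ => Complex.cos ((ν : ℂ) * t) :=
  (Complex.contDiff_cos.restrict_scalars ℝ).comp
    (contDiff_const.mul Complex.ofRealCLM.contDiff)

theorem hasDerivAt_sin_mul (ν t : ℝ) : HasDerivAt (fun t : ℝ => Complex.sin ((ν : ℂ) * t))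
    (Complex.cos ((ν : ℂ) * t) * ν) t := by
  have h : HasDerivAt (fun t : ℝ => (ν : ℂ) * t) (ν : ℂ) t := by
    simpa using (hasDerivAt_id t).ofReal_comp.const_mul (ν : ℂ)
  exact (Complex.hasDerivAt_sin _).comp t h

theorem hasDerivAt_cos_mul (ν t : ℝ) : HasDerivAt (fun t : ℝ => Complex.cos ((ν : ℂ) * t))
    (-Complex.sin ((ν : ℂ) * t) * ν) t := by
  have h : HasDerivAt (fun t : ℝ => (ν : ℂ) * t) (ν : ℂ) t := by
    simpa using (hasDerivAt_id t).ofReal_comp.const_mul (ν : ℂ)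
  exact (Complex.hasDerivAt_cos _).comp t h

theorem deriv_deriv_sin_mul (ν t : ℝ) :
    deriv (deriv fun t : ℝ => Complex.sin ((ν : ℂ) * t)) t =
      -(ν : ℂ) ^ 2 * Complex.sin ((ν : ℂ) * t) := by
  rw [funext fun t => (hasDerivAt_sin_mul ν t).deriv,
    ((hasDerivAt_cos_mul ν t).mul_const _).deriv]
  ring

theorem deriv_deriv_cos_mul (ν t : ℝ) :
    deriv (deriv fun t : ℝ => Complex.cos ((ν : ℂ) * t)) t =
      -(ν : ℂ) ^ 2 * Complex.cos ((ν : ℂ) * t) := by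
  rw [funext fun t => (hasDerivAt_cos_mul ν t).deriv,
    ((hasDerivAt_sin_mul ν t).fun_neg.mul_const _).deriv]
  ring

/-- The odd mode `sin (π t / d)` vanishes on the diagonal and is therefore insensitive to `α`. -/
theorem subset_essentialSpectrum_of_odd_mode (hd : 0 < d) (σ α : LInftyRay) :
    Complex.ofReal '' Ici (2 * Real.pi ^ 2 / d ^ 2) ⊆ essentialSpectrum (operator d σ α) := by
  refine subset_essentialSpectrum fun lam hlam => ?_
  refine mem_opSpectrum_of_mode (ν := Real.pi / d) (t := d / 2) hd σ α
    (h := fun t => Complex.sin (((Real.pi / d : ℝ) : ℂ) * t))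
    (contDiff_sin_mul _) ?_ ?_ (deriv_deriv_sin_mul _)
    ⟨by linarith, by linarith⟩ ?_ (fun ε hε => ⟨0, ?_⟩) ?_
  · rw [← Complex.ofReal_mul, div_mul_cancel₀ _ hd.ne', Complex.sin_pi]
  · rw [← Complex.ofReal_mul, mul_neg, div_mul_cancel₀ _ hd.ne', Complex.ofReal_neg,
      Complex.sin_neg, Complex.sin_pi, neg_zero]
  · rw [← Complex.ofReal_mul, show Real.pi / d * (d / 2) = Real.pi / 2 by field_simp,
      Complex.ofReal_div, Complex.ofReal_ofNat, Complex.sin_pi_div_two]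
    exact one_ne_zero
  · refine ae_of_all _ fun y _ => ?_
    simpa using hε.le
  · refine le_trans (le_of_eq ?_) hlam
    rw [div_pow]
    ring

/-- The mode is `cos (π t / (2 d))`, the lowest one. -/
theorem subset_essentialSpectrum_of_even_mode (hd : 0 < d) (σ α : LInftyRay)
    (hα : ∀ ε : ℝ, 0 < ε → ∃ R : ℝ, 0 ≤ R ∧ ∀ᵐ y : ℝ, R ≤ y → |α y| < ε) :
    Complex.ofReal '' Ici (Real.pi ^ 2 / (2 * d ^ 2)) ⊆ essentialSpectrum (operator d σ α) := by
  refine subset_essentialSpectrum fun lam hlam => ?_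
  have e2 : Real.pi / (2 * d) * d = Real.pi / 2 := by field_simp
  refine mem_opSpectrum_of_mode (ν := Real.pi / (2 * d)) (t := 0) hd σ α
    (h := fun t => Complex.cos (((Real.pi / (2 * d) : ℝ) : ℂ) * t))
    (contDiff_cos_mul _) ?_ ?_ (deriv_deriv_cos_mul _)
    ⟨by linarith, by linarith⟩ ?_ (fun ε hε => ?_) ?_
  · rw [← Complex.ofReal_mul, e2, Complex.ofReal_div, Complex.ofReal_ofNat,
      Complex.cos_pi_div_two]
  · rw [← Complex.ofReal_mul, mul_neg, e2, Complex.ofReal_neg, Complex.cos_neg,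
      Complex.ofReal_div, Complex.ofReal_ofNat, Complex.cos_pi_div_two]
  · simp
  · obtain ⟨R, -, hR⟩ := hα ε hε
    refine ⟨R, ?_⟩
    filter_upwards [hR] with y hy h
    simpa using (hy h).le
  · refine le_trans (le_of_eq ?_) hlam
    field_simp

end

end Pencil

end

theorem mainTheorem7 (d : ℝ) (hd : 0 < d) (σ α : Pencil.LInftyRay) :
    Complex.ofReal '' Set.Ici (2 * Real.pi ^ 2 / d ^ 2) ⊆
        Pencil.essentialSpectrum (Pencil.operator d σ α) ∧
      ((∀ ε : ℝ, 0 < ε → ∃ R : ℝ, 0 ≤ R ∧ ∀ᵐ y : ℝ, R ≤ y → |α y| < ε) →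
        Pencil.essentialSpectrum (Pencil.operator d σ α) =
          Complex.ofReal '' Set.Ici (Real.pi ^ 2 / (2 * d ^ 2))) :=
  ⟨Pencil.subset_essentialSpectrum_of_odd_mode hd σ α, fun hα =>
    (Pencil.essentialSpectrum_subset hd σ α hα).antisymm
      (Pencil.subset_essentialSpectrum_of_even_mode hd σ α hα)⟩
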